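/- **Setting.** For every sample size $n$ let $p=p_n\in\{1,2,\dots\}\cup\{\infty\}$ and consider a linear model on $\mathbb R^p$ (on $\ell^2$ if $p=\infty$); all objects below may depend on $n$, except the constants $\sigma_x$ and $b$. The inputs $x_1,\dots,x_n$ are i.i.d. with second moment operator $\Sigma=\mathbb E[xx^T]=\sum_i\lambda_i v_iv_i^T$, where $(v_i)$ is an orthonormal basis, $\lambda_1\ge\lambda_2\ge\dots>0$ and $\sum_i\lambda_i<\infty$; the whitened coordinates $\langle v_i,x\rangle/\sqrt{\lambda_i}$ are independent, have mean zero and unit variance, and are $\sigma_x$-subgaussian. The parameter $\theta$ is independent of the inputs; it is obtained from a fixed vector of finite nonzero norm, with coordinates $\tilde\theta_i$ in the basis $(v_i)$, by flipping the sign of every $\tilde\theta_i$ independently with probability $1/2$. Given $\theta$, the pairs $(x_i,y_i)$ are i.i.d. with $\mathbb E[y_i\mid x_i,\theta]=x_i^T\theta$ and $\mathbb E[(y_i-x_i^T\theta)^2\mid x_i,\theta]=\sigma^2>0$. Let $X=[x_1,\dots,x_n]^T$, and let $\hat\theta=X^T(XX^T)^\dagger y$ be the min-norm (ridgeless) estimator,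 with $\dagger$ the Moore–Penrose pseudoinverse. Its standard risk and its adversarial risk with budget $\alpha>0$ are the functions of $X$ $$R^{\rm std}=\mathbb E_\theta\mathbb E_y\mathbb E_{x_\star}\big[(x_\star^T\hat\theta-x_\star^T\theta)^2\big],\qquad R^{\rm adv}_\alpha=\mathbb E_\theta\mathbb E_y\mathbb E_{x_\star}\Big[\sup_{\|\delta\|_2\le\alpha}\big((x_\star+\delta)^T\hat\theta-x_\star^T\theta\big)^2\Big],$$ where $x_\star$ is an independent copy of $x_1$. Put $$r_k=\frac{\sum_{i>k}\lambda_i}{\lambda_{k+1}},\qquad R_k=\frac{(\sum_{i>k}\lambda_i)^2}{\sum_{i>k}\lambda_i^2},\qquad k^*=k^*(b)=\inf\{k\ge0: r_k\ge bn\}.$$ **Theorem.** Suppose that for some constant $b>0$ the benign overfitting condition holds ($k^*$ is finite for all large $n$, and) $$\lim_{n\to\infty}\sum_{i>k^*}\lambda_i\tilde\theta_i^2=\lim_{n\to\infty}\Big(\frac{\lambda_{k^*+1}r_{k^*}}n\Big)^2\sum_{i\le k^*}\frac{\tilde\theta_i^2}{\lambda_i}=\lim_{n\to\infty}\frac{k^*}n=\lim_{n\to\infty}\frac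 n{R_{k^*}}=0,$$ and that $\sigma^2=\omega(\lambda_{k^*+1}r_{k^*}/n)$, i.e. $\sigma^2/(\lambda_{k^*+1}r_{k^*}/n)\to\infty$. Then, as $n\to\infty$, for every budget $\alpha>0$ (which may depend on $n$), $$\frac{R^{\rm adv}_\alpha}{\alpha^2}\to\infty\quad\text{in probability},$$ and, provided that the noise level $\sigma^2=\sigma_n^2$ stays bounded as $n$ varies (for instance, is constant), $R^{\rm std}\to0$ in probability. -/

import Mathlib

open MeasureTheory ProbabilityTheory Filter Topology
open scoped NNReal ENNReal Matrix RealInnerProductSpace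

noncomputable section

/-! ## Moore-Penrose pseudoinverse of a symmetric matrix -/

/-- The four Penrose equations: `B` is the Moore-Penrose pseudoinverse of the real matrix `A`. -/
structure IsMoorePenrose {n : ℕ} (A B : Matrix (Fin n) (Fin n) ℝ) : Prop where
  mul_mul_left : A * B * A = A
  mul_mul_right : B * A * B = B
  symm_left : (A * B).IsHermitian
  symm_right : (B * A).IsHermitian

/-- The pseudoinverse of a symmetric matrix: keep the eigenvectors, invert the nonzero eigenvalues
and leave the zero eigenvalues (recall `0⁻¹ = 0`). Only used for symmetric matrices. -/
def symPinv {n : ℕ} (A : Matrix (Fin n) (Fin n) ℝ) : Matrix (Fin n) (Fin n) ℝ :=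
  cfc (fun t : ℝ => t⁻¹) A

/-- `symPinv A` satisfies the Penrose equations. -/
theorem symPinv_isMoorePenrose {n : ℕ} {A : Matrix (Fin n) (Fin n) ℝ} (hA : A.IsHermitian) :
    IsMoorePenrose A (symPinv A) := by
  have hsa : IsSelfAdjoint A := hA
  have hc : ∀ f : ℝ → ℝ, ContinuousOn f (spectrum ℝ A) := fun f =>
    (Set.Finite.continuousOn (Matrix.finite_real_spectrum) f)
  have hid : cfc (fun t : ℝ => t) A = A := cfc_id' ℝ A
  have hAB : A * symPinv A = cfc (fun t : ℝ => t * t⁻¹) A := by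
    rw [cfc_mul (fun t : ℝ => t) (fun t : ℝ => t⁻¹) A (hc _) (hc _), hid, symPinv]
  have hBA : symPinv A * A = cfc (fun t : ℝ => t⁻¹ * t) A := by
    rw [cfc_mul (fun t : ℝ => t⁻¹) (fun t : ℝ => t) A (hc _) (hc _), hid, symPinv]
  refine ⟨?_, ?_, ?_, ?_⟩
  · calc A * symPinv A * A = cfc (fun t : ℝ => t * t⁻¹ * t) A := by
          rw [cfc_mul (fun t : ℝ => t * t⁻¹) (fun t : ℝ => t) A (hc _) (hc _), hid, hAB]
      _ = A := by simp only [mul_inv_mul_cancel]; exact hid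
  · calc symPinv A * A * symPinv A = cfc (fun t : ℝ => t⁻¹ * t * t⁻¹) A := by
          rw [cfc_mul (fun t : ℝ => t⁻¹ * t) (fun t : ℝ => t⁻¹) A (hc _) (hc _), hBA, symPinv]
      _ = symPinv A := by
          have h : (fun t : ℝ => t⁻¹ * t * t⁻¹) = fun t : ℝ => t⁻¹ := by
            funext t
            rcases eq_or_ne t 0 with rfl | ht
            · simp
            · rw [inv_mul_cancel₀ ht, one_mul]
          rw [h, symPinv]
  · rw [hAB]; exact cfc_predicate (R := ℝ) _ A
  · rw [hBA]; exact cfc_predicate (R := ℝ) _ A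

/-! ## The ridge estimator -/

/-- The ridge estimator `Xᵀ (X Xᵀ + n lam I)† y`, where the rows of `X` are the inputs
`X 0, …, X (n-1)`, so that `X Xᵀ` is their Gram matrix and `Xᵀ a = ∑ i, a i • X i`.
For `lam = 0` it is the min-norm (ridgeless) estimator. -/
def ridge {H : Type*} [NormedAddCommGroup H] [InnerProductSpace ℝ H] {n : ℕ} (lam : ℝ)
    (X : Fin n → H) (y : Fin n → ℝ) : H :=
  ∑ i, (symPinv (Matrix.gram ℝ X + ((n : ℝ) * lam) • (1 : Matrix (Fin n) (Fin n) ℝ)) *ᵥ y) i • X i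

/-! ## The linear model -/

/-- Coordinate labels `{i : ℕ | i < p}` for a dimension `p ∈ {0, 1, 2, …, ∞}`. -/
abbrev CoordIdx (p : ℕ∞) : Type := {i : ℕ // (i : ℕ∞) < p}

/-- The linear model with `σx`-subgaussian design over a real Hilbert space `H` of dimension `p`
(so `H` is `ℝ^p`, or `ℓ²` if `p = ∞`). Indices start at `0`: `eig i` is the `(i+1)`-st
largest eigenvalue of the second moment operator of the inputs. -/
structure LinearModel (H : Type*) [NormedAddCommGroup H] [InnerProductSpace ℝ H]
    [MeasurableSpace H] [BorelSpace H] (σx : ℝ≥0) where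
  /-- the dimension -/
  p : ℕ∞
  /-- the eigenvalues in decreasing order, continued by zero beyond the dimension -/
  eig : ℕ → ℝ
  eig_pos : ∀ i : ℕ, (i : ℕ∞) < p → 0 < eig i
  eig_eq_zero : ∀ i : ℕ, p ≤ (i : ℕ∞) → eig i = 0
  eig_antitone : Antitone eig
  eig_summable : Summable eig
  /-- the orthonormal basis of eigenvectors -/
  basis : HilbertBasis (CoordIdx p) ℝ H
  /-- the law of an input -/
  inputLaw : Measure H
  inputLaw_prob : IsProbabilityMeasure inputLaw
  /-- the whitened coordinates `⟪v i, x⟫ / √(eig i)` are independent -/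
  white_indep : iIndepFun (fun (i : CoordIdx p) (x : H) => ⟪basis i, x⟫ / √(eig i)) inputLaw
  white_mean : ∀ i : CoordIdx p, ∫ x, ⟪basis i, x⟫ / √(eig i) ∂inputLaw = 0
  white_var : ∀ i : CoordIdx p, ∫ x, (⟪basis i, x⟫ / √(eig i)) ^ 2 ∂inputLaw = 1
  white_subgaussian : ∀ i : CoordIdx p,
    HasSubgaussianMGF (fun x : H => ⟪basis i, x⟫ / √(eig i)) (σx ^ 2) inputLaw
  /-- the parameter, up to the signs of its coordinates in the eigenbasis -/
  truth : H
  truth_ne_zero : truth ≠ 0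
  /-- the law of the parameter: every coordinate of `truth` in the eigenbasis is multiplied by an
  independent fair random sign -/
  prior : Measure H
  prior_prob : IsProbabilityMeasure prior
  prior_indep : iIndepFun (fun (i : CoordIdx p) (θ : H) => ⟪basis i, θ⟫) prior
  prior_sign : ∀ i : CoordIdx p, prior.map (fun θ : H => ⟪basis i, θ⟫) =
    (2⁻¹ : ℝ≥0∞) • Measure.dirac ⟪basis i, truth⟫ +
      (2⁻¹ : ℝ≥0∞) • Measure.dirac (-⟪basis i, truth⟫)
  /-- the standard deviation of the noise -/
  noise : ℝ
  noise_pos : 0 < noise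
  /-- the conditional law of a label, given the input `x` and the parameter `θ` -/
  labelLaw : Kernel (H × H) ℝ
  labelLaw_markov : IsMarkovKernel labelLaw
  label_memLp : ∀ᵐ q ∂(inputLaw.prod prior), MemLp id 2 (labelLaw q)
  label_mean : ∀ᵐ q ∂(inputLaw.prod prior), ∫ y, y ∂(labelLaw q) = ⟪q.1, q.2⟫
  label_var : ∀ᵐ q ∂(inputLaw.prod prior), ∫ y, (y - ⟪q.1, q.2⟫) ^ 2 ∂(labelLaw q) = noise ^ 2

namespace LinearModel

variable {H : Type*} [NormedAddCommGroup H] [InnerProductSpace ℝ H] [MeasurableSpace H]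
  [BorelSpace H] {σx : ℝ≥0}

/-- The coordinates of the parameter in the eigenbasis (up to sign), continued by zero. -/
def coef (M : LinearModel H σx) (i : ℕ) : ℝ :=
  if h : (i : ℕ∞) < M.p then ⟪M.basis ⟨i, h⟩, M.truth⟫ else 0

/-- The sum of all eigenvalues but the `k` largest; it equals `λ_{k+1} r_k`. -/
def tail (M : LinearModel H σx) (k : ℕ) : ℝ := ∑' i, M.eig (k + i)

/-- Effective rank `r_k`. It is `0` for `k ≥ p`, where `λ_{k+1}` does not exist. -/
def rankr (M : LinearModel H σx) (k : ℕ) : ℝ := M.tail k / M.eig k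

/-- Effective rank `R_k`. -/
def rankR (M : LinearModel H σx) (k : ℕ) : ℝ := M.tail k ^ 2 / ∑' i, M.eig (k + i) ^ 2

/-- The critical index `k*(b) = inf {k ≥ 0 | r_k ≥ b n}`. -/
def critIndex (M : LinearModel H σx) (b : ℝ) (n : ℕ) : ℕ := sInf {k : ℕ | b * n ≤ M.rankr k}

/-- The law of `n` independent inputs. -/
def designLaw (M : LinearModel H σx) (n : ℕ) : Measure (Fin n → H) :=
  Measure.pi fun _ => M.inputLaw

/-- The law of the labels of the inputs `X`, given the parameter `θ`. -/
def labelsLaw (M : LinearModel H σx) {n : ℕ} (X : Fin n → H) (θ : H) : Measure (Fin n → ℝ) :=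
  Measure.pi fun i => M.labelLaw (X i, θ)

/-- The standard risk of an estimator, as a function of the training inputs `X`: the average over
the parameter `θ`, the training labels `y` and a fresh input `x`. -/
def stdRisk (M : LinearModel H σx) {n : ℕ} (est : (Fin n → H) → (Fin n → ℝ) → H)
    (X : Fin n → H) : ℝ≥0∞ :=
  ∫⁻ θ, ∫⁻ y, ∫⁻ x, ENNReal.ofReal ((⟪x, est X y⟫ - ⟪x, θ⟫) ^ 2)
    ∂M.inputLaw ∂(M.labelsLaw X θ) ∂M.prior

/-- The adversarial risk with budget `α`, as a function of the training inputs `X`. -/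
def advRisk (M : LinearModel H σx) {n : ℕ} (α : ℝ) (est : (Fin n → H) → (Fin n → ℝ) → H)
    (X : Fin n → H) : ℝ≥0∞ :=
  ∫⁻ θ, ∫⁻ y, ∫⁻ x, ⨆ (δ : H) (_ : ‖δ‖ ≤ α),
      ENNReal.ofReal ((⟪x + δ, est X y⟫ - ⟪x, θ⟫) ^ 2)
    ∂M.inputLaw ∂(M.labelsLaw X θ) ∂M.prior

end LinearModel

/-- The benign overfitting condition with constant `b` for a sequence of models, the `n`-th of
which is used with sample size `n`. The first clause says that the infimum defining the critical
index is over a nonempty set, i.e. that the critical index is finite. -/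
structure BenignOverfitting {σx : ℝ≥0} {H : ℕ → Type*} [∀ n, NormedAddCommGroup (H n)]
    [∀ n, InnerProductSpace ℝ (H n)] [∀ n, MeasurableSpace (H n)] [∀ n, BorelSpace (H n)]
    (M : ∀ n, LinearModel (H n) σx) (b : ℝ) : Prop where
  finite_index : ∀ᶠ n in atTop, ∃ k : ℕ, b * n ≤ (M n).rankr k
  tail_signal : Tendsto (fun n : ℕ =>
    ∑' i, (M n).eig ((M n).critIndex b n + i) * (M n).coef ((M n).critIndex b n + i) ^ 2)
    atTop (𝓝 0)
  head_signal : Tendsto (fun n : ℕ =>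
    ((M n).eig ((M n).critIndex b n) * (M n).rankr ((M n).critIndex b n) / n) ^ 2 *
      ∑ i ∈ Finset.range ((M n).critIndex b n), (M n).coef i ^ 2 / (M n).eig i)
    atTop (𝓝 0)
  index_small : Tendsto (fun n : ℕ => ((M n).critIndex b n : ℝ) / n) atTop (𝓝 0)
  rank_large : Tendsto (fun n : ℕ => (n : ℝ) / (M n).rankR ((M n).critIndex b n)) atTop (𝓝 0)

/-- `f n → 0` in probability, where `f n` is a `[0, ∞]`-valued function on the space of `P n`. -/
def TendstoZeroInProb {Ω : ℕ → Type*} [∀ n, MeasurableSpace (Ω n)] (P : ∀ n, Measure (Ω n))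
    (f : ∀ n, Ω n → ℝ≥0∞) : Prop :=
  ∀ ε : ℝ≥0∞, 0 < ε → Tendsto (fun n => P n {ω | ε ≤ f n ω}) atTop (𝓝 0)

/-- `f n → ∞` in probability, where `f n` is a `[0, ∞]`-valued function on the space of `P n`. -/
def TendstoInftyInProb {Ω : ℕ → Type*} [∀ n, MeasurableSpace (Ω n)] (P : ∀ n, Measure (Ω n))
    (f : ∀ n, Ω n → ℝ≥0∞) : Prop :=
  ∀ C : ℝ≥0, Tendsto (fun n => P n {ω | f n ω ≤ (C : ℝ≥0∞)}) atTop (𝓝 0)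

end

/-! ## Nets of the unit sphere -/

section Nets

open Metric Module

variable {E : Type*} [NormedAddCommGroup E] [NormedSpace ℝ E]

variable {F : Type*} [NormedAddCommGroup F] [NormedSpace ℝ F]

/-! Write k for the critical index and t for `tail k`, which is λ_{k+1} r_k. Split every input into
a head (its first k coordinates, whitened) and a tail. On an event of probability tending to one,
two facts hold: the quadratic form of the whitened heads is of order n in every direction
(`HeadBounds`), and the Gram matrix of the tails lies between t/16 and a constant times t
(`TailBounds`). The tail thus acts like a ridge penalty of size t on a well conditioned
k-dimensional regression.

Both facts come from `measure_not_array_bounds_le`: Chernoff bounds for weighted sums of squares in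
a fixed direction, made uniform by nets of the sphere. The two tails behave differently. The upper
one has exponent L r_k with L at the prover's disposal, at the cost of a larger constant, so r_k ≥
bn beats a net of 6^n points. The lower one has exponent of order R_k with a fixed factor, so it
needs n/R_k → 0. In infinite dimension the far tail is cut off and controlled by Markov's
inequality.

Adversarial risk: perturbing along the estimator gives at least α² times its mean squared norm
(`le_iSup_shifted_sq`). The noise alone contributes σ² times the sum of the squared norms of the
interpolators of the n unit label vectors. Their heads absorb little since k/n is small, so each
tail must on average interpolate a fixed share of a unit vector with vectors of squared size about
t; the sum is at least of order n/t (`le_sum_tail_norm_sq`), and σ²n/t tends to infinity.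

Standard risk: the same vectors count here only with the eigenvalues as weights. The variance is at
most of order k/n from the head (`sum_head_sq_le`) plus, after averaging over the inputs, n/R_k from
the tail (`sum_sq_dot_le`). An energy estimate (`tail_norm_sq_le`), with λ_{k+1} ≤ t/(bn), bounds
the bias by the two signal terms of the benign overfitting condition. The random signs enter only
through the squared coordinates of the parameter, which are almost surely fixed. Markov's inequality
turns the averages into convergence in probability. -/

theorem norm_map_le_of_norm_one {T : E →ₗ[ℝ] F} {m : ℝ} (h : ∀ v, ‖v‖ = 1 → ‖T v‖ ≤ m) (v : E) :
    ‖T v‖ ≤ m * ‖v‖ := by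
  rcases eq_or_ne v 0 with rfl | hv
  · simp
  have hv' : 0 < ‖v‖ := norm_pos_iff.2 hv
  have := h (‖v‖⁻¹ • v) (by rw [norm_smul, norm_inv, norm_norm, inv_mul_cancel₀ hv'.ne'])
  rw [map_smul, norm_smul, norm_inv, norm_norm, inv_mul_le_iff₀ hv'] at this
  linarith

theorem le_norm_map_of_norm_one {T : E →ₗ[ℝ] F} {m : ℝ} (h : ∀ v, ‖v‖ = 1 → m ≤ ‖T v‖) (v : E) :
    m * ‖v‖ ≤ ‖T v‖ := by
  rcases eq_or_ne v 0 with rfl | hv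
  · simp
  have hv' : 0 < ‖v‖ := norm_pos_iff.2 hv
  have := h (‖v‖⁻¹ • v) (by rw [norm_smul, norm_inv, norm_norm, inv_mul_cancel₀ hv'.ne'])
  rw [map_smul, norm_smul, norm_inv, norm_norm, le_inv_mul_iff₀ hv'] at this
  linarith

/-- Lower bound for a linear map of norm at most `m` from its values on a net. -/
theorem le_norm_map_of_net {T : E →ₗ[ℝ] F} {l m δ : ℝ} {s : Finset E} (hm : 0 ≤ m)
    (hnet : ∀ v : E, ‖v‖ = 1 → ∃ c ∈ s, ‖v - c‖ ≤ δ)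
    (hT : ∀ v, ‖T v‖ ≤ m * ‖v‖) (h : ∀ c ∈ s, l ≤ ‖T c‖) (v : E) :
    (l - m * δ) * ‖v‖ ≤ ‖T v‖ := by
  refine le_norm_map_of_norm_one (fun v hv => ?_) v
  obtain ⟨c, hc, hvc⟩ := hnet v hv
  have h1 : ‖T c‖ ≤ ‖T v‖ + ‖T (v - c)‖ := by
    calc ‖T c‖ = ‖T v - T (v - c)‖ := by rw [← map_sub]; simp
      _ ≤ _ := norm_sub_le _ _
  have h2 : ‖T (v - c)‖ ≤ m * δ := (hT _).trans (by gcongr)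
  linarith [h c hc]

variable [FiniteDimensional ℝ E]

/-- A `δ`-separated subset of the unit ball of a `d`-dimensional space has at most `(3 / δ) ^ d`
elements. -/
theorem card_le_of_separated_in_ball {δ : ℝ} (hδ : 0 < δ) (hδ1 : δ ≤ 1) (s : Finset E)
    (hs : ∀ c ∈ s, ‖c‖ ≤ 1) (h : ∀ c ∈ s, ∀ d ∈ s, c ≠ d → δ ≤ ‖c - d‖) :
    (s.card : ℝ) ≤ (3 / δ) ^ finrank ℝ E := by
  borelize E
  let μ : Measure E := Measure.addHaar
  have hδ2 : 0 < δ / 2 := by positivity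
  have hρ : 0 < 1 + δ / 2 := by positivity
  -- Volume comparison: the balls of radius δ/2 around the points are disjoint and lie in the ball
  -- of radius 1 + δ/2.
  set A := ⋃ c ∈ s, ball (c : E) (δ / 2) with hA
  have hdisj : Set.Pairwise (s : Set E)
      (Function.onFun Disjoint fun c => ball (c : E) (δ / 2)) := by
    rintro c hc d hd hcd
    apply ball_disjoint_ball
    rw [dist_eq_norm]
    linarith [h c hc d hd hcd]
  have hsub : A ⊆ ball (0 : E) (1 + δ / 2) := by
    refine Set.iUnion₂_subset fun x hx => ?_
    apply ball_subset_ball'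
    rw [dist_zero_right]
    linarith [hs x hx]
  have hvol : (s.card : ℝ≥0∞) * ENNReal.ofReal ((δ / 2) ^ finrank ℝ E) * μ (ball 0 1) ≤
      ENNReal.ofReal ((1 + δ / 2) ^ finrank ℝ E) * μ (ball 0 1) :=
    calc
      (s.card : ℝ≥0∞) * ENNReal.ofReal ((δ / 2) ^ finrank ℝ E) * μ (ball 0 1) = μ A := by
        rw [hA, measure_biUnion_finset hdisj fun c _ => measurableSet_ball]
        simp only [μ.addHaar_ball_of_pos _ hδ2]
        simp only [Finset.sum_const, nsmul_eq_mul, mul_assoc]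
      _ ≤ μ (ball (0 : E) (1 + δ / 2)) := measure_mono hsub
      _ = _ := by simp only [μ.addHaar_ball_of_pos _ hρ]
  have hcard : (s.card : ℝ≥0∞) * ENNReal.ofReal ((δ / 2) ^ finrank ℝ E) ≤
      ENNReal.ofReal ((1 + δ / 2) ^ finrank ℝ E) :=
    (ENNReal.mul_le_mul_iff_left (measure_ball_pos _ _ zero_lt_one).ne' measure_ball_lt_top.ne).1
      hvol
  have hreal := ENNReal.toReal_le_of_le_ofReal (pow_nonneg hρ.le _) hcard
  rw [ENNReal.toReal_mul, ENNReal.toReal_natCast, ENNReal.toReal_ofReal (by positivity)] at hreal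
  calc (s.card : ℝ) ≤ (1 + δ / 2) ^ finrank ℝ E / (δ / 2) ^ finrank ℝ E := by
        rwa [le_div_iff₀ (by positivity)]
    _ = ((1 + δ / 2) / (δ / 2)) ^ finrank ℝ E := (div_pow _ _ _).symm
    _ ≤ (3 / δ) ^ finrank ℝ E := by
        gcongr ?_ ^ _
        rw [div_le_div_iff₀ hδ2 hδ]
        nlinarith

/-- The unit sphere of a `d`-dimensional space has a `δ`-net of at most `(3 / δ) ^ d` points. -/
theorem exists_sphere_net {δ : ℝ} (hδ : 0 < δ) (hδ1 : δ ≤ 1) :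
    ∃ s : Finset E, (∀ c ∈ s, ‖c‖ = 1) ∧ (∀ v : E, ‖v‖ = 1 → ∃ c ∈ s, ‖v - c‖ ≤ δ) ∧
      (s.card : ℝ) ≤ (3 / δ) ^ finrank ℝ E := by
  classical
  by_contra! hcon
  -- Greedy construction: a separated set obeys the cardinality bound, so if no set of that size is
  -- a net, some unit vector is far from it and can be added. Separated sets of every size would
  -- then exist.
  have key : ∀ m : ℕ, ∃ s : Finset E, s.card = m ∧ (∀ c ∈ s, ‖c‖ = 1) ∧
      ∀ c ∈ s, ∀ d ∈ s, c ≠ d → δ ≤ ‖c - d‖ := by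
    intro m
    induction m with
    | zero => exact ⟨∅, by simp⟩
    | succ m ih =>
      obtain ⟨s, hm, h1, hsep⟩ := ih
      have hcard := card_le_of_separated_in_ball hδ hδ1 s (fun c hc => (h1 c hc).le) hsep
      have : ∃ v : E, ‖v‖ = 1 ∧ ∀ c ∈ s, δ < ‖v - c‖ := by
        by_contra! h2
        exact absurd hcard (not_le.2 (hcon s h1 h2))
      obtain ⟨v, hv, hvs⟩ := this
      have hvn : v ∉ s := fun hmem => by
        have := hvs v hmem
        simp at this
        linarith
      refine ⟨insert v s, by rw [Finset.card_insert_of_notMem hvn, hm], ?_, ?_⟩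
      · intro c hc
        rcases Finset.mem_insert.1 hc with rfl | hc
        · exact hv
        · exact h1 c hc
      · intro c hc d hd hcd
        rcases Finset.mem_insert.1 hc with hc' | hc' <;>
          rcases Finset.mem_insert.1 hd with hd' | hd'
        · exact absurd (hc'.trans hd'.symm) hcd
        · rw [hc']; exact (hvs d hd').le
        · rw [hd', norm_sub_rev]; exact (hvs c hc').le
        · exact hsep c hc' d hd' hcd
  obtain ⟨m, hm⟩ := exists_nat_gt ((3 / δ) ^ finrank ℝ E)
  obtain ⟨s, hs, h1, hsep⟩ := key m
  have := card_le_of_separated_in_ball hδ hδ1 s (fun c hc => (h1 c hc).le) hsep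
  rw [hs] at this
  linarith

/-- A linear map bounded by `m` on a `1/2`-net of the unit sphere has norm at most `2 * m`. -/
theorem norm_map_le_of_net {T : E →ₗ[ℝ] F} {m : ℝ} {s : Finset E}
    (hnet : ∀ v : E, ‖v‖ = 1 → ∃ c ∈ s, ‖v - c‖ ≤ 1 / 2)
    (h : ∀ c ∈ s, ‖T c‖ ≤ m) (v : E) : ‖T v‖ ≤ 2 * m * ‖v‖ := by
  let T' : E →L[ℝ] F := LinearMap.toContinuousLinearMap T
  have hT : ∀ v, ‖T v‖ ≤ ‖T'‖ * ‖v‖ := T'.le_opNorm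
  have h1 : ∀ v, ‖v‖ = 1 → ‖T v‖ ≤ m + ‖T'‖ / 2 := by
    intro v hv
    obtain ⟨c, hc, hvc⟩ := hnet v hv
    calc ‖T v‖ = ‖T c + T (v - c)‖ := by rw [← map_add]; simp
      _ ≤ ‖T c‖ + ‖T (v - c)‖ := norm_add_le _ _
      _ ≤ m + ‖T'‖ * (1 / 2) := by
          gcongr
          · exact h c hc
          · exact (hT _).trans (by gcongr)
      _ = _ := by ring
  rcases subsingleton_or_nontrivial E with hE | hE
  · simp [Subsingleton.elim v 0]
  obtain ⟨e, he⟩ := exists_norm_eq E (zero_le_one : (0 : ℝ) ≤ 1)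
  have hnn : 0 ≤ m + ‖T'‖ / 2 := (norm_nonneg _).trans (h1 e he)
  -- The net argument bounds the operator norm by itself; its finiteness, from finite dimension,
  -- allows half of it to be absorbed.
  have h2 : ‖T'‖ ≤ m + ‖T'‖ / 2 := T'.opNorm_le_bound hnn (norm_map_le_of_norm_one h1)
  exact (hT v).trans (by gcongr; linarith)

end Nets

/-! ## Exponential moments and tails of weighted sums of squares -/

section Tails

variable {Ω : Type*} [MeasurableSpace Ω] {P : Measure Ω}

/-- The exponential moment of the square of a subgaussian variable. -/
theorem lintegral_exp_sq_le [IsProbabilityMeasure P] {X : Ω → ℝ} (hXm : Measurable X) {c : ℝ≥0}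
    (hc : 0 < c) (hX : HasSubgaussianMGF X c P) :
    ∫⁻ ω, ENNReal.ofReal (Real.exp (X ω ^ 2 / (4 * c))) ∂P ≤ 2 := by
  have hc' : (0 : ℝ) < c := by exact_mod_cast hc
  -- Gaussian linearization: exp(τ²X²/2) is the mean of exp(τXs) over a standard normal s.
  -- Exchanging the integrals and using subgaussianity leaves the mean of exp(s²/4), which is √2.
  set τ : ℝ := √(1 / (2 * c)) with hτ
  have hτ2 : τ ^ 2 = 1 / (2 * c) := Real.sq_sqrt (by positivity)
  have h1 : ∀ ω, ENNReal.ofReal (Real.exp (X ω ^ 2 / (4 * c))) =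
      ∫⁻ s, ENNReal.ofReal (Real.exp ((τ * X ω) * s)) ∂(gaussianReal 0 1) := by
    intro ω
    rw [← ofReal_integral_eq_lintegral_ofReal (integrable_exp_mul_gaussianReal _)
      (ae_of_all _ fun _ => (Real.exp_pos _).le)]
    have := congrFun (mgf_id_gaussianReal (μ := 0) (v := 1)) (τ * X ω)
    simp only [mgf, id] at this
    rw [this]
    congr 2
    rw [mul_pow, hτ2]
    simp
    field_simp
    ring
  have h2 : ∀ s : ℝ, ∫⁻ ω, ENNReal.ofReal (Real.exp ((τ * X ω) * s)) ∂P ≤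
      ENNReal.ofReal (Real.exp (s ^ 2 / 4)) := by
    intro s
    have h3 : ∀ ω, τ * X ω * s = (τ * s) * X ω := fun ω => by ring
    simp_rw [h3]
    rw [← ofReal_integral_eq_lintegral_ofReal (hX.integrable_exp_mul _)
      (ae_of_all _ fun _ => (Real.exp_pos _).le)]
    apply ENNReal.ofReal_le_ofReal
    refine (hX.mgf_le (τ * s)).trans (le_of_eq ?_)
    congr 1
    rw [mul_pow, hτ2]
    field_simp
    ring
  simp_rw [h1]
  rw [lintegral_lintegral_swap (by fun_prop)]
  refine (lintegral_mono h2).trans ?_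
  rw [gaussianReal_of_var_ne_zero _ one_ne_zero, lintegral_withDensity_eq_lintegral_mul _
    (measurable_gaussianPDF _ _) (by fun_prop)]
  have h4 : ∀ s : ℝ, (gaussianPDF 0 1 * fun s => ENNReal.ofReal (Real.exp (s ^ 2 / 4))) s =
      ENNReal.ofReal ((√(2 * Real.pi))⁻¹ * Real.exp (-(1 / 4) * s ^ 2)) := by
    intro s
    simp only [Pi.mul_apply, gaussianPDF, gaussianPDFReal]
    rw [← ENNReal.ofReal_mul (by positivity), mul_assoc, ← Real.exp_add]
    simp
    congr 3
    ring
  simp_rw [h4]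
  rw [← ofReal_integral_eq_lintegral_ofReal
    ((integrable_exp_neg_mul_sq (by norm_num)).const_mul _) (ae_of_all _ fun _ => by positivity),
    integral_const_mul, integral_gaussian]
  rw [show (2 : ℝ≥0∞) = ENNReal.ofReal 2 by simp]
  apply ENNReal.ofReal_le_ofReal
  rw [inv_mul_le_iff₀ (by positivity), Real.sqrt_le_left (by positivity), mul_pow,
    Real.sq_sqrt (by positivity)]
  have := Real.pi_pos
  field_simp
  norm_num

/-- The Chernoff bound for a sum of independent variables. -/
theorem measure_sum_ge_le_exp {J : Type*} [Fintype J] {Y : J → Ω → ℝ} {m : J → ℝ}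
    (hYm : ∀ j, Measurable (Y j)) (hind : iIndepFun Y P)
    (hY : ∀ j, ∫⁻ ω, ENNReal.ofReal (Real.exp (Y j ω)) ∂P ≤ ENNReal.ofReal (Real.exp (m j)))
    (x : ℝ) : P {ω | x ≤ ∑ j, Y j ω} ≤ ENNReal.ofReal (Real.exp (∑ j, m j - x)) := by
  have hmeas : Measurable fun ω => ENNReal.ofReal (Real.exp (∑ j, Y j ω)) := by fun_prop
  have hprod : ∫⁻ ω, ENNReal.ofReal (Real.exp (∑ j, Y j ω)) ∂P ≤
      ENNReal.ofReal (Real.exp (∑ j, m j)) := by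
    simp_rw [Real.exp_sum, ENNReal.ofReal_prod_of_nonneg fun _ _ => (Real.exp_pos _).le]
    rw [lintegral_prod_eq_prod_lintegral_of_indepFun Finset.univ
      (fun j ω => ENNReal.ofReal (Real.exp (Y j ω)))
      (hind.comp (fun _ y => ENNReal.ofReal (Real.exp y)) (fun _ => by fun_prop))
      (fun j => by fun_prop)]
    exact Finset.prod_le_prod' fun j _ => hY j
  have hset : {ω | x ≤ ∑ j, Y j ω} =
      {ω | ENNReal.ofReal (Real.exp x) ≤ ENNReal.ofReal (Real.exp (∑ j, Y j ω))} := by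
    ext ω
    simp only [Set.mem_ofPred_eq]
    rw [ENNReal.ofReal_le_ofReal_iff (Real.exp_pos _).le, Real.exp_le_exp]
  rw [hset]
  refine (meas_ge_le_lintegral_div hmeas.aemeasurable (by simp [Real.exp_pos]) (by simp)).trans ?_
  rw [Real.exp_sub, ENNReal.ofReal_div_of_pos (Real.exp_pos _)]
  gcongr

/-- The chord of the convex function exp between 0 and y. It reduces a weight below the maximal one
to the exponential moment available at the maximal weight. -/
theorem exp_mul_le_of_le_one {y p : ℝ} (hp0 : 0 ≤ p) (hp1 : p ≤ 1) :
    Real.exp (p * y) ≤ 1 - p + p * Real.exp y := by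
  have := convexOn_exp.2 (Set.mem_univ 0) (Set.mem_univ y) (sub_nonneg.2 hp1) hp0 (by ring)
  simpa using this

theorem exp_neg_le_quadratic {x : ℝ} (hx : 0 ≤ x) : Real.exp (-x) ≤ 1 - x + x ^ 2 / 2 := by
  have h := Real.quadratic_le_exp_of_nonneg hx
  rw [Real.exp_neg, inv_le_iff_one_le_mul₀ (Real.exp_pos x)]
  have hq : 0 < 1 - x + x ^ 2 / 2 := by nlinarith [sq_nonneg (x - 1)]
  -- The product equals (1 + x²/2)² - x² = 1 + x⁴/4.
  calc (1 : ℝ) ≤ (1 - x + x ^ 2 / 2) * (1 + x + x ^ 2 / 2) := by nlinarith [pow_nonneg hx 4]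
    _ ≤ _ := by gcongr

variable [IsProbabilityMeasure P]

/-- Upper tail of a weighted sum of squares of independent variables. -/
theorem measure_weighted_sq_ge_le {J : Type*} [Fintype J] {ξ : J → Ω → ℝ}
    (hm : ∀ j, Measurable (ξ j)) (hind : iIndepFun ξ P) {η : ℝ} (hη : 0 < η)
    (hexp : ∀ j, ∫⁻ ω, ENNReal.ofReal (Real.exp (η * ξ j ω ^ 2)) ∂P ≤ 2)
    {w : J → ℝ} {wmax : ℝ} (hw : ∀ j, 0 ≤ w j) (hwm : ∀ j, w j ≤ wmax) (hpos : 0 < wmax) (L : ℝ) :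
    P {ω | (L + 1) / η * ∑ j, w j ≤ ∑ j, w j * ξ j ω ^ 2} ≤
      ENNReal.ofReal (Real.exp (-(L * ((∑ j, w j) / wmax)))) := by
  -- With p = w j / wmax the chord bound gives a mean of at most 1 + p ≤ exp p. The exponents then
  -- sum to the ratio of total to maximal weight, and L multiplies that same ratio.
  have hY : ∀ j, ∫⁻ ω, ENNReal.ofReal (Real.exp (η / wmax * (w j * ξ j ω ^ 2))) ∂P ≤
      ENNReal.ofReal (Real.exp (w j / wmax)) := by
    intro j
    have hp0 : 0 ≤ w j / wmax := div_nonneg (hw j) hpos.le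
    have hp1 : w j / wmax ≤ 1 := (div_le_one hpos).2 (hwm j)
    have h1 : ∀ ω, ENNReal.ofReal (Real.exp (η / wmax * (w j * ξ j ω ^ 2))) ≤
        ENNReal.ofReal (1 - w j / wmax) +
          ENNReal.ofReal (w j / wmax) * ENNReal.ofReal (Real.exp (η * ξ j ω ^ 2)) := by
      intro ω
      rw [← ENNReal.ofReal_mul hp0, ← ENNReal.ofReal_add (by linarith) (by positivity)]
      apply ENNReal.ofReal_le_ofReal
      refine le_trans (le_of_eq ?_) (exp_mul_le_of_le_one hp0 hp1)
      congr 1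
      ring
    have hmj := hm j
    calc ∫⁻ ω, ENNReal.ofReal (Real.exp (η / wmax * (w j * ξ j ω ^ 2))) ∂P
        ≤ ∫⁻ ω, (ENNReal.ofReal (1 - w j / wmax) +
          ENNReal.ofReal (w j / wmax) * ENNReal.ofReal (Real.exp (η * ξ j ω ^ 2))) ∂P :=
          lintegral_mono h1
      _ ≤ ENNReal.ofReal (1 - w j / wmax) + ENNReal.ofReal (w j / wmax) * 2 := by
          rw [lintegral_add_left measurable_const, lintegral_const, measure_univ, mul_one,
            lintegral_const_mul _ (by fun_prop)]
          gcongr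
          exact hexp j
      _ = ENNReal.ofReal (w j / wmax + 1) := by
          rw [show (2 : ℝ≥0∞) = ENNReal.ofReal 2 by simp, ← ENNReal.ofReal_mul hp0,
            ← ENNReal.ofReal_add (by linarith) (by positivity)]
          congr 1
          ring
      _ ≤ _ := ENNReal.ofReal_le_ofReal (Real.add_one_le_exp _)
  have := measure_sum_ge_le_exp (P := P) (Y := fun j ω => η / wmax * (w j * ξ j ω ^ 2))
    (m := fun j => w j / wmax) (fun j => by have := hm j; fun_prop)
    (hind.comp (fun j y => η / wmax * (w j * y ^ 2)) (fun j => by fun_prop)) hY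
    ((L + 1) / wmax * ∑ j, w j)
  refine le_trans (le_trans (measure_mono fun ω hω => ?_) this) (le_of_eq ?_)
  · simp only [Set.mem_ofPred_eq] at hω ⊢
    rw [← Finset.mul_sum]
    calc (L + 1) / wmax * ∑ j, w j = η / wmax * ((L + 1) / η * ∑ j, w j) := by field_simp
      _ ≤ _ := by gcongr
  · congr 2
    rw [← Finset.sum_div]
    ring

/-- Lower tail of a weighted sum of squares of independent variables. -/
theorem measure_weighted_sq_le_le {J : Type*} [Fintype J] {ξ : J → Ω → ℝ}
    (hm : ∀ j, Measurable (ξ j)) (hind : iIndepFun ξ P) {η : ℝ} (hη : 0 < η)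
    (hexp : ∀ j, ∫⁻ ω, ENNReal.ofReal (Real.exp (η * ξ j ω ^ 2)) ∂P ≤ 2)
    (hvar : ∀ j, ∫ ω, ξ j ω ^ 2 ∂P = 1)
    {w : J → ℝ} (hw : ∀ j, 0 ≤ w j) (hS : 0 < ∑ j, w j ^ 2) :
    P {ω | ∑ j, w j * ξ j ω ^ 2 ≤ (∑ j, w j) / 2} ≤
      ENNReal.ofReal (Real.exp (-(η ^ 2 / 32 * ((∑ j, w j) ^ 2 / ∑ j, w j ^ 2)))) := by
  set W := ∑ j, w j with hW
  set S := ∑ j, w j ^ 2 with hSdef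
  have hW0 : 0 ≤ W := Finset.sum_nonneg fun j _ => hw j
  -- The minimizer of -aW/2 + 2a²S/η², the Chernoff exponent obtained from a second-order expansion
  -- with fourth moments at most 4/η².
  set a : ℝ := η ^ 2 * W / (8 * S) with ha
  have ha0 : 0 ≤ a := by positivity
  -- A non-integrable square would have integral 0 by convention, against the value 1.
  have hint2 : ∀ j, Integrable (fun ω => ξ j ω ^ 2) P := fun j => by
    by_contra hcon
    have := hvar j
    rw [integral_undef hcon] at this
    exact zero_ne_one this
  have h4 : ∀ j, ∫⁻ ω, ENNReal.ofReal (ξ j ω ^ 4) ∂P ≤ ENNReal.ofReal (4 / η ^ 2) := by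
    intro j
    have h1 : ∀ ω, ENNReal.ofReal (ξ j ω ^ 4) ≤
        ENNReal.ofReal (2 / η ^ 2) * ENNReal.ofReal (Real.exp (η * ξ j ω ^ 2)) := by
      intro ω
      rw [← ENNReal.ofReal_mul (by positivity)]
      apply ENNReal.ofReal_le_ofReal
      have := Real.quadratic_le_exp_of_nonneg (show 0 ≤ η * ξ j ω ^ 2 by positivity)
      have h0 : 0 ≤ η * ξ j ω ^ 2 := by positivity
      rw [div_mul_eq_mul_div, le_div_iff₀ (by positivity)]
      nlinarith
    have hmj := hm j
    calc _ ≤ ∫⁻ ω, ENNReal.ofReal (2 / η ^ 2) * ENNReal.ofReal (Real.exp (η * ξ j ω ^ 2)) ∂P :=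
          lintegral_mono h1
      _ ≤ ENNReal.ofReal (2 / η ^ 2) * 2 := by
          rw [lintegral_const_mul _ (by fun_prop)]
          gcongr
          exact hexp j
      _ = _ := by
          rw [show (2 : ℝ≥0∞) = ENNReal.ofReal 2 by simp, ← ENNReal.ofReal_mul (by positivity)]
          congr 1
          ring
  have hY : ∀ j, ∫⁻ ω, ENNReal.ofReal (Real.exp (-(a * (w j * ξ j ω ^ 2)))) ∂P ≤
      ENNReal.ofReal (Real.exp (-(a * w j) + 2 * a ^ 2 / η ^ 2 * w j ^ 2)) := by
    intro j
    have hwj := hw j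
    have hmj := hm j
    have hi4 : Integrable (fun ω => ξ j ω ^ 4) P := by
      refine ⟨by fun_prop, ?_⟩
      rw [hasFiniteIntegral_iff_ofReal (ae_of_all _ fun ω => by positivity)]
      exact (h4 j).trans_lt ENNReal.ofReal_lt_top
    have hi4' : ∫ ω, ξ j ω ^ 4 ∂P ≤ 4 / η ^ 2 := by
      rw [integral_eq_lintegral_of_nonneg_ae (ae_of_all _ fun ω => by positivity) (by fun_prop)]
      exact ENNReal.toReal_le_of_le_ofReal (by positivity) (h4 j)
    have hbound : ∀ ω, Real.exp (-(a * (w j * ξ j ω ^ 2))) ≤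
        1 - a * w j * ξ j ω ^ 2 + a ^ 2 * w j ^ 2 / 2 * ξ j ω ^ 4 := by
      intro ω
      refine (exp_neg_le_quadratic (by positivity)).trans (le_of_eq ?_)
      ring
    have hint : Integrable (fun ω => 1 - a * w j * ξ j ω ^ 2 + a ^ 2 * w j ^ 2 / 2 * ξ j ω ^ 4) P :=
      ((integrable_const _).sub ((hint2 j).const_mul _)).add (hi4.const_mul _)
    calc _ ≤ ∫⁻ ω, ENNReal.ofReal
          (1 - a * w j * ξ j ω ^ 2 + a ^ 2 * w j ^ 2 / 2 * ξ j ω ^ 4) ∂P :=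
          lintegral_mono fun ω => ENNReal.ofReal_le_ofReal (hbound ω)
      _ = ENNReal.ofReal (1 - a * w j + a ^ 2 * w j ^ 2 / 2 * ∫ ω, ξ j ω ^ 4 ∂P) := by
          rw [← ofReal_integral_eq_lintegral_ofReal hint
            (ae_of_all _ fun ω => (Real.exp_pos _).le.trans (hbound ω)),
            integral_add (f := fun ω => 1 - a * w j * ξ j ω ^ 2)
              ((integrable_const _).sub ((hint2 j).const_mul _)) (hi4.const_mul _),
            integral_sub (integrable_const _) ((hint2 j).const_mul _), integral_const_mul,
            integral_const_mul, hvar j]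
          simp
      _ ≤ _ := by
          apply ENNReal.ofReal_le_ofReal
          refine le_trans ?_ (Real.add_one_le_exp _)
          have : a ^ 2 * w j ^ 2 / 2 * ∫ ω, ξ j ω ^ 4 ∂P ≤ a ^ 2 * w j ^ 2 / 2 * (4 / η ^ 2) := by
            gcongr
          have h5 : a ^ 2 * w j ^ 2 / 2 * (4 / η ^ 2) = 2 * a ^ 2 / η ^ 2 * w j ^ 2 := by ring
          linarith
  have := measure_sum_ge_le_exp (P := P) (Y := fun j ω => -(a * (w j * ξ j ω ^ 2)))
    (m := fun j => -(a * w j) + 2 * a ^ 2 / η ^ 2 * w j ^ 2)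
    (fun j => by have := hm j; fun_prop)
    (hind.comp (fun j y => -(a * (w j * y ^ 2))) (fun j => by fun_prop)) hY (-(a * (W / 2)))
  refine le_trans (le_trans (measure_mono fun ω hω => ?_) this) (le_of_eq ?_)
  · simp only [Set.mem_ofPred_eq] at hω ⊢
    rw [Finset.sum_neg_distrib, ← Finset.mul_sum, neg_le_neg_iff]
    gcongr
  · congr 2
    rw [Finset.sum_add_distrib, Finset.sum_neg_distrib, ← Finset.mul_sum, ← Finset.mul_sum, ← hW,
      ← hSdef, ha]
    field_simp
    ring

end Tails

/-! ## Two-sided bounds for random quadratic forms -/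

section QuadraticForms

variable {Ω : Type*} [MeasurableSpace Ω] {P : Measure Ω}

/-- The linear map `a ↦ (√(w j) * ∑ i, a i * z j i) j`. -/
noncomputable def weightedMap {ι J : Type*} [Fintype ι] [Fintype J] (w : J → ℝ) (z : J → ι → ℝ) :
    EuclideanSpace ℝ ι →ₗ[ℝ] EuclideanSpace ℝ J where
  toFun a := WithLp.toLp 2 fun j => √(w j) * ∑ i, a i * z j i
  map_add' a b := by
    ext j
    simp [add_mul, Finset.sum_add_distrib, mul_add]
  map_smul' r a := by
    ext j
    simp only [PiLp.smul_apply, smul_eq_mul, RingHom.id_apply, Finset.mul_sum]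
    exact Finset.sum_congr rfl fun i _ => by ring

theorem norm_sq_weightedMap {ι J : Type*} [Fintype ι] [Fintype J] {w : J → ℝ} (hw : ∀ j, 0 ≤ w j)
    (z : J → ι → ℝ) (a : EuclideanSpace ℝ ι) :
    ‖weightedMap w z a‖ ^ 2 = ∑ j, w j * (∑ i, a i * z j i) ^ 2 := by
  rw [EuclideanSpace.real_norm_sq_eq]
  exact Finset.sum_congr rfl fun j _ => by
    simp only [weightedMap, LinearMap.coe_mk, AddHom.coe_mk, mul_pow, Real.sq_sqrt (hw j)]

/-- With high probability the random quadratic form `a ↦ ∑ j, w j * (∑ i, a i * ζ j i) ^ 2` is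
comparable to `(∑ j, w j) * ∑ i, a i ^ 2`. -/
theorem measure_not_quadraticForm_bounds_le [IsProbabilityMeasure P] {ι J : Type*} [Fintype ι]
    [Fintype J] {ζ : J → Ω → ι → ℝ} (hm : ∀ j i, Measurable fun ω => ζ j ω i)
    (hind : ∀ a : ι → ℝ, iIndepFun (fun j ω => ∑ i, a i * ζ j ω i) P) {η : ℝ} (hη : 0 < η)
    (hexp : ∀ a : ι → ℝ, ∑ i, a i ^ 2 = 1 → ∀ j,
      ∫⁻ ω, ENNReal.ofReal (Real.exp (η * (∑ i, a i * ζ j ω i) ^ 2)) ∂P ≤ 2)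
    (hvar : ∀ a : ι → ℝ, ∑ i, a i ^ 2 = 1 → ∀ j, ∫ ω, (∑ i, a i * ζ j ω i) ^ 2 ∂P = 1)
    {w : J → ℝ} {wmax : ℝ} (hw : ∀ j, 0 ≤ w j) (hwm : ∀ j, w j ≤ wmax) (hpos : 0 < wmax)
    (hS : 0 < ∑ j, w j ^ 2) {L : ℝ} (hL : 0 ≤ L) {δ : ℝ} (hδ : 0 < δ) (hδ1 : δ ≤ 1)
    (hδL : 32 * ((L + 1) / η) * δ ^ 2 ≤ 1) :
    P {ω | ¬ ∀ a : ι → ℝ, (∑ j, w j) / 8 * ∑ i, a i ^ 2 ≤ ∑ j, w j * (∑ i, a i * ζ j ω i) ^ 2 ∧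
      ∑ j, w j * (∑ i, a i * ζ j ω i) ^ 2 ≤ 4 * ((L + 1) / η) * (∑ j, w j) * ∑ i, a i ^ 2} ≤
    ENNReal.ofReal (6 ^ Fintype.card ι * Real.exp (-(L * ((∑ j, w j) / wmax))) +
      (3 / δ) ^ Fintype.card ι *
        Real.exp (-(η ^ 2 / 32 * ((∑ j, w j) ^ 2 / ∑ j, w j ^ 2)))) := by
  set W := ∑ j, w j with hW
  set S := ∑ j, w j ^ 2 with hSdef
  have hW0 : 0 ≤ W := Finset.sum_nonneg fun j _ => hw j
  set C := (L + 1) / η with hC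
  have hC0 : 0 < C := by positivity
  -- Two nets: a coarse one suffices for the upper bound, which then controls the passage from a
  -- δ-net to the sphere in the lower bound.
  obtain ⟨s, hs1, hsnet, hscard⟩ :=
    exists_sphere_net (E := EuclideanSpace ℝ ι) (δ := 1 / 2) (by norm_num) (by norm_num)
  obtain ⟨s', hs1', hsnet', hscard'⟩ := exists_sphere_net (E := EuclideanSpace ℝ ι) hδ hδ1
  rw [finrank_euclideanSpace] at hscard hscard'
  rw [show (3 : ℝ) / (1 / 2) = 6 by norm_num] at hscard
  have hunit : ∀ {a : EuclideanSpace ℝ ι}, ‖a‖ = 1 → ∑ i, a i ^ 2 = 1 := fun {a} ha => by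
    rw [← EuclideanSpace.real_norm_sq_eq, ha, one_pow]
  have hsub : {ω | ¬ ∀ a : ι → ℝ, W / 8 * ∑ i, a i ^ 2 ≤ ∑ j, w j * (∑ i, a i * ζ j ω i) ^ 2 ∧
      ∑ j, w j * (∑ i, a i * ζ j ω i) ^ 2 ≤ 4 * C * W * ∑ i, a i ^ 2} ⊆
      (⋃ c ∈ s, {ω | C * W ≤ ∑ j, w j * (∑ i, c i * ζ j ω i) ^ 2}) ∪
      (⋃ c ∈ s', {ω | ∑ j, w j * (∑ i, c i * ζ j ω i) ^ 2 ≤ W / 2}) := by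
    intro ω hω
    by_contra hcon
    simp only [Set.mem_union, Set.mem_iUnion, Set.mem_ofPred_eq, not_or, not_exists, not_le]
      at hcon
    refine hω fun a => ?_
    set T := weightedMap w fun j => ζ j ω with hT
    have hTsq : ∀ a, ‖T a‖ ^ 2 = ∑ j, w j * (∑ i, a i * ζ j ω i) ^ 2 :=
      norm_sq_weightedMap hw fun j => ζ j ω
    have hup : ∀ c ∈ s, ‖T c‖ ≤ √(C * W) := fun c hc => by
      apply Real.le_sqrt_of_sq_le
      rw [hTsq]
      exact (hcon.1 c hc).le
    have hlo : ∀ c ∈ s', √(W / 2) ≤ ‖T c‖ := fun c hc => by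
      apply Real.sqrt_le_iff.2 ⟨norm_nonneg _, ?_⟩
      rw [hTsq]
      exact (hcon.2 c hc).le
    have h1 := norm_map_le_of_net hsnet hup
    have h2 := le_norm_map_of_net (by positivity) hsnet' h1 hlo
    -- Here √(W/2) = 2√(W/8), and the condition on δ says exactly that the net error is at most
    -- √(W/8) when W > 0.
    have h3 : √(W / 8) ≤ √(W / 2) - 2 * √(C * W) * δ := by
      have e1 : √(W / 2) = 2 * √(W / 8) := by
        rw [show W / 2 = 2 ^ 2 * (W / 8) by ring, Real.sqrt_mul (by norm_num),
          Real.sqrt_sq (by norm_num)]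
      have e2 : 2 * √(C * W) * δ ≤ √(W / 8) := by
        apply Real.le_sqrt_of_sq_le
        rw [mul_pow, mul_pow, Real.sq_sqrt (by positivity)]
        nlinarith
      linarith
    have hn : ‖(WithLp.toLp 2 a : EuclideanSpace ℝ ι)‖ ^ 2 = ∑ i, a i ^ 2 := by
      rw [EuclideanSpace.real_norm_sq_eq]
    have hTa := hTsq (WithLp.toLp 2 a)
    simp only at hTa
    constructor
    · rw [← hTa, ← hn]
      have h4 : √(W / 8) * ‖(WithLp.toLp 2 a : EuclideanSpace ℝ ι)‖ ≤ ‖T (WithLp.toLp 2 a)‖ :=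
        (mul_le_mul_of_nonneg_right h3 (norm_nonneg _)).trans (h2 _)
      calc _ = (√(W / 8) * ‖(WithLp.toLp 2 a : EuclideanSpace ℝ ι)‖) ^ 2 := by
            rw [mul_pow, Real.sq_sqrt (by positivity)]
        _ ≤ _ := by gcongr
    · rw [← hTa, ← hn]
      calc _ ≤ (2 * √(C * W) * ‖(WithLp.toLp 2 a : EuclideanSpace ℝ ι)‖) ^ 2 := by
            gcongr
            exact h1 _
        _ = _ := by rw [mul_pow, mul_pow, Real.sq_sqrt (by positivity)]; ring
  have hmξ : ∀ (a : ι → ℝ) j, Measurable fun ω => ∑ i, a i * ζ j ω i := fun a j =>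
    Finset.measurable_sum _ fun i _ => (hm j i).const_mul _
  refine (measure_mono hsub).trans ((measure_union_le _ _).trans ?_)
  rw [ENNReal.ofReal_add (by positivity) (by positivity)]
  gcongr ?_ + ?_
  · refine (measure_biUnion_finset_le _ _).trans ?_
    refine (Finset.sum_le_sum fun (c : EuclideanSpace ℝ ι) hc =>
      measure_weighted_sq_ge_le (hmξ c) (hind c) hη
      (hexp c (hunit (hs1 c hc))) hw hwm hpos L).trans ?_
    rw [Finset.sum_const, nsmul_eq_mul, ← ENNReal.ofReal_natCast,
      ← ENNReal.ofReal_mul (by positivity)]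
    apply ENNReal.ofReal_le_ofReal
    gcongr
  · refine (measure_biUnion_finset_le _ _).trans ?_
    refine (Finset.sum_le_sum fun (c : EuclideanSpace ℝ ι) hc =>
      measure_weighted_sq_le_le (hmξ c) (hind c) hη
      (hexp c (hunit (hs1' c hc))) (hvar c (hunit (hs1' c hc))) hw hS).trans ?_
    rw [Finset.sum_const, nsmul_eq_mul, ← ENNReal.ofReal_natCast,
      ← ENNReal.ofReal_mul (by positivity)]
    apply ENNReal.ofReal_le_ofReal
    gcongr

end QuadraticForms

/-! ## Independence of arrays -/

section Arrays

/-- If the variables `X i j`, indexed by pairs, are independent, then so are the families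
`(X i j) j`. -/
theorem iIndepFun_curry {Ω ι : Type*} {κ : ι → Type*} [MeasurableSpace Ω] {P : Measure Ω}
    {X : (i : ι) → (j : κ i) → Ω → ℝ} (mX : ∀ i j, Measurable (X i j))
    (h : iIndepFun (fun (p : (i : ι) × κ i) ω => X p.1 p.2 ω) P) :
    iIndepFun (fun i ω => (X i · ω)) P := by
  have := h.isProbabilityMeasure
  have : ∀ i j, IsProbabilityMeasure (P.map (X i j)) :=
    fun i j => Measure.isProbabilityMeasure_map (mX i j).aemeasurable
  have hcomp : (fun ω i j => X i j ω) =
      (MeasurableEquiv.piCurry fun i (_ : κ i) => ℝ) ∘ (fun ω p => X p.1 p.2 ω) := by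
    ext; simp [Sigma.curry]
  rw [iIndepFun_iff_map_fun_eq_infinitePi_map (by fun_prop), hcomp,
    ← Measure.map_map (by fun_prop) (by fun_prop),
    (iIndepFun_iff_map_fun_eq_infinitePi_map (by fun_prop)).1 h,
    Measure.infinitePi_map_piCurry (fun i j => P.map (X i j))]
  congr 1
  ext1 i
  have hi : iIndepFun (fun j => X i j) P :=
    h.precomp (g := fun j : κ i => (⟨i, j⟩ : (i : ι) × κ i)) sigma_mk_injective
  exact ((iIndepFun_iff_map_fun_eq_infinitePi_map (by fun_prop)).1 hi).symm

theorem iIndepFun_comp_measurePreserving {Ω H J : Type*} [MeasurableSpace Ω] [MeasurableSpace H]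
    {P : Measure Ω} {μ : Measure H} {f : Ω → H} (e : MeasurePreserving f P μ) {z : J → H → ℝ}
    (hz : ∀ j, Measurable (z j)) (hind : iIndepFun z μ) : iIndepFun (fun j ω => z j (f ω)) P := by
  have := hind.isProbabilityMeasure
  have : IsProbabilityMeasure (P.map f) := by rwa [e.map_eq]
  have : IsProbabilityMeasure P := Measure.isProbabilityMeasure_of_map f
  have hf := e.measurable
  have h1 := (iIndepFun_iff_map_fun_eq_infinitePi_map hz).1 hind
  rw [iIndepFun_iff_map_fun_eq_infinitePi_map (by fun_prop)]
  rw [← e.map_eq, Measure.map_map (by fun_prop) hf] at h1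
  refine h1.trans ?_
  congr 1
  ext1 j
  rw [Measure.map_map (hz j) hf]
  rfl

/-- For independent copies `x 0, …, x (n-1)` of a vector with independent coordinates `z j`, the
coordinate families `(z j (x i)) i` are independent. -/
theorem iIndepFun_columns {H J : Type*} [MeasurableSpace H] {μ : Measure H} [IsProbabilityMeasure μ]
    {z : J → H → ℝ} (hz : ∀ j, Measurable (z j)) (hind : iIndepFun z μ) (n : ℕ) :
    iIndepFun (fun j (X : Fin n → H) => fun i => z j (X i)) (Measure.pi fun _ : Fin n => μ) := by
  have h1 : iIndepFun (fun (i : Fin n) (X : Fin n → H) => fun j => z j (X i))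
      (Measure.pi fun _ : Fin n => μ) :=
    iIndepFun_pi (X := fun _ x j => z j x) fun i => (measurable_pi_lambda _ hz).aemeasurable
  have h2 : ∀ i : Fin n, iIndepFun (fun j (X : Fin n → H) => z j (X i))
      (Measure.pi fun _ : Fin n => μ) := fun i =>
    iIndepFun_comp_measurePreserving (measurePreserving_eval (fun _ : Fin n => μ) i) hz hind
  -- Independence across the inputs and across the coordinates makes the whole array independent;
  -- transposing the index pairs and regrouping gives the columns.
  have h3 := iIndepFun_uncurry' (X := fun (i : Fin n) j (X : Fin n → H) => z j (X i))
    (fun i j => by fun_prop) h1 h2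
  refine iIndepFun_curry (κ := fun _ => Fin n) (X := fun j i (X : Fin n → H) => z j (X i))
    (fun j i => by fun_prop) ?_
  exact h3.precomp (g := fun p : (_ : J) × Fin n => (p.2, p.1)) fun p q hpq => by
    rcases p with ⟨p1, p2⟩; rcases q with ⟨q1, q2⟩
    simp only [Prod.mk.injEq] at hpq
    obtain ⟨rfl, rfl⟩ := hpq
    rfl

end Arrays

/-! ## Finite frames with two-sided bounds -/

section Frames

variable {H : Type*} [NormedAddCommGroup H] [InnerProductSpace ℝ H] {ι : Type*} [Fintype ι]
  {T : ι → H} {lo hi : ℝ}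

theorem inner_sum_smul_right (T : ι → H) (a : ι → ℝ) (x : H) :
    ⟪x, ∑ i, a i • T i⟫ = ∑ i, a i * ⟪T i, x⟫ := by
  rw [inner_sum]
  exact Finset.sum_congr rfl fun i _ => by rw [real_inner_smul_right, real_inner_comm]

theorem norm_sq_sum_smul (T : ι → H) (a : ι → ℝ) :
    ‖∑ i, a i • T i‖ ^ 2 = ∑ i, a i * ⟪T i, ∑ l, a l • T l⟫ := by
  rw [← real_inner_self_eq_norm_sq, inner_sum_smul_right]

/-- Cauchy–Schwarz. The crude bound by the sum of squared norms is enough for the part of the tail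
beyond the truncation. -/
theorem norm_sum_smul_sq_le (a : ι → ℝ) (x : ι → H) :
    ‖∑ i, a i • x i‖ ^ 2 ≤ (∑ i, ‖x i‖ ^ 2) * ∑ i, a i ^ 2 := by
  calc ‖∑ i, a i • x i‖ ^ 2 ≤ (∑ i, |a i| * ‖x i‖) ^ 2 := by
        gcongr
        refine (norm_sum_le _ _).trans (le_of_eq ?_)
        exact Finset.sum_congr rfl fun i _ => by rw [norm_smul, Real.norm_eq_abs]
    _ ≤ (∑ i, |a i| ^ 2) * ∑ i, ‖x i‖ ^ 2 := Finset.sum_mul_sq_le_sq_mul_sq _ _ _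
    _ = _ := by simp_rw [sq_abs]; rw [mul_comm]

/-- Duality: the synthesis map a ↦ ∑ a i • T i and its adjoint, the analysis map, have the same
norm. -/
theorem sum_inner_sq_le (hhi0 : 0 ≤ hi)
    (hhi : ∀ a : ι → ℝ, ‖∑ i, a i • T i‖ ^ 2 ≤ hi * ∑ i, a i ^ 2) (x : H) :
    ∑ i, ⟪T i, x⟫ ^ 2 ≤ hi * ‖x‖ ^ 2 := by
  set h : ι → ℝ := fun i => ⟪T i, x⟫ with hh
  have h1 : ∑ i, h i ^ 2 = ⟪x, ∑ i, h i • T i⟫ := by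
    rw [inner_sum_smul_right]
    exact Finset.sum_congr rfl fun i _ => by rw [sq]
  have h2 : (∑ i, h i ^ 2) ^ 2 ≤ ‖x‖ ^ 2 * (hi * ∑ i, h i ^ 2) := by
    calc (∑ i, h i ^ 2) ^ 2 = |⟪x, ∑ i, h i • T i⟫| ^ 2 := by rw [h1, sq_abs]
      _ ≤ (‖x‖ * ‖∑ i, h i • T i‖) ^ 2 := by gcongr; exact abs_real_inner_le_norm _ _
      _ = ‖x‖ ^ 2 * ‖∑ i, h i • T i‖ ^ 2 := by ring
      _ ≤ _ := by gcongr; exact hhi h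
  rcases (Finset.sum_nonneg fun i (_ : i ∈ Finset.univ) => sq_nonneg (h i)).eq_or_lt with h0 | h0
  · rw [← h0]
    positivity
  · nlinarith

/-- The Gram system of a family with a lower frame bound is solvable. -/
theorem exists_inner_sum_smul_eq (hlo0 : 0 < lo)
    (hlo : ∀ a : ι → ℝ, lo * ∑ i, a i ^ 2 ≤ ‖∑ i, a i • T i‖ ^ 2) (y : ι → ℝ) :
    ∃ a : ι → ℝ, ∀ i, ⟪T i, ∑ l, a l • T l⟫ = y i := by
  let Φ : (ι → ℝ) →ₗ[ℝ] (ι → ℝ) :=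
    { toFun := fun a i => ⟪T i, ∑ l, a l • T l⟫
      map_add' := fun a b => by
        ext i
        simp [add_smul, Finset.sum_add_distrib, inner_add_right]
      map_smul' := fun r a => by
        ext i
        simp [mul_smul, ← Finset.smul_sum, real_inner_smul_right] }
  have hinj : Function.Injective Φ := by
    rw [← LinearMap.ker_eq_bot, LinearMap.ker_eq_bot']
    intro a ha
    have h1 : ∀ i, ⟪T i, ∑ l, a l • T l⟫ = 0 := fun i => congrFun ha i
    have h2 := hlo a
    rw [norm_sq_sum_smul] at h2
    simp only [h1, mul_zero, Finset.sum_const_zero] at h2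
    have h3 : ∑ i, a i ^ 2 ≤ 0 := by nlinarith
    have h4 := (Finset.sum_eq_zero_iff_of_nonneg fun i _ => sq_nonneg (a i)).1
      (le_antisymm h3 (Finset.sum_nonneg fun i _ => sq_nonneg (a i)))
    ext i
    simpa using h4 i (Finset.mem_univ i)
  obtain ⟨a, ha⟩ := (LinearMap.injective_iff_surjective.1 hinj) y
  exact ⟨a, fun i => congrFun ha i⟩

/-- Pairing the Gram system with its solution gives lo |a|² ≤ a·y ≤ |a| |y|. -/
theorem sum_sq_le_of_inner_eq (hlo0 : 0 < lo)
    (hlo : ∀ a : ι → ℝ, lo * ∑ i, a i ^ 2 ≤ ‖∑ i, a i • T i‖ ^ 2) {a y : ι → ℝ}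
    (h : ∀ i, ⟪T i, ∑ l, a l • T l⟫ = y i) : ∑ i, a i ^ 2 ≤ (∑ i, y i ^ 2) / lo ^ 2 := by
  have h1 := hlo a
  rw [norm_sq_sum_smul] at h1
  simp_rw [h] at h1
  have h2 := Finset.sum_mul_sq_le_sq_mul_sq Finset.univ a y
  have ha0 : 0 ≤ ∑ i, a i ^ 2 := Finset.sum_nonneg fun i _ => sq_nonneg (a i)
  have hy0 : 0 ≤ ∑ i, y i ^ 2 := Finset.sum_nonneg fun i _ => sq_nonneg (y i)
  rw [le_div_iff₀ (by positivity)]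
  rcases ha0.eq_or_lt with h0 | h0
  · rw [← h0]; simpa using hy0
  · have h3 : (lo * ∑ i, a i ^ 2) ^ 2 ≤ (∑ i, a i * y i) ^ 2 := by gcongr
    have h4 : (∑ i, a i ^ 2) * ((∑ i, a i ^ 2) * lo ^ 2) ≤ (∑ i, a i ^ 2) * ∑ i, y i ^ 2 := by
      nlinarith
    exact le_of_mul_le_mul_left h4 h0

/-- If the vectors `x i` solve the Gram system for the standard basis, then the values of a
functional on them are the coordinates of the solution of a Gram system. -/
theorem sum_sq_dot_le [DecidableEq ι] (hlo0 : 0 < lo)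
    (hlo : ∀ a : ι → ℝ, lo * ∑ i, a i ^ 2 ≤ ‖∑ i, a i • T i‖ ^ 2) {g : ι → ι → ℝ}
    (hg : ∀ i l, ⟪T l, ∑ m, g i m • T m⟫ = if l = i then 1 else 0) (z : ι → ℝ) :
    ∑ i, (∑ l, g i l * z l) ^ 2 ≤ (∑ i, z i ^ 2) / lo ^ 2 := by
  obtain ⟨f, hf⟩ := exists_inner_sum_smul_eq hlo0 hlo z
  -- Symmetry of the inverse Gram matrix, whose rows are the vectors g i.
  have h1 : ∀ i, ∑ l, g i l * z l = f i := fun i => by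
    calc ∑ l, g i l * z l = ∑ l, g i l * ⟪T l, ∑ m, f m • T m⟫ := by simp_rw [hf]
      _ = ⟪∑ m, f m • T m, ∑ m, g i m • T m⟫ := (inner_sum_smul_right T _ _).symm
      _ = ⟪∑ m, g i m • T m, ∑ m, f m • T m⟫ := real_inner_comm _ _
      _ = ∑ m, f m * ⟪T m, ∑ m, g i m • T m⟫ := inner_sum_smul_right T _ _
      _ = f i := by simp [hg]
  simp_rw [h1]
  exact sum_sq_le_of_inner_eq hlo0 hlo hf

end Frames

/-! ## Splitting the min-norm interpolation equations into head and tail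

The equations `⟪T i, ∑ l, g l • T l⟫ + ∑ j ∈ κ, γ j * z i j = s i` and
`∑ i, g i * z i j = γ j / lam j + d j` say that `g` solves the Gram system of the whole data, where
`T` is the tail of the data and `z` is its whitened head. -/

section Split

variable {H : Type*} [NormedAddCommGroup H] [InnerProductSpace ℝ H] {ι : Type*} [Fintype ι]
  {T : ι → H} {lo hi ν N : ℝ} {κ : Finset ℕ} {lam : ℕ → ℝ} {z : ι → ℕ → ℝ}

/-- Pairs the dual variables with the head contribution. The first sum on the right is nonnegative
for positive eigenvalues and can be dropped in estimates; it is all that remains when d = 0. -/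
theorem head_inner_eq {g : ι → ℝ} {γ d : ℕ → ℝ}
    (hdual : ∀ j ∈ κ, ∑ i, g i * z i j = γ j / lam j + d j) :
    ∑ i, g i * ∑ j ∈ κ, γ j * z i j = ∑ j ∈ κ, γ j ^ 2 / lam j + ∑ j ∈ κ, γ j * d j := by
  simp_rw [Finset.mul_sum]
  rw [Finset.sum_comm, ← Finset.sum_add_distrib]
  refine Finset.sum_congr rfl fun j hj => ?_
  calc ∑ i, g i * (γ j * z i j) = γ j * ∑ i, g i * z i j := by
        rw [Finset.mul_sum]; exact Finset.sum_congr rfl fun i _ => by ring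
    _ = _ := by rw [hdual j hj]; ring

/-- The squared norm of the tail of the min-norm interpolator. -/
theorem tail_norm_sq_le (hlo0 : 0 < lo) (hν : 0 < ν) (hlohi : lo ≤ hi)
    (hlo : ∀ a : ι → ℝ, lo * ∑ i, a i ^ 2 ≤ ‖∑ i, a i • T i‖ ^ 2)
    (hhi : ∀ a : ι → ℝ, ‖∑ i, a i • T i‖ ^ 2 ≤ hi * ∑ i, a i ^ 2)
    (hz : ∀ γ : ℕ → ℝ, ν * ∑ j ∈ κ, γ j ^ 2 ≤ ∑ i, (∑ j ∈ κ, γ j * z i j) ^ 2)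
    (hlam : ∀ j ∈ κ, 0 < lam j) {g s : ι → ℝ} {γ d : ℕ → ℝ}
    (heq : ∀ i, ⟪T i, ∑ l, g l • T l⟫ + ∑ j ∈ κ, γ j * z i j = s i)
    (hdual : ∀ j ∈ κ, ∑ i, g i * z i j = γ j / lam j + d j) :
    ‖∑ l, g l • T l‖ ^ 2 ≤ 5 * ((∑ i, s i ^ 2) / lo + hi / ν * ∑ j ∈ κ, d j ^ 2) ∧
    ∑ j ∈ κ, γ j ^ 2 ≤ 2 / ν * (∑ i, s i ^ 2 + hi * ‖∑ l, g l • T l‖ ^ 2) := by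
  have hhi0 : 0 < hi := hlo0.trans_le hlohi
  set V := ∑ l, g l • T l with hV
  set u : ι → ℝ := fun i => ∑ j ∈ κ, γ j * z i j with hu
  have hT : ∀ i, ⟪T i, V⟫ = s i - u i := fun i => by rw [← heq i]; ring
  set S := ∑ i, s i ^ 2 with hS
  set D := ∑ j ∈ κ, d j ^ 2 with hD
  set Γ := ∑ j ∈ κ, γ j ^ 2 with hΓ
  have hS0 : 0 ≤ S := Finset.sum_nonneg fun i _ => sq_nonneg (s i)
  have hD0 : 0 ≤ D := Finset.sum_nonneg fun i _ => sq_nonneg (d i)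
  have hΓ0 : 0 ≤ Γ := Finset.sum_nonneg fun i _ => sq_nonneg (γ i)
  -- The energy identity. Its last term is -∑ γ²/lam - ∑ γ d, so only g·s and -∑ γ d need upper
  -- bounds, each allowed to use a quarter of ‖V‖².
  have hW : ‖V‖ ^ 2 = ∑ i, g i * s i - ∑ i, g i * u i := by
    rw [hV, norm_sq_sum_smul, ← hV, ← Finset.sum_sub_distrib]
    exact Finset.sum_congr rfl fun i _ => by rw [hT]; ring
  have hgu := head_inner_eq hdual
  have hq : 0 ≤ ∑ j ∈ κ, γ j ^ 2 / lam j :=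
    Finset.sum_nonneg fun j hj => div_nonneg (sq_nonneg _) (hlam j hj).le
  have hu2 : ∑ i, u i ^ 2 ≤ 2 * (S + hi * ‖V‖ ^ 2) := by
    have h1 := sum_inner_sq_le hhi0.le hhi V
    simp_rw [hT] at h1
    have h2 : ∑ i, u i ^ 2 ≤ ∑ i, (2 * s i ^ 2 + 2 * (s i - u i) ^ 2) :=
      Finset.sum_le_sum fun i _ => by nlinarith [sq_nonneg (2 * s i - u i)]
    rw [Finset.sum_add_distrib, ← Finset.mul_sum, ← Finset.mul_sum] at h2
    linarith
  have hΓu : ν * Γ ≤ ∑ i, u i ^ 2 := hz γ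
  have hΓle : Γ ≤ 2 / ν * (S + hi * ‖V‖ ^ 2) := by
    rw [div_mul_eq_mul_div, le_div_iff₀ hν]
    linarith
  refine ⟨?_, hΓle⟩
  have hgs : ∑ i, g i * s i ≤ ‖V‖ ^ 2 / 4 + S / lo := by
    have h1 : ∑ i, g i * s i ≤ ∑ i, (lo / 4 * g i ^ 2 + s i ^ 2 / lo) :=
      Finset.sum_le_sum fun i _ => by
        have : lo / 4 * g i ^ 2 + s i ^ 2 / lo - g i * s i = (lo * g i / 2 - s i) ^ 2 / lo := by
          field_simp; ring
        have h2 : 0 ≤ (lo * g i / 2 - s i) ^ 2 / lo := by positivity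
        linarith
    rw [Finset.sum_add_distrib, ← Finset.mul_sum, ← Finset.sum_div] at h1
    have := hlo g
    linarith
  -- The weight ν/(8 hi) is chosen so that the bound on ∑ γ² turns this term into ‖V‖²/4 plus a
  -- multiple of S.
  have hγd : -∑ j ∈ κ, γ j * d j ≤ ν / (8 * hi) * Γ + 2 * hi / ν * D := by
    rw [hΓ, hD, Finset.mul_sum, Finset.mul_sum, ← Finset.sum_neg_distrib, ← Finset.sum_add_distrib]
    refine Finset.sum_le_sum fun j _ => ?_
    have : ν / (8 * hi) * γ j ^ 2 + 2 * hi / ν * d j ^ 2 - -(γ j * d j) =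
        (ν * γ j + 4 * hi * d j) ^ 2 / (8 * hi * ν) := by field_simp; ring
    have h2 : 0 ≤ (ν * γ j + 4 * hi * d j) ^ 2 / (8 * hi * ν) := by positivity
    linarith
  have h5 : ν / (8 * hi) * Γ ≤ S / (4 * lo) + ‖V‖ ^ 2 / 4 := by
    calc ν / (8 * hi) * Γ ≤ ν / (8 * hi) * (2 / ν * (S + hi * ‖V‖ ^ 2)) := by gcongr
      _ = S / (4 * hi) + ‖V‖ ^ 2 / 4 := by field_simp; ring
      _ ≤ _ := by gcongr
  have h6 : S / (4 * lo) = S / lo / 4 := by field_simp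
  have h7 : 2 * hi / ν * D = 2 * (hi / ν * D) := by ring
  have h8 : 0 ≤ S / lo := by positivity
  have h9 : 0 ≤ hi / ν * D := by positivity
  change ∑ i, g i * u i = _ at hgu
  linarith

/-- The head of the min-norm interpolators of the standard basis vectors. -/
theorem sum_head_sq_le [DecidableEq ι] (hlo0 : 0 < lo) (hν : 0 < ν) (hlohi : lo ≤ hi)
    (hlo : ∀ a : ι → ℝ, lo * ∑ i, a i ^ 2 ≤ ‖∑ i, a i • T i‖ ^ 2)
    (hhi : ∀ a : ι → ℝ, ‖∑ i, a i • T i‖ ^ 2 ≤ hi * ∑ i, a i ^ 2)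
    (hz : ∀ γ : ℕ → ℝ, ν * ∑ j ∈ κ, γ j ^ 2 ≤ ∑ i, (∑ j ∈ κ, γ j * z i j) ^ 2)
    (hz' : ∀ γ : ℕ → ℝ, ∑ i, (∑ j ∈ κ, γ j * z i j) ^ 2 ≤ N * ∑ j ∈ κ, γ j ^ 2)
    (hlam : ∀ j ∈ κ, 0 < lam j) {g : ι → ι → ℝ} {γ : ι → ℕ → ℝ}
    (heq : ∀ i l, ⟪T l, ∑ m, g i m • T m⟫ + ∑ j ∈ κ, γ i j * z l j = if l = i then 1 else 0)
    (hdual : ∀ i, ∀ j ∈ κ, ∑ l, g i l * z l j = γ i j / lam j) :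
    ∑ i, ∑ j ∈ κ, γ i j ^ 2 ≤ (hi / ν) ^ 2 * (κ.card * N / lo ^ 2) := by
  have hhi0 : 0 < hi := hlo0.trans_le hlohi
  -- The vectors b j are the inverse tail Gram matrix applied to the whitened head columns. By
  -- linearity, β below is the same inverse applied to u.
  choose b hb using fun j => exists_inner_sum_smul_eq hlo0 hlo fun l => z l j
  have hone : ∀ i, ∑ j ∈ κ, γ i j ^ 2 ≤ (hi / ν) ^ 2 * ∑ j ∈ κ, b j i ^ 2 := by
    intro i
    set u : ι → ℝ := fun l => ∑ j ∈ κ, γ i j * z l j with hu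
    set β : ι → ℝ := fun l => ∑ j ∈ κ, γ i j * b j l with hβ
    set V := ∑ m, g i m • T m with hV
    have hTβ : ∀ l, ⟪T l, ∑ m, β m • T m⟫ = u l := by
      intro l
      have : ∑ m, β m • T m = ∑ j ∈ κ, γ i j • ∑ m, b j m • T m := by
        simp_rw [hβ, Finset.sum_smul, Finset.smul_sum, mul_smul]
        rw [Finset.sum_comm]
      rw [this, inner_sum]
      exact Finset.sum_congr rfl fun j _ => by rw [real_inner_smul_right, hb]
    have hgu : 0 ≤ ∑ l, g i l * u l := by
      have h1 := head_inner_eq (γ := γ i) (d := fun _ => 0) (g := g i)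
        (lam := lam) (z := z) (κ := κ) (fun j hj => by rw [hdual i j hj, add_zero])
      change ∑ l, g i l * u l = _ at h1
      rw [h1]
      simp only [mul_zero, Finset.sum_const_zero, add_zero]
      exact Finset.sum_nonneg fun j hj => div_nonneg (sq_nonneg _) (hlam j hj).le
    -- Together with `hgu` this gives ‖∑ β m • T m‖² ≤ β i. Hence ν ∑ γ² ≤ |u|² ≤ hi β i, and
    -- Cauchy–Schwarz on β i = ∑ γ j b j i closes the estimate.
    have hgu' : ∑ l, g i l * u l = β i - ‖∑ m, β m • T m‖ ^ 2 := by
      calc ∑ l, g i l * u l = ∑ l, g i l * ⟪T l, ∑ m, β m • T m⟫ := by simp_rw [hTβ]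
        _ = ⟪V, ∑ m, β m • T m⟫ := by rw [← inner_sum_smul_right, real_inner_comm]
        _ = ∑ l, β l * ⟪T l, V⟫ := inner_sum_smul_right _ _ _
        _ = ∑ l, β l * ((if l = i then 1 else 0) - u l) :=
            Finset.sum_congr rfl fun l _ => by rw [← heq i l, add_sub_cancel_right]
        _ = β i - ∑ l, β l * ⟪T l, ∑ m, β m • T m⟫ := by
            simp_rw [mul_sub, Finset.sum_sub_distrib, hTβ]
            simp
        _ = _ := by rw [norm_sq_sum_smul]
    have hu2 : ∑ l, u l ^ 2 ≤ hi * β i := by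
      have h1 := sum_inner_sq_le hhi0.le hhi (∑ m, β m • T m)
      simp_rw [hTβ] at h1
      refine h1.trans ?_
      gcongr
      linarith
    have hΓ0 : 0 ≤ ∑ j ∈ κ, γ i j ^ 2 := Finset.sum_nonneg fun j _ => sq_nonneg _
    have hb0 : 0 ≤ ∑ j ∈ κ, b j i ^ 2 := Finset.sum_nonneg fun j _ => sq_nonneg _
    have h1 : ν * ∑ j ∈ κ, γ i j ^ 2 ≤ hi * β i := (hz (γ i)).trans hu2
    have h2 : β i ^ 2 ≤ (∑ j ∈ κ, γ i j ^ 2) * ∑ j ∈ κ, b j i ^ 2 :=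
      Finset.sum_mul_sq_le_sq_mul_sq _ _ _
    have h3 : (ν * ∑ j ∈ κ, γ i j ^ 2) ^ 2 ≤ (hi * β i) ^ 2 := by gcongr
    rcases hΓ0.eq_or_lt with h0 | h0
    · rw [← h0]; positivity
    · have h4 : (∑ j ∈ κ, γ i j ^ 2) * (ν ^ 2 * ∑ j ∈ κ, γ i j ^ 2) ≤
          (∑ j ∈ κ, γ i j ^ 2) * (hi ^ 2 * ∑ j ∈ κ, b j i ^ 2) := by
        nlinarith [sq_nonneg hi]
      have h5 := le_of_mul_le_mul_left h4 h0
      rw [div_pow, div_mul_eq_mul_div, le_div_iff₀ (by positivity)]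
      linarith
  calc ∑ i, ∑ j ∈ κ, γ i j ^ 2 ≤ ∑ i, (hi / ν) ^ 2 * ∑ j ∈ κ, b j i ^ 2 :=
        Finset.sum_le_sum fun i _ => hone i
    _ = (hi / ν) ^ 2 * ∑ j ∈ κ, ∑ i, b j i ^ 2 := by rw [← Finset.mul_sum, Finset.sum_comm]
    _ ≤ (hi / ν) ^ 2 * ∑ j ∈ κ, N / lo ^ 2 := by
        gcongr with j hj
        refine (sum_sq_le_of_inner_eq hlo0 hlo (hb j)).trans ?_
        gcongr
        -- Testing the upper head bound on one coordinate bounds the squared length of the column z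
        -- j by N.
        have h1 := hz' (Pi.single j 1)
        have h2 : ∑ l ∈ κ, (Pi.single j 1 : ℕ → ℝ) l ^ 2 = 1 := by
          rw [Finset.sum_eq_single_of_mem j hj fun l _ hl => by simp [hl]]
          simp
        have h3 : ∀ i, ∑ l ∈ κ, (Pi.single j 1 : ℕ → ℝ) l * z i l = z i j := fun i => by
          rw [Finset.sum_eq_single_of_mem j hj fun l _ hl => by simp [hl]]
          simp
        simpa only [h2, h3, mul_one] using h1
    _ = _ := by
        rw [Finset.sum_const, nsmul_eq_mul]
        ring

/-- The tails of the min-norm interpolators of the standard basis vectors are not small. -/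
theorem le_sum_tail_norm_sq [DecidableEq ι] (hhi0 : 0 < hi)
    (hhi : ∀ a : ι → ℝ, ‖∑ i, a i • T i‖ ^ 2 ≤ hi * ∑ i, a i ^ 2)
    (hz' : ∀ γ : ℕ → ℝ, ∑ i, (∑ j ∈ κ, γ j * z i j) ^ 2 ≤ N * ∑ j ∈ κ, γ j ^ 2)
    {g : ι → ι → ℝ} {γ : ι → ℕ → ℝ}
    (heq : ∀ i l, ⟪T l, ∑ m, g i m • T m⟫ + ∑ j ∈ κ, γ i j * z l j = if l = i then 1 else 0) :
    (Fintype.card ι / 2 - N * ∑ i, ∑ j ∈ κ, γ i j ^ 2) / hi ≤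
      ∑ i, ‖∑ m, g i m • T m‖ ^ 2 := by
  rw [div_le_iff₀ hhi0]
  have h1 : ∀ i, (1 : ℝ) / 2 - N * ∑ j ∈ κ, γ i j ^ 2 ≤ ‖∑ m, g i m • T m‖ ^ 2 * hi := by
    intro i
    have h2 := sum_inner_sq_le hhi0.le hhi (∑ m, g i m • T m)
    -- Termwise (A + U)²/2 - U² ≤ A²: what the head does not interpolate is left to the tail.
    have h3 : ∑ l, ((if l = i then 1 else 0) ^ 2 / 2 - (∑ j ∈ κ, γ i j * z l j) ^ 2) ≤
        ∑ l, ⟪T l, ∑ m, g i m • T m⟫ ^ 2 := by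
      refine Finset.sum_le_sum fun l _ => ?_
      rw [← heq i l]
      nlinarith [sq_nonneg (⟪T l, ∑ m, g i m • T m⟫ - ∑ j ∈ κ, γ i j * z l j)]
    rw [Finset.sum_sub_distrib, ← Finset.sum_div] at h3
    simp only [ite_pow, one_pow, ne_eq, OfNat.ofNat_ne_zero, not_false_eq_true, zero_pow,
      Finset.sum_ite_eq', Finset.mem_univ, if_true] at h3
    linarith [hz' (γ i)]
  calc (Fintype.card ι / 2 - N * ∑ i, ∑ j ∈ κ, γ i j ^ 2 : ℝ)
      = ∑ i : ι, (1 / 2 - N * ∑ j ∈ κ, γ i j ^ 2) := by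
        rw [Finset.sum_sub_distrib, ← Finset.mul_sum, Finset.sum_const, Finset.card_univ]
        simp
        ring
    _ ≤ _ := by
        rw [Finset.sum_mul]
        exact Finset.sum_le_sum fun i _ => h1 i

end Split

/-! ## Linear combinations of uncorrelated variables -/

section Uncorrelated

variable {Ω : Type*} [MeasurableSpace Ω] {P : Measure Ω} {ι : Type*}

/-- The second moment of a linear combination of uncorrelated variables. -/
theorem integral_sum_mul_sq [DecidableEq ι] {s : Finset ι} {Y : ι → Ω → ℝ}
    (hY : ∀ i ∈ s, MemLp (Y i) 2 P) {v : ι → ℝ}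
    (hv : ∀ i ∈ s, ∀ j ∈ s, ∫ ω, Y i ω * Y j ω ∂P = if i = j then v i else 0) (a : ι → ℝ) :
    ∫ ω, (∑ i ∈ s, a i * Y i ω) ^ 2 ∂P = ∑ i ∈ s, a i ^ 2 * v i := by
  have hint : ∀ i ∈ s, ∀ j ∈ s, Integrable (fun ω => a i * Y i ω * (a j * Y j ω)) P :=
    fun i hi j hj => by
      have := ((hY i hi).integrable_mul (hY j hj)).const_mul (a i * a j)
      refine this.congr (ae_of_all _ fun ω => ?_)
      simp only [Pi.mul_apply]
      ring
  simp_rw [sq (∑ i ∈ s, a i * Y i _), Finset.sum_mul_sum]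
  rw [integral_finsetSum _ fun i hi => integrable_finsetSum _ fun j hj => hint i hi j hj]
  refine Finset.sum_congr rfl fun i hi => ?_
  rw [integral_finsetSum _ fun j hj => hint i hi j hj]
  have : ∀ j ∈ s, ∫ ω, a i * Y i ω * (a j * Y j ω) ∂P = if i = j then a i * a j * v i else 0 := by
    intro j hj
    have h1 : ∀ ω, a i * Y i ω * (a j * Y j ω) = a i * a j * (Y i ω * Y j ω) := fun ω => by ring
    simp_rw [h1]
    rw [integral_const_mul, hv i hi j hj]
    split_ifs <;> simp
  rw [Finset.sum_congr rfl this, Finset.sum_ite_eq s i, if_pos hi, sq]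

theorem integral_mul_eq_ite_of_iIndepFun [DecidableEq ι] {Y : ι → Ω → ℝ} (hind : iIndepFun Y P)
    (hm : ∀ i, Measurable (Y i)) (hmean : ∀ i, ∫ ω, Y i ω ∂P = 0) {v : ℝ}
    (hvar : ∀ i, ∫ ω, Y i ω ^ 2 ∂P = v) (i j : ι) :
    ∫ ω, Y i ω * Y j ω ∂P = if i = j then v else 0 := by
  split_ifs with h
  · subst h
    simp_rw [← sq]
    exact hvar i
  · rw [(hind.indepFun h).integral_fun_mul_eq_mul_integral (hm i).aestronglyMeasurable
      (hm j).aestronglyMeasurable, hmean i, zero_mul]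

theorem HasSubgaussianMGF_mono {X : Ω → ℝ} {c c' : ℝ≥0} (h : HasSubgaussianMGF X c P)
    (hc : c ≤ c') : HasSubgaussianMGF X c' P :=
  ⟨h.integrable_exp_mul, fun t => (h.mgf_le t).trans (by gcongr)⟩

variable [Fintype ι]

theorem hasSubgaussianMGF_sum_mul {Y : ι → Ω → ℝ} (hind : iIndepFun Y P) {c : ℝ≥0}
    (hY : ∀ i, HasSubgaussianMGF (Y i) c P) {a : ι → ℝ} (ha : ∑ i, a i ^ 2 = 1) :
    HasSubgaussianMGF (fun ω => ∑ i, a i * Y i ω) c P := by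
  have h := HasSubgaussianMGF.sum_of_iIndepFun (X := fun i ω => a i * Y i ω)
    (hind.comp (fun i y => a i * y) fun i => by fun_prop) (s := Finset.univ)
    fun i _ => (hY i).const_mul (a i)
  refine HasSubgaussianMGF_mono h (le_of_eq ?_)
  apply NNReal.eq
  rw [NNReal.coe_sum]
  change ∑ i, a i ^ 2 * (c : ℝ) = c
  rw [← Finset.sum_mul, ha, one_mul]

/-- Two-sided bounds for the quadratic form of an array of independent subgaussian variables. -/
theorem measure_not_array_bounds_le [IsProbabilityMeasure P] {J : Type*} [Fintype J]
    {Y : J → ι → Ω → ℝ} (hm : ∀ j i, Measurable (Y j i))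
    (hcol : iIndepFun (fun j ω => fun i => Y j i ω) P) (hrow : ∀ j, iIndepFun (Y j) P) {c : ℝ≥0}
    (hc : 0 < c) (hsub : ∀ j i, HasSubgaussianMGF (Y j i) c P)
    (hmean : ∀ j i, ∫ ω, Y j i ω ∂P = 0) (hvar : ∀ j i, ∫ ω, Y j i ω ^ 2 ∂P = 1)
    {w : J → ℝ} {wmax : ℝ} (hw : ∀ j, 0 ≤ w j) (hwm : ∀ j, w j ≤ wmax) (hpos : 0 < wmax)
    (hS : 0 < ∑ j, w j ^ 2) {L : ℝ} (hL : 0 ≤ L) {δ : ℝ} (hδ : 0 < δ) (hδ1 : δ ≤ 1)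
    (hδL : 32 * ((L + 1) * (4 * c)) * δ ^ 2 ≤ 1) :
    P {ω | ¬ ∀ a : ι → ℝ, (∑ j, w j) / 8 * ∑ i, a i ^ 2 ≤ ∑ j, w j * (∑ i, a i * Y j i ω) ^ 2 ∧
      ∑ j, w j * (∑ i, a i * Y j i ω) ^ 2 ≤ 4 * ((L + 1) * (4 * c)) * (∑ j, w j) * ∑ i, a i ^ 2} ≤
    ENNReal.ofReal (6 ^ Fintype.card ι * Real.exp (-(L * ((∑ j, w j) / wmax))) +
      (3 / δ) ^ Fintype.card ι *
        Real.exp (-((1 / (4 * c)) ^ 2 / 32 * ((∑ j, w j) ^ 2 / ∑ j, w j ^ 2)))) := by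
  classical
  have hc' : (0 : ℝ) < c := by exact_mod_cast hc
  have hη : (L + 1) / (1 / (4 * c)) = (L + 1) * (4 * (c : ℝ)) := by field_simp
  have h := measure_not_quadraticForm_bounds_le (P := P) (ζ := fun j ω i => Y j i ω)
    (fun j i => hm j i)
    (fun a => hcol.comp (fun _ y => ∑ i, a i * y i) fun _ => by fun_prop)
    (η := 1 / (4 * c)) (by positivity)
    (fun a ha j => by
      have h1 := lintegral_exp_sq_le (P := P) (X := fun ω => ∑ i, a i * Y j i ω)
        (Finset.measurable_sum _ fun i _ => (hm j i).const_mul _) hc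
        (hasSubgaussianMGF_sum_mul (hrow j) (hsub j) ha)
      refine le_trans (le_of_eq ?_) h1
      congr 1
      ext ω
      congr 2
      ring)
    (fun a ha j => by
      rw [integral_sum_mul_sq (fun i _ => (hsub j i).memLp 2) (v := fun _ => 1)
        fun i _ l _ => integral_mul_eq_ite_of_iIndepFun (hrow j) (hm j) (hmean j) (hvar j) i l]
      simpa using ha)
    hw hwm hpos hS hL hδ hδ1 (by rw [hη]; exact hδL)
  rwa [hη] at h

end Uncorrelated

/-! ## Coordinates in the eigenbasis -/

namespace LinearModel

variable {H : Type*} [NormedAddCommGroup H] [InnerProductSpace ℝ H] [MeasurableSpace H]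
  [BorelSpace H] {σx : ℝ≥0} (M : LinearModel H σx)

/-- The eigenvectors, continued by zero. -/
noncomputable def vec (j : ℕ) : H := if h : (j : ℕ∞) < M.p then M.basis ⟨j, h⟩ else 0

/-- The whitened coordinates, continued by zero. -/
noncomputable def white (j : ℕ) (x : H) : ℝ := ⟪M.vec j, x⟫ / √(M.eig j)

theorem vec_of_lt {j : ℕ} (h : (j : ℕ∞) < M.p) : M.vec j = M.basis ⟨j, h⟩ := dif_pos h

theorem vec_of_le {j : ℕ} (h : M.p ≤ (j : ℕ∞)) : M.vec j = 0 := dif_neg (not_lt.2 h)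

theorem eig_nonneg (j : ℕ) : 0 ≤ M.eig j := by
  rcases lt_or_ge (j : ℕ∞) M.p with h | h
  · exact (M.eig_pos j h).le
  · exact (M.eig_eq_zero j h).ge

theorem lt_p_of_eig_pos {j : ℕ} (h : 0 < M.eig j) : (j : ℕ∞) < M.p := by
  by_contra hcon
  exact h.ne' (M.eig_eq_zero j (not_lt.1 hcon))

theorem coef_eq (j : ℕ) : M.coef j = ⟪M.vec j, M.truth⟫ := by
  unfold coef vec
  split_ifs <;> simp

theorem inner_vec_eq (j : ℕ) (x : H) : ⟪M.vec j, x⟫ = √(M.eig j) * M.white j x := by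
  rcases lt_or_ge (j : ℕ∞) M.p with h | h
  · have := Real.sqrt_pos.2 (M.eig_pos j h)
    rw [white]
    field_simp
  · simp [white, M.vec_of_le h]

theorem inner_vec_vec (i j : ℕ) :
    ⟪M.vec i, M.vec j⟫ = if i = j ∧ (i : ℕ∞) < M.p then 1 else 0 := by
  classical
  rcases lt_or_ge (i : ℕ∞) M.p with hi | hi
  · rcases lt_or_ge (j : ℕ∞) M.p with hj | hj
    · rw [M.vec_of_lt hi, M.vec_of_lt hj, orthonormal_iff_ite.1 M.basis.orthonormal]
      simp [hi]
    · rw [M.vec_of_le hj, inner_zero_right, if_neg]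
      rintro ⟨rfl, h⟩
      exact absurd h (not_lt.2 hj)
  · simp [M.vec_of_le hi, not_lt.2 hi]

theorem hasSum_inner (x y : H) : HasSum (fun j => ⟪M.vec j, x⟫ * ⟪M.vec j, y⟫) ⟪x, y⟫ := by
  have h := M.basis.hasSum_inner_mul_inner x y
  rw [← Function.Injective.hasSum_iff (f := fun j => ⟪M.vec j, x⟫ * ⟪M.vec j, y⟫)
    (g := fun i : CoordIdx M.p => (i : ℕ)) Subtype.val_injective]
  · refine h.congr_fun fun i => ?_
    simp only [Function.comp_apply]
    rw [M.vec_of_lt i.2, real_inner_comm]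
  · intro j hj
    have : M.p ≤ (j : ℕ∞) := by
      by_contra hcon
      exact hj ⟨⟨j, not_le.1 hcon⟩, rfl⟩
    simp [M.vec_of_le this]

theorem hasSum_sq_inner (x : H) : HasSum (fun j => ⟪M.vec j, x⟫ ^ 2) (‖x‖ ^ 2) := by
  have := M.hasSum_inner x x
  rw [real_inner_self_eq_norm_sq] at this
  simpa only [← sq] using this

/-- The projection onto the span of the eigenvectors with index at least `k`. -/
noncomputable def tl (k : ℕ) : H →ₗ[ℝ] H where
  toFun x := x - ∑ j ∈ Finset.range k, ⟪M.vec j, x⟫ • M.vec j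
  map_add' x y := by
    simp only [inner_add_right, add_smul, Finset.sum_add_distrib]
    abel
  map_smul' r x := by
    simp only [real_inner_smul_right, mul_smul, ← Finset.smul_sum, smul_sub, RingHom.id_apply]

theorem tl_apply (k : ℕ) (x : H) :
    M.tl k x = x - ∑ j ∈ Finset.range k, ⟪M.vec j, x⟫ • M.vec j := rfl

theorem inner_vec_tl (k j : ℕ) (x : H) :
    ⟪M.vec j, M.tl k x⟫ = if j < k then 0 else ⟪M.vec j, x⟫ := by
  rw [tl_apply, inner_sub_right, inner_sum]
  simp_rw [real_inner_smul_right, inner_vec_vec]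
  rcases lt_or_ge (j : ℕ∞) M.p with h | h
  · simp only [h, and_true, mul_ite, mul_one, mul_zero, Finset.sum_ite_eq, Finset.mem_range]
    split_ifs <;> simp
  · simp [M.vec_of_le h, not_lt.2 h]

theorem inner_tl_left (k : ℕ) (x y : H) :
    ⟪M.tl k x, y⟫ = ⟪x, y⟫ - ∑ j ∈ Finset.range k, ⟪M.vec j, x⟫ * ⟪M.vec j, y⟫ := by
  rw [tl_apply, inner_sub_left, sum_inner]
  simp_rw [real_inner_smul_left]

theorem inner_tl_tl (k : ℕ) (x y : H) : ⟪M.tl k x, M.tl k y⟫ = ⟪M.tl k x, y⟫ := by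
  rw [M.tl_apply k y, inner_sub_right, inner_sum, Finset.sum_eq_zero, sub_zero]
  intro j hj
  rw [real_inner_smul_right, real_inner_comm (M.vec j) (M.tl k x), inner_vec_tl,
    if_pos (Finset.mem_range.1 hj),
    mul_zero]

theorem hasSum_norm_tl_sq (k : ℕ) (x : H) :
    HasSum (fun i => ⟪M.vec (k + i), x⟫ ^ 2) (‖M.tl k x‖ ^ 2) := by
  have h := M.hasSum_sq_inner (M.tl k x)
  simp_rw [inner_vec_tl] at h
  rw [← hasSum_nat_add_iff' k, Finset.sum_eq_zero (fun j hj => by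
    rw [if_pos (Finset.mem_range.1 hj)]; simp), sub_zero] at h
  refine h.congr_fun fun i => ?_
  rw [if_neg (by omega), add_comm]

theorem norm_tl_sq_add (k m : ℕ) (x : H) :
    ‖M.tl k x‖ ^ 2 = ∑ l ∈ Finset.range m, ⟪M.vec (k + l), x⟫ ^ 2 + ‖M.tl (k + m) x‖ ^ 2 := by
  have h := M.hasSum_norm_tl_sq k x
  rw [← h.tsum_eq, ← h.summable.sum_add_tsum_nat_add m, ← (M.hasSum_norm_tl_sq (k + m) x).tsum_eq]
  congr 2
  ext i
  rw [add_assoc, add_comm i m]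

theorem norm_tl_le (k : ℕ) (x : H) : ‖M.tl k x‖ ^ 2 ≤ ‖x‖ ^ 2 := by
  have h := M.norm_tl_sq_add 0 k x
  have h0 : M.tl 0 x = x := by simp [tl_apply]
  rw [h0, zero_add] at h
  rw [h]
  have : 0 ≤ ∑ l ∈ Finset.range k, ⟪M.vec (0 + l), x⟫ ^ 2 :=
    Finset.sum_nonneg fun i _ => sq_nonneg _
  linarith

/-- Finite combinations of the countable basis are dense. Second countability makes the inner
product jointly measurable on H × H, as exchanging the averages over inputs and parameters requires.
-/
theorem secondCountable (M : LinearModel H σx) : SecondCountableTopology H := by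
  have : Countable (CoordIdx M.p) := inferInstance
  have h := M.basis.dense_span
  have hsep : TopologicalSpace.IsSeparable (Set.univ : Set H) := by
    have h1 : TopologicalSpace.IsSeparable
        ((Submodule.span ℝ (Set.range M.basis) : Submodule ℝ H) : Set H) :=
      (Set.countable_range M.basis).isSeparable.span
    have h2 := h1.closure
    have h3 : closure ((Submodule.span ℝ (Set.range M.basis) : Submodule ℝ H) : Set H) =
        Set.univ := by
      rw [← Submodule.topologicalClosure_coe, h]
      rfl
    rwa [h3] at h2
  have := TopologicalSpace.isSeparable_univ_iff.1 hsep
  exact UniformSpace.secondCountable_of_separable H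

theorem measurable_inner_vec (j : ℕ) : Measurable fun x : H => ⟪M.vec j, x⟫ :=
  (continuous_const.inner continuous_id).measurable

theorem measurable_white (j : ℕ) : Measurable (M.white j) :=
  (M.measurable_inner_vec j).div_const _

theorem continuous_tl (k : ℕ) : Continuous (M.tl k) := by
  change Continuous fun x => x - ∑ j ∈ Finset.range k, ⟪M.vec j, x⟫ • M.vec j
  fun_prop

/-! ## Moments of the inputs -/

instance : IsProbabilityMeasure M.inputLaw := M.inputLaw_prob

instance : IsProbabilityMeasure M.prior := M.prior_prob

instance : IsMarkovKernel M.labelLaw := M.labelLaw_markov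

instance (n : ℕ) : IsProbabilityMeasure (M.designLaw n) := by
  unfold designLaw; infer_instance

theorem white_of_lt {j : ℕ} (h : (j : ℕ∞) < M.p) :
    M.white j = fun x => ⟪M.basis ⟨j, h⟩, x⟫ / √(M.eig j) := by
  ext x
  rw [white, M.vec_of_lt h]

theorem white_of_le {j : ℕ} (h : M.p ≤ (j : ℕ∞)) : M.white j = 0 := by
  ext x
  simp [white, M.vec_of_le h]

theorem white_hasSubgaussianMGF {j : ℕ} (h : (j : ℕ∞) < M.p) :
    HasSubgaussianMGF (M.white j) (σx ^ 2) M.inputLaw := by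
  rw [M.white_of_lt h]
  exact M.white_subgaussian ⟨j, h⟩

theorem integral_white {j : ℕ} (h : (j : ℕ∞) < M.p) : ∫ x, M.white j x ∂M.inputLaw = 0 := by
  rw [M.white_of_lt h]
  exact M.white_mean ⟨j, h⟩

theorem integral_white_sq {j : ℕ} (h : (j : ℕ∞) < M.p) :
    ∫ x, M.white j x ^ 2 ∂M.inputLaw = 1 := by
  rw [M.white_of_lt h]
  exact M.white_var ⟨j, h⟩

theorem iIndepFun_white {ι : Type*} {f : ι → ℕ} (hf : Function.Injective f)
    (hp : ∀ i, (f i : ℕ∞) < M.p) : iIndepFun (fun i => M.white (f i)) M.inputLaw := by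
  have h := M.white_indep.precomp (g := fun i => (⟨f i, hp i⟩ : CoordIdx M.p)) fun a b hab => by
    simp only [Subtype.mk.injEq] at hab
    exact hf hab
  convert h using 2 with i
  exact M.white_of_lt (hp i)

theorem memLp_inner_vec (j : ℕ) : MemLp (fun x => ⟪M.vec j, x⟫) 2 M.inputLaw := by
  simp_rw [M.inner_vec_eq j]
  rcases lt_or_ge (j : ℕ∞) M.p with h | h
  · exact ((M.white_hasSubgaussianMGF h).memLp 2).const_mul _
  · simp [M.white_of_le h]

theorem integral_inner_vec_mul (i j : ℕ) :
    ∫ x, ⟪M.vec i, x⟫ * ⟪M.vec j, x⟫ ∂M.inputLaw = if i = j then M.eig i else 0 := by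
  have h1 : ∀ x, ⟪M.vec i, x⟫ * ⟪M.vec j, x⟫ =
      √(M.eig i) * √(M.eig j) * (M.white i x * M.white j x) := fun x => by
    rw [M.inner_vec_eq i, M.inner_vec_eq j]; ring
  simp_rw [h1]
  rw [integral_const_mul]
  rcases lt_or_ge (i : ℕ∞) M.p with hi | hi
  · split_ifs with h
    · subst h
      simp_rw [← sq]
      rw [M.integral_white_sq hi, Real.sq_sqrt (M.eig_nonneg i), mul_one]
    · rcases lt_or_ge (j : ℕ∞) M.p with hj | hj
      · have hind := (M.iIndepFun_white (f := fun k : CoordIdx M.p => (k : ℕ))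
          Subtype.val_injective fun k => k.2).indepFun
          (i := ⟨i, hi⟩) (j := ⟨j, hj⟩) (by simpa using h)
        rw [hind.integral_fun_mul_eq_mul_integral (M.measurable_white i).aestronglyMeasurable
          (M.measurable_white j).aestronglyMeasurable, M.integral_white hi, zero_mul, mul_zero]
      · simp [M.white_of_le hj]
  · have : M.eig i = 0 := M.eig_eq_zero i hi
    simp [this]

theorem lintegral_inner_vec_sq (j : ℕ) :
    ∫⁻ x, ENNReal.ofReal (⟪M.vec j, x⟫ ^ 2) ∂M.inputLaw = ENNReal.ofReal (M.eig j) := by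
  rw [← ofReal_integral_eq_lintegral_ofReal (M.memLp_inner_vec j).integrable_sq
    (ae_of_all _ fun _ => sq_nonneg _)]
  simp_rw [sq]
  rw [M.integral_inner_vec_mul, if_pos rfl]

theorem ofReal_norm_tl_sq (k : ℕ) (x : H) :
    ENNReal.ofReal (‖M.tl k x‖ ^ 2) = ∑' i, ENNReal.ofReal (⟪M.vec (k + i), x⟫ ^ 2) := by
  have h := M.hasSum_norm_tl_sq k x
  rw [← h.tsum_eq, ENNReal.ofReal_tsum_of_nonneg (fun _ => sq_nonneg _) h.summable]

theorem summable_eig_add (k : ℕ) : Summable fun i => M.eig (k + i) := by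
  simpa only [add_comm] using (summable_nat_add_iff k).2 M.eig_summable

theorem lintegral_norm_tl_sq (k : ℕ) :
    ∫⁻ x, ENNReal.ofReal (‖M.tl k x‖ ^ 2) ∂M.inputLaw = ENNReal.ofReal (M.tail k) := by
  simp_rw [ofReal_norm_tl_sq]
  rw [lintegral_tsum fun i =>
    ((M.measurable_inner_vec _).pow_const 2).ennreal_ofReal.aemeasurable]
  simp_rw [lintegral_inner_vec_sq]
  rw [tail, ENNReal.ofReal_tsum_of_nonneg (fun _ => M.eig_nonneg _) (M.summable_eig_add k)]

/-- The second moment of a linear functional of an input. -/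
theorem lintegral_inner_sq_le (v : H) :
    ∫⁻ x, ENNReal.ofReal (⟪x, v⟫ ^ 2) ∂M.inputLaw ≤
      ∑' j, ENNReal.ofReal (M.eig j * ⟪M.vec j, v⟫ ^ 2) := by
  set F : ℕ → H → ℝ≥0∞ := fun N x =>
    ENNReal.ofReal ((∑ j ∈ Finset.range N, ⟪M.vec j, v⟫ * ⟪M.vec j, x⟫) ^ 2) with hF
  have hFm : ∀ N, Measurable (F N) := fun N =>
    ((Finset.measurable_sum _ fun j _ =>
      (M.measurable_inner_vec j).const_mul _).pow_const 2).ennreal_ofReal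
  have hlim : ∀ x, ENNReal.ofReal (⟪x, v⟫ ^ 2) = liminf (fun N => F N x) atTop := by
    intro x
    refine (Tendsto.liminf_eq ?_).symm
    refine ENNReal.tendsto_ofReal (Tendsto.pow ?_ 2)
    rw [real_inner_comm]
    exact (M.hasSum_inner v x).tendsto_sum_nat
  simp_rw [hlim]
  -- Fatou's lemma along the partial sums of the expansion, whose second moments are explicit
  -- because the coordinates are uncorrelated.
  refine (lintegral_liminf_le hFm).trans ?_
  refine (liminf_le_liminf (Eventually.of_forall fun N => ?_)).trans (liminf_const _).le
  have h1 : ∫⁻ x, F N x ∂M.inputLaw =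
      ENNReal.ofReal (∑ j ∈ Finset.range N, ⟪M.vec j, v⟫ ^ 2 * M.eig j) := by
    rw [← integral_sum_mul_sq (fun j _ => M.memLp_inner_vec j)
      (fun i _ j _ => M.integral_inner_vec_mul i j) fun j => ⟪M.vec j, v⟫]
    rw [ofReal_integral_eq_lintegral_ofReal _ (ae_of_all _ fun _ => sq_nonneg _)]
    exact MemLp.integrable_sq (memLp_finsetSum _ fun j _ => (M.memLp_inner_vec j).const_mul _)
  rw [h1, ENNReal.ofReal_sum_of_nonneg fun j _ => mul_nonneg (sq_nonneg _) (M.eig_nonneg j)]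
  refine (ENNReal.sum_le_tsum _).trans (le_of_eq ?_)
  simp_rw [mul_comm]

/-! ## Probability of the good events -/

/-- The tails of the inputs form a family with frame bounds `lo` and `hi`. -/
def TailBounds (k : ℕ) {n : ℕ} (lo hi : ℝ) (X : Fin n → H) : Prop :=
  ∀ a : Fin n → ℝ, lo * ∑ i, a i ^ 2 ≤ ‖∑ i, a i • M.tl k (X i)‖ ^ 2 ∧
    ‖∑ i, a i • M.tl k (X i)‖ ^ 2 ≤ hi * ∑ i, a i ^ 2

/-- The whitened heads of the inputs are well conditioned, with bounds `lo` and `hi`. -/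
def HeadBounds (k : ℕ) {n : ℕ} (lo hi : ℝ) (X : Fin n → H) : Prop :=
  ∀ γ : ℕ → ℝ,
    lo * ∑ j ∈ Finset.range k, γ j ^ 2 ≤
      ∑ i, (∑ j ∈ Finset.range k, γ j * M.white j (X i)) ^ 2 ∧
    ∑ i, (∑ j ∈ Finset.range k, γ j * M.white j (X i)) ^ 2 ≤ hi * ∑ j ∈ Finset.range k, γ j ^ 2

theorem measurePreserving_eval_design {n : ℕ} (i : Fin n) :
    MeasurePreserving (fun X : Fin n → H => X i) (M.designLaw n) M.inputLaw :=
  measurePreserving_eval (fun _ : Fin n => M.inputLaw) i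

theorem lintegral_design_sum {n : ℕ} {f : H → ℝ≥0∞} (hf : Measurable f) :
    ∫⁻ X, ∑ i : Fin n, f (X i) ∂(M.designLaw n) = n * ∫⁻ x, f x ∂M.inputLaw := by
  rw [lintegral_finsetSum (f := fun i (X : Fin n → H) => f (X i)) _
    fun i _ => hf.comp (measurable_pi_apply i)]
  simp_rw [fun i : Fin n => (M.measurePreserving_eval_design i).lintegral_comp hf]
  simp

/-- The parameter `σx ^ 2 + 1` is positive whatever `σx` is, as the exponential moment bound for
squares requires. -/
theorem white_eval_facts {n : ℕ} (i : Fin n) {j : ℕ} (h : (j : ℕ∞) < M.p) :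
    HasSubgaussianMGF (fun X : Fin n → H => M.white j (X i)) (σx ^ 2 + 1) (M.designLaw n) ∧
    ∫ X, M.white j (X i) ∂(M.designLaw n) = 0 ∧
    ∫ X, M.white j (X i) ^ 2 ∂(M.designLaw n) = 1 := by
  have e := M.measurePreserving_eval_design i
  have key : ∀ f : H → ℝ, Measurable f →
      ∫ X, f (X i) ∂(M.designLaw n) = ∫ x, f x ∂M.inputLaw := fun f hf => by
    rw [← e.map_eq, integral_map e.measurable.aemeasurable hf.aestronglyMeasurable]
  refine ⟨HasSubgaussianMGF_mono ?_ (le_add_of_nonneg_right zero_le_one), ?_, ?_⟩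
  · refine HasSubgaussianMGF.of_map (X := M.white j) e.measurable.aemeasurable ?_
    rw [e.map_eq]
    exact M.white_hasSubgaussianMGF h
  · rw [key _ (M.measurable_white j), M.integral_white h]
  · rw [key (fun x => M.white j x ^ 2) ((M.measurable_white j).pow_const 2), M.integral_white_sq h]

theorem measurable_white_eval {n : ℕ} (i : Fin n) (j : ℕ) :
    Measurable fun X : Fin n → H => M.white j (X i) :=
  (M.measurable_white j).comp (measurable_pi_apply i)

/-- The array bound in dimension k with the n inputs as independent vectors of weight 1; both
effective ranks are then n. -/
theorem measure_not_headBounds_le {k n : ℕ} (hk : (k : ℕ∞) ≤ M.p) (hn : 0 < n) {L δ : ℝ}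
    (hL : 0 ≤ L) (hδ : 0 < δ) (hδ1 : δ ≤ 1)
    (hδL : 32 * ((L + 1) * (4 * (σx ^ 2 + 1))) * δ ^ 2 ≤ 1) :
    M.designLaw n {X | ¬ M.HeadBounds k (n / 8) (4 * ((L + 1) * (4 * (σx ^ 2 + 1))) * n) X} ≤
      ENNReal.ofReal (6 ^ k * Real.exp (-(L * n)) +
        (3 / δ) ^ k * Real.exp (-((1 / (4 * (σx ^ 2 + 1))) ^ 2 / 32 * n))) := by
  have hn' : (0 : ℝ) < n := by exact_mod_cast hn
  have hp : ∀ j : Fin k, ((j : ℕ) : ℕ∞) < M.p := fun j =>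
    lt_of_lt_of_le (by exact_mod_cast j.2) hk
  have hind := M.iIndepFun_white Fin.val_injective hp
  have h := measure_not_array_bounds_le (P := M.designLaw n)
    (Y := fun (i : Fin n) (j : Fin k) (X : Fin n → H) => M.white j (X i))
    (fun i j => M.measurable_white_eval i j)
    (iIndepFun_pi (X := fun _ x (j : Fin k) => M.white j x)
      fun i => (measurable_pi_lambda _ fun j : Fin k => M.measurable_white j).aemeasurable)
    (fun i => iIndepFun_comp_measurePreserving (M.measurePreserving_eval_design i)
      (fun j => M.measurable_white j) hind)
    (c := σx ^ 2 + 1) (by positivity)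
    (fun i j => (M.white_eval_facts i (hp j)).1) (fun i j => (M.white_eval_facts i (hp j)).2.1)
    (fun i j => (M.white_eval_facts i (hp j)).2.2) (w := fun _ => 1) (wmax := 1)
    (fun _ => zero_le_one) (fun _ => le_rfl) one_pos (by simpa using hn) hL hδ hδ1
    (by push_cast; exact hδL)
  simp only [Finset.sum_const, Finset.card_univ, Fintype.card_fin, nsmul_eq_mul, mul_one, one_mul,
    div_one, one_pow, NNReal.coe_add, NNReal.coe_pow, NNReal.coe_one] at h
  rw [show (n : ℝ) ^ 2 / n = n by field_simp] at h
  refine le_trans (measure_mono fun X hX => ?_) h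
  rw [Set.mem_ofPred_eq] at hX ⊢
  refine fun hcon => hX fun γ => ?_
  have := hcon fun j => γ j
  simpa only [Finset.sum_range] using this


theorem tail_eq_sum_add (k m : ℕ) :
    M.tail k = ∑ l ∈ Finset.range m, M.eig (k + l) + M.tail (k + m) := by
  rw [tail, tail, ← (M.summable_eig_add k).sum_add_tsum_nat_add m]
  congr 2
  ext i
  rw [add_assoc, add_comm i m]

theorem tail_nonneg (k : ℕ) : 0 ≤ M.tail k := tsum_nonneg fun _ => M.eig_nonneg _

theorem eig_le_tail (k : ℕ) : M.eig k ≤ M.tail k := by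
  have := M.tail_eq_sum_add k 1
  simp only [Finset.sum_range_one, add_zero] at this
  linarith [M.tail_nonneg (k + 1)]

theorem summable_eig_sq (k : ℕ) : Summable fun i => M.eig (k + i) ^ 2 := by
  refine Summable.of_nonneg_of_le (fun i => sq_nonneg _) (fun i => ?_)
    ((M.summable_eig_add k).mul_left (M.eig 0))
  rw [sq]
  exact mul_le_mul_of_nonneg_right (M.eig_antitone (Nat.zero_le _)) (M.eig_nonneg _)

/-- Truncations of the tail below the dimension, with small remainder. -/
theorem exists_truncation (k : ℕ) {ε : ℝ} (hε : 0 < ε) :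
    ∃ m : ℕ, (∀ l < m, ((k + l : ℕ) : ℕ∞) < M.p) ∧ M.tail (k + m) ≤ ε := by
  classical
  -- In finite dimension the truncation stops exactly at the dimension and leaves no remainder;
  -- otherwise the tails of the convergent eigenvalue series tend to 0.
  by_cases h : ∃ l : ℕ, M.p ≤ ((k + l : ℕ) : ℕ∞)
  · refine ⟨Nat.find h, fun l hl => not_le.1 (Nat.find_min h hl), ?_⟩
    have h0 : ∀ i, M.eig (k + Nat.find h + i) = 0 := fun i =>
      M.eig_eq_zero _ ((Nat.find_spec h).trans (by exact_mod_cast Nat.le_add_right _ _))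
    rw [tail]
    simp only [h0, tsum_zero]
    exact hε.le
  · push Not at h
    have hlim : Tendsto (fun m => M.tail (k + m)) atTop (𝓝 0) := by
      have := tendsto_sum_nat_add fun i => M.eig (k + i)
      refine this.congr fun m => tsum_congr fun i => ?_
      congr 1
      ring
    obtain ⟨m, hm⟩ := (hlim.eventually (ge_mem_nhds hε)).exists
    exact ⟨m, fun l _ => h l, hm⟩

/-- Splits the tail quadratic form into finitely many weighted squares of independent variables and
a remainder. -/
theorem norm_tl_sum_sq (k m : ℕ) {n : ℕ} (a : Fin n → ℝ) (X : Fin n → H) :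
    ‖∑ i, a i • M.tl k (X i)‖ ^ 2 =
      ∑ l : Fin m, M.eig (k + l) * (∑ i, a i * M.white (k + l) (X i)) ^ 2 +
        ‖∑ i, a i • M.tl (k + m) (X i)‖ ^ 2 := by
  have h1 : ∀ k, ∑ i, a i • M.tl k (X i) = M.tl k (∑ i, a i • X i) := fun k => by
    simp only [map_sum, map_smul]
  rw [h1, h1, M.norm_tl_sq_add k m, Finset.sum_range]
  congr 1
  refine Finset.sum_congr rfl fun l _ => ?_
  rw [inner_sum]
  simp_rw [real_inner_smul_right, M.inner_vec_eq (k + l)]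
  rw [← Real.sq_sqrt (M.eig_nonneg (k + l)), ← mul_pow, Finset.mul_sum,
    Real.sqrt_sq (Real.sqrt_nonneg _)]
  congr 1
  exact Finset.sum_congr rfl fun i _ => by ring

theorem measurable_norm_tl_sq (k : ℕ) :
    Measurable fun x : H => ENNReal.ofReal (‖M.tl k x‖ ^ 2) :=
  ((M.continuous_tl k).norm.pow 2).measurable.ennreal_ofReal

/-- The array bound in dimension n with the roles exchanged: the independent vectors are the
whitened tail coordinates of all inputs, and the eigenvalues are the weights. This is where r_k and
R_k appear. -/
theorem measure_not_tailBounds_le {k n : ℕ} (hk : 0 < M.eig k) {L δ : ℝ}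
    (hL : 0 ≤ L) (hδ : 0 < δ) (hδ1 : δ ≤ 1)
    (hδL : 32 * ((L + 1) * (4 * (σx ^ 2 + 1))) * δ ^ 2 ≤ 1) {ε : ℝ} (hε : 0 < ε) :
    M.designLaw n {X | ¬ M.TailBounds k (M.tail k / 16)
      ((4 * ((L + 1) * (4 * (σx ^ 2 + 1))) + 1) * M.tail k) X} ≤
      ENNReal.ofReal (6 ^ n * Real.exp (-(L * (M.rankr k / 2))) +
        (3 / δ) ^ n * Real.exp (-((1 / (4 * (σx ^ 2 + 1))) ^ 2 / 32 * (M.rankR k / 4)))) +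
      ENNReal.ofReal ε := by
  set t := M.tail k with ht
  set C : ℝ := 4 * ((L + 1) * (4 * (σx ^ 2 + 1))) with hC
  have hC0 : 0 ≤ C := by positivity
  have ht0 : 0 < t := hk.trans_le (M.eig_le_tail k)
  -- The bound t/2 keeps half of the total weight, at the cost of the factors 1/2 on r_k and 1/4 on
  -- R_k. The bound tε/(n+1) makes the n remainders add up to at least t with probability at most ε.
  obtain ⟨m, hmp, hm⟩ := M.exists_truncation k
    (ε := min (t / 2) (t * ε / (n + 1))) (lt_min (by positivity) (by positivity))
  have hm1 := hm.trans (min_le_left _ _)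
  have hm2 := hm.trans (min_le_right _ _)
  set W := ∑ l : Fin m, M.eig (k + l) with hW
  have hWt : t = W + M.tail (k + m) := by
    rw [ht, M.tail_eq_sum_add k m, Finset.sum_range]
  have hW1 : t / 2 ≤ W := by linarith
  have hW2 : W ≤ t := by linarith [M.tail_nonneg (k + m)]
  set S := ∑ l : Fin m, M.eig (k + l) ^ 2 with hS
  have hmpos : 0 < m := by
    by_contra hcon
    have h0 : m = 0 := by omega
    subst h0
    simp only [hW, Finset.univ_eq_empty, Finset.sum_empty] at hW1
    linarith
  have hS0 : 0 < S := by
    refine lt_of_lt_of_le ?_ (Finset.single_le_sum (f := fun l : Fin m => M.eig (k + l) ^ 2)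
      (fun l _ => sq_nonneg _) (Finset.mem_univ ⟨0, hmpos⟩))
    simpa using pow_pos hk 2
  have hS1 : S ≤ ∑' i, M.eig (k + i) ^ 2 := by
    rw [hS, ← Finset.sum_range fun l => M.eig (k + l) ^ 2]
    exact (M.summable_eig_sq k).sum_le_tsum _ fun _ _ => sq_nonneg _
  have hinj : Function.Injective fun l : Fin m => k + (l : ℕ) := fun a b hab =>
    Fin.ext (by simpa using hab)
  have hp : ∀ l : Fin m, ((k + (l : ℕ) : ℕ) : ℕ∞) < M.p := fun l => hmp l l.2
  have hind := M.iIndepFun_white hinj hp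
  have hrow : ∀ l : Fin m,
      iIndepFun (fun (i : Fin n) (X : Fin n → H) => M.white (k + l) (X i)) (M.designLaw n) :=
    fun l => iIndepFun_pi (X := fun _ x => M.white (k + l) x)
      fun i => (M.measurable_white _).aemeasurable
  have h := measure_not_array_bounds_le (P := M.designLaw n)
    (Y := fun (l : Fin m) (i : Fin n) (X : Fin n → H) => M.white (k + l) (X i))
    (fun l i => M.measurable_white_eval i _)
    (iIndepFun_columns (fun l => M.measurable_white _) hind n) hrow
    (c := σx ^ 2 + 1) (by positivity)
    (fun l i => (M.white_eval_facts i (hp l)).1) (fun l i => (M.white_eval_facts i (hp l)).2.1)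
    (fun l i => (M.white_eval_facts i (hp l)).2.2) (w := fun l => M.eig (k + l)) (wmax := M.eig k)
    (fun l => M.eig_nonneg _) (fun l => M.eig_antitone (Nat.le_add_right _ _)) hk hS0 hL hδ hδ1
    (by push_cast; exact hδL)
  simp only [Fintype.card_fin, NNReal.coe_add, NNReal.coe_pow, NNReal.coe_one, ← hW, ← hS,
    ← hC] at h
  have hrem : M.designLaw n {X | ENNReal.ofReal t ≤
      ∑ i, ENNReal.ofReal (‖M.tl (k + m) (X i)‖ ^ 2)} ≤ ENNReal.ofReal ε := by
    have hmeas : Measurable fun X : Fin n → H =>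
        ∑ i, ENNReal.ofReal (‖M.tl (k + m) (X i)‖ ^ 2) :=
      Finset.measurable_sum _ fun i _ =>
        (M.measurable_norm_tl_sq (k + m)).comp (measurable_pi_apply i)
    refine (meas_ge_le_lintegral_div hmeas.aemeasurable
      (by simpa using ht0) ENNReal.ofReal_ne_top).trans ?_
    rw [M.lintegral_design_sum (M.measurable_norm_tl_sq _), M.lintegral_norm_tl_sq,
      ← ENNReal.ofReal_natCast, ← ENNReal.ofReal_mul (by positivity),
      ← ENNReal.ofReal_div_of_pos ht0]
    apply ENNReal.ofReal_le_ofReal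
    rw [div_le_iff₀ ht0]
    calc (n : ℝ) * M.tail (k + m) ≤ n * (t * ε / (n + 1)) := by gcongr
      _ = ε * t * (n / (n + 1)) := by ring
      _ ≤ ε * t * 1 := by
          gcongr
          rw [div_le_one (by positivity)]
          linarith
      _ = _ := mul_one _
  refine (measure_mono (t := _ ∪ _) fun X hX => ?_).trans ((measure_union_le _ _).trans
    (add_le_add (h.trans ?_) hrem))
  · by_contra hcon
    rw [Set.mem_union, not_or, Set.mem_ofPred_eq, Set.mem_ofPred_eq, not_not, not_le] at hcon
    refine hX fun a => ?_
    obtain ⟨h1, h2⟩ := hcon.1 a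
    have h3 : ∑ i, ‖M.tl (k + m) (X i)‖ ^ 2 ≤ t := by
      have := hcon.2
      rw [← ENNReal.ofReal_sum_of_nonneg fun i _ => by positivity] at this
      exact ((ENNReal.ofReal_lt_ofReal_iff ht0).1 this).le
    have h4 := norm_sum_smul_sq_le a fun i => M.tl (k + m) (X i)
    have ha0 : 0 ≤ ∑ i, a i ^ 2 := Finset.sum_nonneg fun i _ => sq_nonneg _
    rw [M.norm_tl_sum_sq k m]
    constructor
    · calc t / 16 * ∑ i, a i ^ 2 ≤ W / 8 * ∑ i, a i ^ 2 := by
            gcongr ?_ * _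
            linarith
        _ ≤ _ := h1
        _ ≤ _ := le_add_of_nonneg_right (sq_nonneg _)
    · calc _ ≤ C * W * ∑ i, a i ^ 2 + (∑ i, ‖M.tl (k + m) (X i)‖ ^ 2) * ∑ i, a i ^ 2 :=
            add_le_add h2 h4
        _ ≤ C * t * ∑ i, a i ^ 2 + t * ∑ i, a i ^ 2 := by gcongr
        _ = _ := by ring
  · apply ENNReal.ofReal_le_ofReal
    have hr : M.rankr k / 2 ≤ W / M.eig k := by
      rw [rankr, ← ht, div_right_comm]
      gcongr
    have hR : M.rankR k / 4 ≤ W ^ 2 / S := by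
      rw [rankR, ← ht]
      calc t ^ 2 / (∑' i, M.eig (k + i) ^ 2) / 4 ≤ t ^ 2 / S / 4 := by gcongr
        _ = (t / 2) ^ 2 / S := by ring
        _ ≤ _ := by gcongr
    gcongr

end LinearModel

/-! ## Affine functions of independent labels -/

/-- The second moment of an affine function of independent variables with common variance. -/
theorem lintegral_pi_affine_sq {n : ℕ} {ν : Fin n → Measure ℝ} [∀ i, IsProbabilityMeasure (ν i)]
    (hL : ∀ i, MemLp id 2 (ν i)) {m : Fin n → ℝ} (hm : ∀ i, ∫ y, y ∂(ν i) = m i) {v : ℝ}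
    (hv : ∀ i, ∫ y, (y - m i) ^ 2 ∂(ν i) = v) (c : ℝ) (a : Fin n → ℝ) :
    ∫⁻ y, ENNReal.ofReal ((c + ∑ i, a i * (y i - m i)) ^ 2) ∂(Measure.pi ν) =
      ENNReal.ofReal (c ^ 2 + v * ∑ i, a i ^ 2) := by
  set P := Measure.pi ν with hP
  have e : ∀ i, MeasurePreserving (fun y : Fin n → ℝ => y i) P (ν i) := measurePreserving_eval ν
  set Y : Fin n → (Fin n → ℝ) → ℝ := fun i y => y i - m i with hYdef
  have hYm : ∀ i, Measurable (Y i) := fun i => by fun_prop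
  have hY2 : ∀ i, MemLp (Y i) 2 P := fun i =>
    ((hL i).comp_measurePreserving (e i)).sub (memLp_const (m i))
  have hint : ∀ i, Integrable (fun y : ℝ => y) (ν i) := fun i => (hL i).integrable (by norm_num)
  have hmean : ∀ i, ∫ y, Y i y ∂P = 0 := fun i => by
    have h1 : ∫ y, Y i y ∂P = ∫ x, x - m i ∂(ν i) := by
      rw [← (e i).map_eq, integral_map (e i).measurable.aemeasurable (by fun_prop)]
    rw [h1, integral_sub (hint i) (integrable_const _), hm i]
    simp
  have hvar : ∀ i, ∫ y, Y i y ^ 2 ∂P = v := fun i => by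
    have h1 : ∫ y, Y i y ^ 2 ∂P = ∫ x, (x - m i) ^ 2 ∂(ν i) := by
      rw [← (e i).map_eq, integral_map (e i).measurable.aemeasurable (by fun_prop)]
    rw [h1, hv i]
  have hind : iIndepFun Y P := iIndepFun_pi (X := fun i x => x - m i) fun i => by fun_prop
  have hS2 : MemLp (fun y => ∑ i, a i * Y i y) 2 P :=
    memLp_finsetSum _ fun i _ => (hY2 i).const_mul (a i)
  have hSint : Integrable (fun y => ∑ i, a i * Y i y) P := hS2.integrable (by norm_num)
  have hSmean : ∫ y, ∑ i, a i * Y i y ∂P = 0 := by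
    rw [integral_finsetSum _ fun i _ => ((hY2 i).integrable (by norm_num)).const_mul (a i)]
    exact Finset.sum_eq_zero fun i _ => by rw [integral_const_mul, hmean, mul_zero]
  have hSsq : ∫ y, (∑ i, a i * Y i y) ^ 2 ∂P = v * ∑ i, a i ^ 2 := by
    rw [integral_sum_mul_sq (fun i _ => hY2 i) (v := fun _ => v)
      fun i _ j _ => integral_mul_eq_ite_of_iIndepFun hind hYm hmean hvar i j, ← Finset.sum_mul,
      mul_comm]
  have hsq : Integrable (fun y => (c + ∑ i, a i * Y i y) ^ 2) P :=
    ((memLp_const c).add hS2).integrable_sq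
  change ∫⁻ y, ENNReal.ofReal ((c + ∑ i, a i * Y i y) ^ 2) ∂P = _
  rw [← ofReal_integral_eq_lintegral_ofReal hsq (ae_of_all _ fun _ => sq_nonneg _)]
  congr 1
  have h1 : ∀ y, (c + ∑ i, a i * Y i y) ^ 2 =
      (c ^ 2 + 2 * c * ∑ i, a i * Y i y) + (∑ i, a i * Y i y) ^ 2 := fun y => by ring
  simp_rw [h1]
  rw [integral_add (f := fun y => c ^ 2 + 2 * c * ∑ i, a i * Y i y)
    ((integrable_const _).add (hSint.const_mul _)) hS2.integrable_sq,
    integral_add (integrable_const _) (hSint.const_mul _), integral_const_mul, hSmean, hSsq]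
  simp

/-! ## The min-norm interpolator -/

section Ridge

variable {H : Type*} [NormedAddCommGroup H] [InnerProductSpace ℝ H] {n : ℕ}

theorem ridge_eq_sum (lam : ℝ) (X : Fin n → H) (y : Fin n → ℝ) :
    ridge lam X y = ∑ i, y i • ridge lam X (Pi.single i 1) := by
  unfold ridge
  set B := symPinv (Matrix.gram ℝ X + ((n : ℝ) * lam) • (1 : Matrix (Fin n) (Fin n) ℝ))
  simp_rw [Finset.smul_sum, smul_smul]
  rw [Finset.sum_comm]
  refine Finset.sum_congr rfl fun l _ => ?_
  rw [← Finset.sum_smul]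
  congr 1
  simp [Matrix.mulVec, dotProduct, mul_comm, Pi.single_apply]

/-- For inputs with a lower frame bound, the ridgeless estimator interpolates the labels. -/
theorem exists_ridge_eq {lo : ℝ} (hlo0 : 0 < lo) {X : Fin n → H}
    (hlo : ∀ a : Fin n → ℝ, lo * ∑ i, a i ^ 2 ≤ ‖∑ i, a i • X i‖ ^ 2) (y : Fin n → ℝ) :
    ∃ g : Fin n → ℝ, ridge 0 X y = ∑ l, g l • X l ∧ ∀ i, ⟪X i, ∑ l, g l • X l⟫ = y i := by
  set A : Matrix (Fin n) (Fin n) ℝ := Matrix.gram ℝ X with hA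
  have hmul : ∀ (a : Fin n → ℝ) i, (A *ᵥ a) i = ⟪X i, ∑ l, a l • X l⟫ := by
    intro a i
    rw [inner_sum]
    simp only [Matrix.mulVec, dotProduct, hA, Matrix.gram_apply, real_inner_smul_right]
    exact Finset.sum_congr rfl fun l _ => mul_comm _ _
  have hherm : A.IsHermitian := by
    ext i j
    simp [hA, Matrix.gram_apply, real_inner_comm]
  have hP := symPinv_isMoorePenrose hherm
  obtain ⟨a, ha⟩ := exists_inner_sum_smul_eq hlo0 hlo y
  have hAa : A *ᵥ a = y := by
    ext i
    rw [hmul, ha]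
  refine ⟨symPinv A *ᵥ y, ?_, fun i => ?_⟩
  · simp [ridge, hA]
  -- The label vector is in the range of the Gram matrix, so A A† A = A already gives interpolation.
  · rw [← hmul, ← hAa, Matrix.mulVec_mulVec, Matrix.mulVec_mulVec, hP.mul_mul_left]

theorem measurable_ridge_inner (X : Fin n → H) (v u : H) :
    Measurable fun y => ENNReal.ofReal (⟪v, ridge 0 X y - u⟫ ^ 2) := by
  have h1 : (fun y => ENNReal.ofReal (⟪v, ridge 0 X y - u⟫ ^ 2)) = fun y => ENNReal.ofReal
      ((∑ i, y i * ⟪v, ridge 0 X (Pi.single i 1)⟫ - ⟪v, u⟫) ^ 2) := by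
    ext y
    rw [inner_sub_right, ridge_eq_sum 0 X y, inner_sum]
    simp_rw [real_inner_smul_right]
  rw [h1]
  fun_prop

/-- The perturbation has length α along w, with the sign of the residual ⟪x, w⟫ - c, so that it can
only enlarge the error. -/
theorem le_iSup_shifted_sq {α : ℝ} (hα : 0 ≤ α) (w : H) (x : H) (c : ℝ) :
    ENNReal.ofReal (α ^ 2 * ‖w‖ ^ 2) ≤
      ⨆ (δ : H) (_ : ‖δ‖ ≤ α), ENNReal.ofReal ((⟪x + δ, w⟫ - c) ^ 2) := by
  rcases eq_or_ne w 0 with rfl | hw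
  · simp
  have hw' : 0 < ‖w‖ := norm_pos_iff.2 hw
  have key : ∃ δ : H, ‖δ‖ ≤ α ∧ α ^ 2 * ‖w‖ ^ 2 ≤ (⟪x + δ, w⟫ - c) ^ 2 := by
    have hn : ‖(α / ‖w‖) • w‖ ≤ α := by
      rw [norm_smul, Real.norm_eq_abs, abs_of_nonneg (by positivity)]
      exact (div_mul_cancel₀ _ hw'.ne').le
    have hi : ⟪(α / ‖w‖) • w, w⟫ = α * ‖w‖ := by
      rw [real_inner_smul_left, real_inner_self_eq_norm_sq]
      field_simp
    have hαw : 0 ≤ α * ‖w‖ := by positivity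
    rcases le_total 0 (⟪x, w⟫ - c) with h | h
    · refine ⟨(α / ‖w‖) • w, hn, ?_⟩
      rw [inner_add_left, hi]
      nlinarith
    · refine ⟨-((α / ‖w‖) • w), by rwa [norm_neg], ?_⟩
      rw [inner_add_left, inner_neg_left, hi]
      nlinarith
  obtain ⟨δ, hδ, hle⟩ := key
  exact (ENNReal.ofReal_le_ofReal hle).trans
    (le_iSup₂ (f := fun (δ : H) (_ : ‖δ‖ ≤ α) => ENNReal.ofReal ((⟪x + δ, w⟫ - c) ^ 2)) δ hδ)

end Ridge

namespace LinearModel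

variable {H : Type*} [NormedAddCommGroup H] [InnerProductSpace ℝ H] [MeasurableSpace H]
  [BorelSpace H] {σx : ℝ≥0} (M : LinearModel H σx)

theorem sum_smul_tl (k : ℕ) {n : ℕ} (g : Fin n → ℝ) (X : Fin n → H) :
    ∑ l, g l • M.tl k (X l) = M.tl k (∑ l, g l • X l) := by
  simp only [map_sum, map_smul]

/-- The interpolation equations, split into head and tail. -/
theorem split_inner {k n : ℕ} {X : Fin n → H} {w θ : H} {i : Fin n} {y : ℝ}
    (h : ⟪X i, w⟫ = ⟪X i, θ⟫ + y) :
    ⟪M.tl k (X i), M.tl k w⟫ +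
      ∑ j ∈ Finset.range k, (√(M.eig j) * ⟪M.vec j, w - θ⟫) * M.white j (X i) =
      ⟪M.tl k (X i), θ⟫ + y := by
  rw [inner_tl_tl, inner_tl_left, inner_tl_left, h]
  have h1 : ∀ j, (√(M.eig j) * ⟪M.vec j, w - θ⟫) * M.white j (X i) =
      ⟪M.vec j, X i⟫ * ⟪M.vec j, w⟫ - ⟪M.vec j, X i⟫ * ⟪M.vec j, θ⟫ := fun j => by
    rw [inner_sub_right, M.inner_vec_eq j (X i)]
    ring
  simp_rw [h1]
  rw [Finset.sum_sub_distrib]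
  ring

/-- An interpolator in the span of the inputs has head coordinates determined by its dual
coefficients. The last term measures the head of the parameter and vanishes for pure noise. -/
theorem split_dual {n : ℕ} (X : Fin n → H) (g : Fin n → ℝ) (θ : H) {j : ℕ} (hj : 0 < M.eig j) :
    ∑ i, g i * M.white j (X i) =
      (√(M.eig j) * ⟪M.vec j, ∑ l, g l • X l - θ⟫) / M.eig j + ⟪M.vec j, θ⟫ / √(M.eig j) := by
  have hs := Real.sqrt_pos.2 hj
  have h1 : √(M.eig j) * ∑ i, g i * M.white j (X i) = ⟪M.vec j, ∑ l, g l • X l⟫ := by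
    rw [inner_sum, Finset.mul_sum]
    refine Finset.sum_congr rfl fun i _ => ?_
    rw [real_inner_smul_right, M.inner_vec_eq]
    ring
  rw [inner_sub_right, ← h1]
  have h2 : M.eig j = √(M.eig j) ^ 2 := (Real.sq_sqrt hj.le).symm
  rw [h2, Real.sqrt_sq hs.le]
  field_simp
  ring

theorem frame_lower_of_tailBounds {k n : ℕ} {lo hi : ℝ} {X : Fin n → H}
    (hX : M.TailBounds k lo hi X) (a : Fin n → ℝ) :
    lo * ∑ i, a i ^ 2 ≤ ‖∑ i, a i • X i‖ ^ 2 := by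
  refine (hX a).1.trans ?_
  rw [sum_smul_tl]
  exact M.norm_tl_le k _

/-! ## Deterministic bounds on the good event -/

/-- Noiseless labels: the head unknown is the error w - θ scaled by √(eig j), so the head of the
parameter enters only through `split_dual` and the source in the tail system is the tail response.
-/
theorem bias_bounds {k n : ℕ} {lo hi ν N : ℝ} {X : Fin n → H} (hlo0 : 0 < lo) (hν : 0 < ν)
    (hlohi : lo ≤ hi) (hT : M.TailBounds k lo hi X) (hHd : M.HeadBounds k ν N X)
    (heig : ∀ j < k, 0 < M.eig j) (θ : H) :
    ‖M.tl k (ridge 0 X fun i => ⟪X i, θ⟫)‖ ^ 2 ≤ 5 * ((∑ i, ⟪M.tl k (X i), θ⟫ ^ 2) / lo +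
      hi / ν * ∑ j ∈ Finset.range k, ⟪M.vec j, θ⟫ ^ 2 / M.eig j) ∧
    ∑ j ∈ Finset.range k, M.eig j * ⟪M.vec j, (ridge 0 X fun i => ⟪X i, θ⟫) - θ⟫ ^ 2 ≤
      2 / ν * (∑ i, ⟪M.tl k (X i), θ⟫ ^ 2 +
        hi * ‖M.tl k (ridge 0 X fun i => ⟪X i, θ⟫)‖ ^ 2) := by
  obtain ⟨g, hg, hsol⟩ := exists_ridge_eq hlo0 (M.frame_lower_of_tailBounds hT) fun i => ⟪X i, θ⟫
  have h := tail_norm_sq_le (T := fun i => M.tl k (X i)) (κ := Finset.range k) (lam := M.eig)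
    (z := fun i j => M.white j (X i)) hlo0 hν hlohi (fun a => (hT a).1) (fun a => (hT a).2)
    (fun γ => (hHd γ).1) (fun j hj => heig j (Finset.mem_range.1 hj)) (g := g)
    (s := fun i => ⟪M.tl k (X i), θ⟫)
    (γ := fun j => √(M.eig j) * ⟪M.vec j, ∑ l, g l • X l - θ⟫)
    (d := fun j => ⟪M.vec j, θ⟫ / √(M.eig j))
    (fun i => by
      rw [sum_smul_tl]
      have := M.split_inner (k := k) (w := ∑ l, g l • X l) (θ := θ) (i := i) (y := 0)
        (by rw [hsol i, add_zero])
      rwa [add_zero] at this)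
    (fun j hj => M.split_dual X g θ (heig j (Finset.mem_range.1 hj)))
  simp_rw [sum_smul_tl, mul_pow, div_pow, Real.sq_sqrt (M.eig_nonneg _)] at h
  rw [hg]
  exact h

/-- Unit label vectors with θ = 0. The coordinatewise estimate uses the Gram matrix of the full
inputs, which inherits the lower bound of the tail. -/
theorem noise_bounds {k n : ℕ} {lo hi ν N : ℝ} {X : Fin n → H} (hlo0 : 0 < lo) (hν : 0 < ν)
    (hN : 0 ≤ N) (hlohi : lo ≤ hi) (hT : M.TailBounds k lo hi X) (hHd : M.HeadBounds k ν N X)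
    (heig : ∀ j < k, 0 < M.eig j) :
    ∑ i : Fin n, ∑ j ∈ Finset.range k, M.eig j * ⟪M.vec j, ridge 0 X (Pi.single i 1)⟫ ^ 2 ≤
      (hi / ν) ^ 2 * (k * N / lo ^ 2) ∧
    (∀ j, ∑ i : Fin n, M.eig j * ⟪M.vec j, ridge 0 X (Pi.single i 1)⟫ ^ 2 ≤
      M.eig j * (∑ i, ⟪M.vec j, X i⟫ ^ 2) / lo ^ 2) ∧
    (n / 2 - N * ((hi / ν) ^ 2 * (k * N / lo ^ 2))) / hi ≤
      ∑ i : Fin n, ‖ridge 0 X (Pi.single i 1)‖ ^ 2 := by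
  have hhi0 : 0 < hi := hlo0.trans_le hlohi
  have hlow := M.frame_lower_of_tailBounds hT
  choose g hg hsol using fun i : Fin n => exists_ridge_eq hlo0 hlow (Pi.single i 1)
  have hsol' : ∀ i l, ⟪X l, ∑ m, g i m • X m⟫ = if l = i then 1 else 0 := fun i l => by
    rw [hsol, Pi.single_apply]
  have heq : ∀ i l, ⟪M.tl k (X l), ∑ m, g i m • M.tl k (X m)⟫ +
      ∑ j ∈ Finset.range k, (√(M.eig j) * ⟪M.vec j, ∑ l, g i l • X l - 0⟫) * M.white j (X l) =
      if l = i then 1 else 0 := fun i l => by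
    rw [sum_smul_tl, M.split_inner (y := if l = i then 1 else 0)
      (by rw [hsol', inner_zero_right, zero_add]), inner_zero_right, zero_add]
  have h1 := sum_head_sq_le (T := fun i => M.tl k (X i)) (κ := Finset.range k) (lam := M.eig)
    (z := fun i j => M.white j (X i)) hlo0 hν hlohi (fun a => (hT a).1) (fun a => (hT a).2)
    (fun γ => (hHd γ).1) (fun γ => (hHd γ).2) (fun j hj => heig j (Finset.mem_range.1 hj)) (g := g)
    (γ := fun i j => √(M.eig j) * ⟪M.vec j, ∑ l, g i l • X l - 0⟫) heq
    (fun i j hj => by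
      rw [M.split_dual X (g i) 0 (heig j (Finset.mem_range.1 hj)), inner_zero_right, zero_div,
        add_zero])
  have h2 := le_sum_tail_norm_sq (T := fun i => M.tl k (X i)) (κ := Finset.range k)
    (z := fun i j => M.white j (X i)) hhi0 (fun a => (hT a).2) (fun γ => (hHd γ).2) (g := g)
    (γ := fun i j => √(M.eig j) * ⟪M.vec j, ∑ l, g i l • X l - 0⟫) heq
  rw [Finset.card_range] at h1
  refine ⟨?_, fun j => ?_, ?_⟩
  · simp_rw [sub_zero, mul_pow, Real.sq_sqrt (M.eig_nonneg _), ← hg] at h1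
    exact h1
  · have h3 := sum_sq_dot_le hlo0 hlow hsol' fun l => ⟪M.vec j, X l⟫
    rw [← Finset.mul_sum, mul_div_assoc]
    refine mul_le_mul_of_nonneg_left ?_ (M.eig_nonneg j)
    refine le_trans (le_of_eq ?_) h3
    refine Finset.sum_congr rfl fun i _ => ?_
    rw [hg, inner_sum]
    simp_rw [real_inner_smul_right]
  · rw [Fintype.card_fin] at h2
    refine le_trans ?_ (h2.trans (Finset.sum_le_sum fun i _ => ?_))
    · gcongr ?_ / _
      gcongr
    · rw [hg, sum_smul_tl]
      exact M.norm_tl_le k _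

/-! ## Risks for fixed inputs -/

/-- Random signs disappear after squaring. -/
theorem ae_prior_inner_sq : ∀ᵐ θ ∂M.prior, ∀ j, ⟪M.vec j, θ⟫ ^ 2 = M.coef j ^ 2 := by
  rw [ae_all_iff]
  intro j
  rcases lt_or_ge (j : ℕ∞) M.p with h | h
  · have hm : Measurable fun θ : H => ⟪M.basis ⟨j, h⟩, θ⟫ :=
      (continuous_const.inner continuous_id).measurable
    have h1 : ∀ᵐ r ∂(M.prior.map fun θ : H => ⟪M.basis ⟨j, h⟩, θ⟫), r ^ 2 = M.coef j ^ 2 := by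
      have hs : MeasurableSet {r : ℝ | ¬ r ^ 2 = M.coef j ^ 2} :=
        (measurableSet_eq_fun (measurable_id.pow_const 2) measurable_const).compl
      rw [ae_iff, M.prior_sign ⟨j, h⟩, Measure.add_apply, Measure.smul_apply, Measure.smul_apply,
        Measure.dirac_apply' _ hs, Measure.dirac_apply' _ hs]
      simp [M.coef_eq, M.vec_of_lt h]
    rw [M.vec_of_lt h]
    exact ae_of_ae_map hm.aemeasurable h1
  · simp [M.coef_eq, M.vec_of_le h]

/-- The labels of the inputs `X` have the moments prescribed by the model. -/
def LabelMoments {n : ℕ} (X : Fin n → H) (θ : H) : Prop :=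
  ∀ i, MemLp id 2 (M.labelLaw (X i, θ)) ∧ ∫ y, y ∂(M.labelLaw (X i, θ)) = ⟪X i, θ⟫ ∧
    ∫ y, (y - ⟪X i, θ⟫) ^ 2 ∂(M.labelLaw (X i, θ)) = M.noise ^ 2

theorem ae_labelMoments (n : ℕ) :
    ∀ᵐ X ∂(M.designLaw n), ∀ᵐ θ ∂M.prior, M.LabelMoments X θ := by
  have h := Measure.ae_ae_of_ae_prod (M.label_memLp.and (M.label_mean.and M.label_var))
  have h1 : ∀ᵐ X ∂(M.designLaw n), ∀ i : Fin n, ∀ᵐ θ ∂M.prior,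
      MemLp id 2 (M.labelLaw (X i, θ)) ∧ ∫ y, y ∂(M.labelLaw (X i, θ)) = ⟪X i, θ⟫ ∧
        ∫ y, (y - ⟪X i, θ⟫) ^ 2 ∂(M.labelLaw (X i, θ)) = M.noise ^ 2 := by
    rw [ae_all_iff]
    exact fun i => (M.measurePreserving_eval_design i).quasiMeasurePreserving.ae h
  filter_upwards [h1] with X hX
  unfold LabelMoments
  rw [ae_all_iff]
  exact hX

/-- The estimator is linear in the labels, so every functional of it splits into a squared bias and
a variance. -/
theorem lintegral_labels_inner_sq {n : ℕ} {X : Fin n → H} {θ : H} (h : M.LabelMoments X θ)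
    (v u : H) :
    ∫⁻ y, ENNReal.ofReal (⟪v, ridge 0 X y - u⟫ ^ 2) ∂(M.labelsLaw X θ) =
      ENNReal.ofReal (⟪v, (ridge 0 X fun i => ⟪X i, θ⟫) - u⟫ ^ 2 +
        M.noise ^ 2 * ∑ i, ⟪v, ridge 0 X (Pi.single i 1)⟫ ^ 2) := by
  rw [← lintegral_pi_affine_sq (ν := fun i => M.labelLaw (X i, θ)) (fun i => (h i).1)
    (fun i => (h i).2.1) (fun i => (h i).2.2)]
  unfold labelsLaw
  refine lintegral_congr fun y => ?_
  congr 2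
  rw [ridge_eq_sum 0 X y, ridge_eq_sum 0 X fun i => ⟪X i, θ⟫, inner_sub_right, inner_sub_right,
    inner_sum, inner_sum]
  simp_rw [real_inner_smul_right]
  have h1 : ∑ i, ⟪v, ridge 0 X (Pi.single i 1)⟫ * (y i - ⟪X i, θ⟫) =
      ∑ i, y i * ⟪v, ridge 0 X (Pi.single i 1)⟫ -
        ∑ i, ⟪X i, θ⟫ * ⟪v, ridge 0 X (Pi.single i 1)⟫ := by
    rw [← Finset.sum_sub_distrib]
    exact Finset.sum_congr rfl fun i _ => by ring
  rw [h1]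
  ring

/-- The standard risk is at most the sum of the bias and the variance. -/
theorem stdRisk_ridge_le {n : ℕ} {X : Fin n → H} (h : ∀ᵐ θ ∂M.prior, M.LabelMoments X θ) :
    M.stdRisk (ridge 0) X ≤
      ∫⁻ θ, ∑' j, ENNReal.ofReal (M.eig j *
        ⟪M.vec j, (ridge 0 X fun i => ⟪X i, θ⟫) - θ⟫ ^ 2) ∂M.prior +
      ENNReal.ofReal (M.noise ^ 2) * ∑' j, ENNReal.ofReal
        (∑ i, M.eig j * ⟪M.vec j, ridge 0 X (Pi.single i 1)⟫ ^ 2) := by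
  unfold stdRisk
  rw [← ENNReal.tsum_mul_left]
  have hle : ∀ᵐ θ ∂M.prior, ∫⁻ y, ∫⁻ x, ENNReal.ofReal ((⟪x, ridge 0 X y⟫ - ⟪x, θ⟫) ^ 2)
      ∂M.inputLaw ∂(M.labelsLaw X θ) ≤
      ∑' j, ENNReal.ofReal (M.eig j * ⟪M.vec j, (ridge 0 X fun i => ⟪X i, θ⟫) - θ⟫ ^ 2) +
      ∑' j, ENNReal.ofReal (M.noise ^ 2) * ENNReal.ofReal
        (∑ i, M.eig j * ⟪M.vec j, ridge 0 X (Pi.single i 1)⟫ ^ 2) := by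
    filter_upwards [h] with θ hθ
    calc _ ≤ ∫⁻ y, ∑' j, ENNReal.ofReal (M.eig j * ⟪M.vec j, ridge 0 X y - θ⟫ ^ 2)
          ∂(M.labelsLaw X θ) := by
          refine lintegral_mono fun y => ?_
          simp_rw [← inner_sub_right]
          exact M.lintegral_inner_sq_le _
      _ = ∑' j, ENNReal.ofReal (M.eig j) * ∫⁻ y,
            ENNReal.ofReal (⟪M.vec j, ridge 0 X y - θ⟫ ^ 2) ∂(M.labelsLaw X θ) := by
          simp_rw [ENNReal.ofReal_mul (M.eig_nonneg _)]
          rw [lintegral_tsum fun j =>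
            ((measurable_ridge_inner X _ _).const_mul _).aemeasurable]
          simp_rw [lintegral_const_mul _ (measurable_ridge_inner X _ _)]
      _ = _ := by
          rw [← ENNReal.tsum_add]
          refine tsum_congr fun j => ?_
          have hj := M.eig_nonneg j
          rw [M.lintegral_labels_inner_sq hθ, ← ENNReal.ofReal_mul hj,
            ← ENNReal.ofReal_mul (sq_nonneg _), ← ENNReal.ofReal_add (by positivity)
            (mul_nonneg (sq_nonneg _) (Finset.sum_nonneg fun i _ => by positivity))]
          congr 1
          rw [← Finset.mul_sum]
          ring
  refine (lintegral_mono_ae hle).trans (le_of_eq ?_)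
  rw [lintegral_add_right _ measurable_const, lintegral_const, measure_univ, mul_one]

theorem ofReal_norm_sq (x : H) :
    ENNReal.ofReal (‖x‖ ^ 2) = ∑' j, ENNReal.ofReal (⟪M.vec j, x⟫ ^ 2) := by
  have h := M.hasSum_sq_inner x
  rw [← h.tsum_eq, ENNReal.ofReal_tsum_of_nonneg (fun _ => sq_nonneg _) h.summable]

/-- The adversarial risk is at least the squared budget times the variance of the estimator. -/
theorem le_advRisk_ridge {n : ℕ} {X : Fin n → H} (h : ∀ᵐ θ ∂M.prior, M.LabelMoments X θ)
    {α : ℝ} (hα : 0 ≤ α) :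
    ENNReal.ofReal (α ^ 2 * (M.noise ^ 2 * ∑ i, ‖ridge 0 X (Pi.single i 1)‖ ^ 2)) ≤
      M.advRisk α (ridge 0) X := by
  unfold advRisk
  have hle : ∀ᵐ θ ∂M.prior,
      ENNReal.ofReal (α ^ 2 * (M.noise ^ 2 * ∑ i, ‖ridge 0 X (Pi.single i 1)‖ ^ 2)) ≤
      ∫⁻ y, ∫⁻ x, ⨆ (δ : H) (_ : ‖δ‖ ≤ α),
        ENNReal.ofReal ((⟪x + δ, ridge 0 X y⟫ - ⟪x, θ⟫) ^ 2)
        ∂M.inputLaw ∂(M.labelsLaw X θ) := by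
    filter_upwards [h] with θ hθ
    have h1 : ENNReal.ofReal (M.noise ^ 2 * ∑ i, ‖ridge 0 X (Pi.single i 1)‖ ^ 2) ≤
        ∫⁻ y, ENNReal.ofReal (‖ridge 0 X y‖ ^ 2) ∂(M.labelsLaw X θ) := by
      have h2 : ∀ y, ENNReal.ofReal (‖ridge 0 X y‖ ^ 2) =
          ∑' j, ENNReal.ofReal (⟪M.vec j, ridge 0 X y - 0⟫ ^ 2) := fun y => by
        rw [sub_zero, M.ofReal_norm_sq]
      simp_rw [h2]
      rw [lintegral_tsum fun j => (measurable_ridge_inner X _ _).aemeasurable]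
      simp_rw [M.lintegral_labels_inner_sq hθ]
      rw [ENNReal.ofReal_mul (sq_nonneg _), ENNReal.ofReal_sum_of_nonneg fun _ _ => sq_nonneg _]
      simp_rw [M.ofReal_norm_sq]
      rw [← Summable.tsum_finsetSum fun _ _ => ENNReal.summable, ← ENNReal.tsum_mul_left]
      refine ENNReal.tsum_le_tsum fun j => ?_
      rw [← ENNReal.ofReal_sum_of_nonneg fun _ _ => sq_nonneg _,
        ← ENNReal.ofReal_mul (sq_nonneg _)]
      -- The squared mean of the estimator is discarded; the noise alone forces a large norm.
      exact ENNReal.ofReal_le_ofReal (le_add_of_nonneg_left (sq_nonneg _))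
    calc _ = ENNReal.ofReal (α ^ 2) *
          ENNReal.ofReal (M.noise ^ 2 * ∑ i, ‖ridge 0 X (Pi.single i 1)‖ ^ 2) :=
          ENNReal.ofReal_mul (sq_nonneg _)
      _ ≤ ENNReal.ofReal (α ^ 2) *
          ∫⁻ y, ENNReal.ofReal (‖ridge 0 X y‖ ^ 2) ∂(M.labelsLaw X θ) := by gcongr
      -- This inequality holds for arbitrary integrands, so measurability of the norm of the
      -- estimator is not needed.
      _ ≤ ∫⁻ y, ENNReal.ofReal (α ^ 2) * ENNReal.ofReal (‖ridge 0 X y‖ ^ 2)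
          ∂(M.labelsLaw X θ) := lintegral_const_mul_le _ _
      _ ≤ _ := by
          refine lintegral_mono fun y => ?_
          rw [← ENNReal.ofReal_mul (sq_nonneg _)]
          calc _ = ∫⁻ _, ENNReal.ofReal (α ^ 2 * ‖ridge 0 X y‖ ^ 2) ∂M.inputLaw := by simp
            _ ≤ _ := lintegral_mono fun x => le_iSup_shifted_sq hα _ _ _
  calc _ = ∫⁻ _, ENNReal.ofReal (α ^ 2 * (M.noise ^ 2 *
        ∑ i, ‖ridge 0 X (Pi.single i 1)‖ ^ 2)) ∂M.prior := by simp
    _ ≤ _ := lintegral_mono_ae hle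

/-! ## Signal and tail functionals -/

/-- The squared coordinates of the parameter in the head, weighted by inverse eigenvalues. -/
noncomputable def headSignal (k : ℕ) : ℝ := ∑ i ∈ Finset.range k, M.coef i ^ 2 / M.eig i

/-- The squared coordinates of the parameter in the tail, weighted by eigenvalues. -/
noncomputable def tailSignal (k : ℕ) : ℝ := ∑' i, M.eig (k + i) * M.coef (k + i) ^ 2

/-- The mean square of the tail part of the response of an input. -/
noncomputable def tailResponse (k : ℕ) (x : H) : ℝ≥0∞ :=
  ∫⁻ θ, ENNReal.ofReal (⟪M.tl k x, θ⟫ ^ 2) ∂M.prior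

/-- The squared norm of the tail of an input, weighted by eigenvalues. -/
noncomputable def weightedTail (k : ℕ) (x : H) : ℝ≥0∞ :=
  ∑' l, ENNReal.ofReal (M.eig (k + l) * ⟪M.vec (k + l), x⟫ ^ 2)

theorem headSignal_nonneg (k : ℕ) : 0 ≤ M.headSignal k :=
  Finset.sum_nonneg fun i _ => div_nonneg (sq_nonneg _) (M.eig_nonneg i)

theorem tailSignal_nonneg (k : ℕ) : 0 ≤ M.tailSignal k :=
  tsum_nonneg fun _ => mul_nonneg (M.eig_nonneg _) (sq_nonneg _)

theorem summable_tailSignal (k : ℕ) : Summable fun i => M.eig (k + i) * M.coef (k + i) ^ 2 := by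
  have h1 : Summable fun i => M.coef (k + i) ^ 2 := by
    have := (M.hasSum_sq_inner M.truth).summable
    simp_rw [← M.coef_eq] at this
    simpa only [add_comm] using (summable_nat_add_iff k).2 this
  exact Summable.of_nonneg_of_le (fun i => mul_nonneg (M.eig_nonneg _) (sq_nonneg _))
    (fun i => mul_le_mul_of_nonneg_right (M.eig_antitone (Nat.zero_le _)) (sq_nonneg _))
    (h1.mul_left (M.eig 0))

theorem ofReal_tailSignal (k : ℕ) : ENNReal.ofReal (M.tailSignal k) =
    ∑' i, ENNReal.ofReal (M.eig (k + i) * M.coef (k + i) ^ 2) :=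
  ENNReal.ofReal_tsum_of_nonneg (fun _ => mul_nonneg (M.eig_nonneg _) (sq_nonneg _))
    (M.summable_tailSignal k)

theorem tsum_eq_range_add_tsum (f : ℕ → ℝ≥0∞) (k : ℕ) :
    ∑' j, f j = ∑ j ∈ Finset.range k, f j + ∑' i, f (k + i) := by
  simp_rw [add_comm k]
  exact (Summable.sum_add_tsum_nat_add' (f := f) (k := k) ENNReal.summable).symm

theorem measurable_tl_inner (k : ℕ) :
    Measurable fun q : H × H => ENNReal.ofReal (⟪M.tl k q.1, q.2⟫ ^ 2) := by
  have := M.secondCountable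
  exact ((((M.continuous_tl k).measurable.comp measurable_fst).inner
    measurable_snd).pow_const 2).ennreal_ofReal

theorem measurable_tailResponse (k : ℕ) : Measurable (M.tailResponse k) :=
  (M.measurable_tl_inner k).lintegral_prod_right'

theorem measurable_weightedTail (k : ℕ) : Measurable (M.weightedTail k) :=
  Measurable.tsum fun l =>
    (((M.measurable_inner_vec (k + l)).pow_const 2).const_mul _).ennreal_ofReal

/-- After exchanging the averages the projection is moved from the input to θ. The second moment in
x then involves only squared coordinates of θ, which are fixed almost surely. -/
theorem lintegral_tailResponse_le (k : ℕ) :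
    ∫⁻ x, M.tailResponse k x ∂M.inputLaw ≤ ENNReal.ofReal (M.tailSignal k) := by
  unfold tailResponse
  rw [lintegral_lintegral_swap (M.measurable_tl_inner k).aemeasurable]
  calc _ ≤ ∫⁻ _, ENNReal.ofReal (M.tailSignal k) ∂M.prior := by
        refine lintegral_mono_ae ?_
        filter_upwards [M.ae_prior_inner_sq] with θ hθ
        have h1 : ∀ x, ⟪M.tl k x, θ⟫ = ⟪x, M.tl k θ⟫ := fun x => by
          rw [← inner_tl_tl, real_inner_comm, inner_tl_tl, real_inner_comm]
        simp_rw [h1]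
        refine (M.lintegral_inner_sq_le _).trans (le_of_eq ?_)
        rw [tsum_eq_range_add_tsum _ k, Finset.sum_eq_zero, zero_add, ofReal_tailSignal]
        · refine tsum_congr fun i => ?_
          rw [inner_vec_tl, if_neg (by omega), hθ]
        · intro j hj
          rw [inner_vec_tl, if_pos (Finset.mem_range.1 hj)]
          simp
    _ = _ := by simp

theorem lintegral_weightedTail (k : ℕ) :
    ∫⁻ x, M.weightedTail k x ∂M.inputLaw = ENNReal.ofReal (∑' i, M.eig (k + i) ^ 2) := by
  unfold weightedTail
  rw [lintegral_tsum fun l =>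
    (((M.measurable_inner_vec (k + l)).pow_const 2).const_mul _).ennreal_ofReal.aemeasurable,
    ENNReal.ofReal_tsum_of_nonneg (fun _ => sq_nonneg _) (M.summable_eig_sq k)]
  refine tsum_congr fun l => ?_
  simp_rw [ENNReal.ofReal_mul (M.eig_nonneg _)]
  rw [lintegral_const_mul _ ((M.measurable_inner_vec _).pow_const 2).ennreal_ofReal,
    lintegral_inner_vec_sq, ← ENNReal.ofReal_mul (M.eig_nonneg _), sq]

/-! ## Risks on the good event -/

/-- The constant in the bias bound. -/
noncomputable def biasConst (b C : ℝ) : ℝ :=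
  16 * (1 + 80 * C) + 640 * C ^ 2 + 160 / b + 80 * C / b

theorem biasConst_pos {b C : ℝ} (hb : 0 < b) (hC : 0 < C) : 0 < biasConst b C := by
  unfold biasConst
  positivity

variable {M} {k n : ℕ} {b C₁ C₂ : ℝ} {X : Fin n → H}

/-- The first summand is kept as a function of the inputs, to be averaged later: on average the sum
of the n squared tail responses is at most n times the tail signal, which the factor 1/n
compensates. -/
theorem bias_risk_le (hn : 0 < n) (hk : 0 < M.eig k) (hb : 0 < b) (hbk : b * n ≤ M.rankr k)
    (hC₂ : 1 ≤ C₂) (hT : M.TailBounds k (M.tail k / 16) (C₂ * M.tail k) X)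
    (hHd : M.HeadBounds k (n / 8) (C₁ * n) X) {θ : H} (hθ : ∀ j, ⟪M.vec j, θ⟫ ^ 2 = M.coef j ^ 2) :
    ∑' j, ENNReal.ofReal (M.eig j * ⟪M.vec j, (ridge 0 X fun i => ⟪X i, θ⟫) - θ⟫ ^ 2) ≤
      ENNReal.ofReal (biasConst b C₂ / n) * ∑ i, ENNReal.ofReal (⟪M.tl k (X i), θ⟫ ^ 2) +
      ENNReal.ofReal (biasConst b C₂ * ((M.tail k / n) ^ 2 * M.headSignal k) +
        2 * M.tailSignal k) := by
  have hn' : (0 : ℝ) < n := by exact_mod_cast hn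
  have ht : 0 < M.tail k := hk.trans_le (M.eig_le_tail k)
  have heig : ∀ j < k, 0 < M.eig j := fun j hj => hk.trans_le (M.eig_antitone hj.le)
  -- The defining property of the critical index. It makes the eigenvalue-weighted tail of the
  -- interpolator as small as its head error.
  have hlam : M.eig k ≤ M.tail k / (b * n) := by
    rw [rankr, le_div_iff₀ hk] at hbk
    rw [le_div_iff₀ (by positivity)]
    linarith
  obtain ⟨h1, h2⟩ := M.bias_bounds (by positivity) (by positivity) (by nlinarith) hT hHd heig θ
  simp_rw [hθ] at h1
  change _ ≤ 5 * (_ + _ * M.headSignal k) at h1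
  set w := ridge 0 X fun i => ⟪X i, θ⟫ with hw
  set t := M.tail k
  set S := ∑ i, ⟪M.tl k (X i), θ⟫ ^ 2 with hS
  set D := M.headSignal k
  have hS0 : 0 ≤ S := Finset.sum_nonneg fun _ _ => sq_nonneg _
  have hD0 : 0 ≤ D := M.headSignal_nonneg k
  have hW : ‖M.tl k w‖ ^ 2 ≤ 80 * S / t + 40 * C₂ * t * D / n := by
    refine h1.trans (le_of_eq ?_)
    field_simp
    ring
  have hhead : ∑ j ∈ Finset.range k, M.eig j * ⟪M.vec j, w - θ⟫ ^ 2 ≤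
      (16 * (1 + 80 * C₂)) * (S / n) + 640 * C₂ ^ 2 * ((t / n) ^ 2 * D) := by
    calc _ ≤ 2 / (n / 8) * (S + C₂ * t * ‖M.tl k w‖ ^ 2) := h2
      _ ≤ 2 / (n / 8) * (S + C₂ * t * (80 * S / t + 40 * C₂ * t * D / n)) := by gcongr
      _ = _ := by field_simp; ring
  have htail : 2 * M.eig k * ‖M.tl k w‖ ^ 2 ≤
      160 / b * (S / n) + 80 * C₂ / b * ((t / n) ^ 2 * D) := by
    calc _ ≤ 2 * (t / (b * n)) * (80 * S / t + 40 * C₂ * t * D / n) := by gcongr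
      _ = _ := by field_simp; ring
  have hsum : ENNReal.ofReal (∑ j ∈ Finset.range k, M.eig j * ⟪M.vec j, w - θ⟫ ^ 2) +
      ENNReal.ofReal (2 * M.eig k * ‖M.tl k w‖ ^ 2) ≤
      ENNReal.ofReal (biasConst b C₂ / n) * ∑ i, ENNReal.ofReal (⟪M.tl k (X i), θ⟫ ^ 2) +
      ENNReal.ofReal (biasConst b C₂ * ((t / n) ^ 2 * D)) := by
    have hK := biasConst_pos hb (zero_lt_one.trans_le hC₂)
    have hN : 0 ≤ 2 * M.eig k * ‖M.tl k w‖ ^ 2 :=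
      mul_nonneg (mul_nonneg zero_le_two hk.le) (sq_nonneg _)
    have hN' : 0 ≤ biasConst b C₂ * ((t / n) ^ 2 * D) :=
      mul_nonneg hK.le (mul_nonneg (sq_nonneg _) hD0)
    rw [← ENNReal.ofReal_sum_of_nonneg fun _ _ => sq_nonneg _, ← hS,
      ← ENNReal.ofReal_mul (by positivity), ← ENNReal.ofReal_add (Finset.sum_nonneg fun j _ =>
        mul_nonneg (M.eig_nonneg j) (sq_nonneg _)) hN,
      ← ENNReal.ofReal_add (mul_nonneg (div_nonneg hK.le hn'.le) hS0) hN']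
    apply ENNReal.ofReal_le_ofReal
    refine (add_le_add hhead htail).trans ?_
    have e1 : biasConst b C₂ / n * S = biasConst b C₂ * (S / n) := by ring
    rw [e1]
    have hA : 0 ≤ S / n := by positivity
    have hB : 0 ≤ (t / n) ^ 2 * D := by positivity
    have c1 : 16 * (1 + 80 * C₂) + 160 / b ≤ biasConst b C₂ := by
      have : 0 ≤ 640 * C₂ ^ 2 + 80 * C₂ / b := by positivity
      unfold biasConst; linarith
    have c2 : 640 * C₂ ^ 2 + 80 * C₂ / b ≤ biasConst b C₂ := by
      have : 0 ≤ 16 * (1 + 80 * C₂) + 160 / b := by positivity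
      unfold biasConst; linarith
    have d1 := mul_le_mul_of_nonneg_right c1 hA
    have d2 := mul_le_mul_of_nonneg_right c2 hB
    linarith
  rw [tsum_eq_range_add_tsum _ k, ENNReal.ofReal_add (by
    have := biasConst_pos hb (zero_lt_one.trans_le hC₂); positivity)
    (mul_nonneg zero_le_two (M.tailSignal_nonneg k)), ← add_assoc]
  rw [← ENNReal.ofReal_sum_of_nonneg fun j _ => mul_nonneg (M.eig_nonneg j) (sq_nonneg _)]
  -- In the tail, estimator and parameter are bounded separately; no cancellation is used.
  have hT2 : ∑' i, ENNReal.ofReal (M.eig (k + i) * ⟪M.vec (k + i), w - θ⟫ ^ 2) ≤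
      ENNReal.ofReal (2 * M.eig k * ‖M.tl k w‖ ^ 2) + ENNReal.ofReal (2 * M.tailSignal k) := by
    rw [ENNReal.ofReal_mul (p := 2 * M.eig k) (by positivity), ofReal_norm_tl_sq,
      ENNReal.ofReal_mul (p := 2) (q := M.tailSignal k) zero_le_two,
      ofReal_tailSignal, ← ENNReal.tsum_mul_left, ← ENNReal.tsum_mul_left, ← ENNReal.tsum_add]
    refine ENNReal.tsum_le_tsum fun i => ?_
    have h0 := M.eig_nonneg (k + i)
    rw [← ENNReal.ofReal_mul (by positivity), ← ENNReal.ofReal_mul zero_le_two,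
      ← ENNReal.ofReal_add (by positivity) (by positivity)]
    apply ENNReal.ofReal_le_ofReal
    rw [← hθ, inner_sub_right]
    have h3 : M.eig (k + i) ≤ M.eig k := M.eig_antitone (Nat.le_add_right _ _)
    have h4 : (⟪M.vec (k + i), w⟫ - ⟪M.vec (k + i), θ⟫) ^ 2 ≤
        2 * ⟪M.vec (k + i), w⟫ ^ 2 + 2 * ⟪M.vec (k + i), θ⟫ ^ 2 := by
      nlinarith [sq_nonneg (⟪M.vec (k + i), w⟫ + ⟪M.vec (k + i), θ⟫)]
    calc _ ≤ M.eig (k + i) * (2 * ⟪M.vec (k + i), w⟫ ^ 2 + 2 * ⟪M.vec (k + i), θ⟫ ^ 2) := by gcongr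
      _ = 2 * M.eig (k + i) * ⟪M.vec (k + i), w⟫ ^ 2 +
          2 * (M.eig (k + i) * ⟪M.vec (k + i), θ⟫ ^ 2) := by ring
      _ ≤ _ := by gcongr
  calc _ ≤ ENNReal.ofReal (∑ j ∈ Finset.range k, M.eig j * ⟪M.vec j, w - θ⟫ ^ 2) +
        (ENNReal.ofReal (2 * M.eig k * ‖M.tl k w‖ ^ 2) +
          ENNReal.ofReal (2 * M.tailSignal k)) := by gcongr
    _ ≤ _ := by
        rw [← add_assoc]
        gcongr

/-- One set of vectors seen in two norms: weighted by eigenvalues their total is small, while their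
plain squared norms add up to order n/t once k/n is small. -/
theorem variance_facts (hn : 0 < n) (hk : 0 < M.eig k) (hC₁ : 0 ≤ C₁)
    (hC₂ : 1 ≤ C₂) (hT : M.TailBounds k (M.tail k / 16) (C₂ * M.tail k) X)
    (hHd : M.HeadBounds k (n / 8) (C₁ * n) X) :
    ∑' j, ENNReal.ofReal (∑ i, M.eig j * ⟪M.vec j, ridge 0 X (Pi.single i 1)⟫ ^ 2) ≤
      ENNReal.ofReal (16384 * C₂ ^ 2 * C₁ * (k / n)) +
        ENNReal.ofReal (256 / M.tail k ^ 2) * ∑ i, M.weightedTail k (X i) ∧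
    (n / 2 - 16384 * C₂ ^ 2 * C₁ ^ 2 * k) / (C₂ * M.tail k) ≤
      ∑ i : Fin n, ‖ridge 0 X (Pi.single i 1)‖ ^ 2 := by
  have hn' : (0 : ℝ) < n := by exact_mod_cast hn
  have ht : 0 < M.tail k := hk.trans_le (M.eig_le_tail k)
  have heig : ∀ j < k, 0 < M.eig j := fun j hj => hk.trans_le (M.eig_antitone hj.le)
  obtain ⟨h1, h2, h3⟩ := M.noise_bounds (by positivity) (by positivity) (by positivity)
    (by nlinarith) hT hHd heig
  set t := M.tail k
  have e1 : (C₂ * t / (n / 8)) ^ 2 * (k * (C₁ * n) / (t / 16) ^ 2) =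
      16384 * C₂ ^ 2 * C₁ * (k / n) := by
    field_simp
    ring
  have e2 : C₁ * n * (16384 * C₂ ^ 2 * C₁ * (k / n)) = 16384 * C₂ ^ 2 * C₁ ^ 2 * k := by
    field_simp
  rw [e1] at h1
  rw [e1, e2] at h3
  refine ⟨?_, h3⟩
  have hnn : ∀ j, 0 ≤ ∑ i : Fin n, M.eig j * ⟪M.vec j, ridge 0 X (Pi.single i 1)⟫ ^ 2 := fun j =>
    Finset.sum_nonneg fun i _ => mul_nonneg (M.eig_nonneg j) (sq_nonneg _)
  rw [tsum_eq_range_add_tsum _ k]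
  refine add_le_add ?_ ?_
  · rw [← ENNReal.ofReal_sum_of_nonneg fun j _ => hnn j, Finset.sum_comm]
    exact ENNReal.ofReal_le_ofReal h1
  · unfold weightedTail
    rw [← Summable.tsum_finsetSum fun _ _ => ENNReal.summable, ← ENNReal.tsum_mul_left]
    refine ENNReal.tsum_le_tsum fun l => ?_
    rw [← ENNReal.ofReal_sum_of_nonneg fun i _ => mul_nonneg (M.eig_nonneg _) (sq_nonneg _),
      ← ENNReal.ofReal_mul (by positivity)]
    apply ENNReal.ofReal_le_ofReal
    refine (h2 (k + l)).trans (le_of_eq ?_)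
    rw [← Finset.mul_sum]
    field_simp
    ring

/-- On the good event the standard risk is bounded by an additive function of the inputs. -/
theorem stdRisk_le_on_good (hn : 0 < n) (hk : 0 < M.eig k) (hb : 0 < b)
    (hbk : b * n ≤ M.rankr k) (hC₁ : 0 ≤ C₁)
    (hC₂ : 1 ≤ C₂) (hT : M.TailBounds k (M.tail k / 16) (C₂ * M.tail k) X)
    (hHd : M.HeadBounds k (n / 8) (C₁ * n) X) (hlab : ∀ᵐ θ ∂M.prior, M.LabelMoments X θ) :
    M.stdRisk (ridge 0) X ≤
      (ENNReal.ofReal (biasConst b C₂ / n) * ∑ i, M.tailResponse k (X i) +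
        ENNReal.ofReal (biasConst b C₂ * ((M.tail k / n) ^ 2 * M.headSignal k) +
          2 * M.tailSignal k)) +
      ENNReal.ofReal (M.noise ^ 2) * (ENNReal.ofReal (16384 * C₂ ^ 2 * C₁ * (k / n)) +
        ENNReal.ofReal (256 / M.tail k ^ 2) * ∑ i, M.weightedTail k (X i)) := by
  have hmeas : ∀ i, Measurable fun θ : H => ENNReal.ofReal (⟪M.tl k (X i), θ⟫ ^ 2) := fun i =>
    ((continuous_const.inner continuous_id).pow 2).measurable.ennreal_ofReal
  refine (M.stdRisk_ridge_le hlab).trans (add_le_add ?_ ?_)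
  · calc _ ≤ ∫⁻ θ, (ENNReal.ofReal (biasConst b C₂ / n) *
            ∑ i, ENNReal.ofReal (⟪M.tl k (X i), θ⟫ ^ 2) +
          ENNReal.ofReal (biasConst b C₂ * ((M.tail k / n) ^ 2 * M.headSignal k) +
            2 * M.tailSignal k)) ∂M.prior := by
          refine lintegral_mono_ae ?_
          filter_upwards [M.ae_prior_inner_sq] with θ hθ
          exact bias_risk_le hn hk hb hbk hC₂ hT hHd hθ
      _ = _ := by
          rw [lintegral_add_right _ measurable_const, lintegral_const, measure_univ, mul_one,
            lintegral_const_mul _ (Finset.measurable_sum _ fun i _ => hmeas i),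
            lintegral_finsetSum _ fun i _ => hmeas i]
          rfl
  · gcongr
    exact (variance_facts hn hk hC₁ hC₂ hT hHd).1

/-- The complement of the good event. -/
def badEvent (M : LinearModel H σx) (k n : ℕ) (C₁ C₂ : ℝ) : Set (Fin n → H) :=
  {X | ¬ M.TailBounds k (M.tail k / 16) (C₂ * M.tail k) X} ∪
    ({X | ¬ M.HeadBounds k (n / 8) (C₁ * n) X} ∪
      {X | ¬ ∀ᵐ θ ∂M.prior, M.LabelMoments X θ})

/-- A tail bound for the standard risk. -/
theorem measure_stdRisk_ge_le (hn : 0 < n) (hk : 0 < M.eig k) (hb : 0 < b)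
    (hbk : b * n ≤ M.rankr k) (hC₁ : 0 ≤ C₁) (hC₂ : 1 ≤ C₂) {B : ℝ} (hB : M.noise ^ 2 ≤ B)
    {ε : ℝ≥0∞} (hε : ε ≠ 0) (hε' : ε ≠ ∞) :
    M.designLaw n {X | ε ≤ M.stdRisk (ridge 0) X} ≤ M.designLaw n (M.badEvent k n C₁ C₂) +
      ENNReal.ofReal (biasConst b C₂ * M.tailSignal k +
        (biasConst b C₂ * ((M.tail k / n) ^ 2 * M.headSignal k) + 2 * M.tailSignal k) +
        B * (16384 * C₂ ^ 2 * C₁ * (k / n) + 256 * (n / M.rankR k))) / ε := by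
  have hn' : (0 : ℝ) < n := by exact_mod_cast hn
  have ht : 0 < M.tail k := hk.trans_le (M.eig_le_tail k)
  have hK := biasConst_pos hb (zero_lt_one.trans_le hC₂)
  set U : (Fin n → H) → ℝ≥0∞ := fun X =>
    (ENNReal.ofReal (biasConst b C₂ / n) * ∑ i, M.tailResponse k (X i) +
        ENNReal.ofReal (biasConst b C₂ * ((M.tail k / n) ^ 2 * M.headSignal k) +
          2 * M.tailSignal k)) +
      ENNReal.ofReal (M.noise ^ 2) * (ENNReal.ofReal (16384 * C₂ ^ 2 * C₁ * (k / n)) +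
        ENNReal.ofReal (256 / M.tail k ^ 2) * ∑ i, M.weightedTail k (X i)) with hU
  have hm1 : Measurable fun X : Fin n → H => ∑ i, M.tailResponse k (X i) :=
    Finset.measurable_sum _ fun i _ => (M.measurable_tailResponse k).comp (measurable_pi_apply i)
  have hm2 : Measurable fun X : Fin n → H => ∑ i, M.weightedTail k (X i) :=
    Finset.measurable_sum _ fun i _ => (M.measurable_weightedTail k).comp (measurable_pi_apply i)
  have hUm : Measurable U := by fun_prop
  have hUint : ∫⁻ X, U X ∂(M.designLaw n) ≤ ENNReal.ofReal (biasConst b C₂ * M.tailSignal k +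
        (biasConst b C₂ * ((M.tail k / n) ^ 2 * M.headSignal k) + 2 * M.tailSignal k) +
        B * (16384 * C₂ ^ 2 * C₁ * (k / n) + 256 * (n / M.rankR k))) := by
    have hτ := M.tailSignal_nonneg k
    have hD := M.headSignal_nonneg k
    have hR : 0 ≤ M.rankR k := div_nonneg (sq_nonneg _) (tsum_nonneg fun _ => sq_nonneg _)
    have hB0 : 0 ≤ B := (sq_nonneg _).trans hB
    rw [hU, lintegral_add_left (by fun_prop), lintegral_add_right _ measurable_const,
      lintegral_const, measure_univ, mul_one, lintegral_const_mul _ hm1,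
      lintegral_const_mul _ (by fun_prop), lintegral_add_left measurable_const, lintegral_const,
      measure_univ, mul_one, lintegral_const_mul _ hm2,
      M.lintegral_design_sum (M.measurable_tailResponse k),
      M.lintegral_design_sum (M.measurable_weightedTail k), lintegral_weightedTail,
      ENNReal.ofReal_add (q := B * (16384 * C₂ ^ 2 * C₁ * (k / n) + 256 * (n / M.rankR k)))
        (by positivity) (by positivity),
      ENNReal.ofReal_add (p := biasConst b C₂ * M.tailSignal k) (by positivity) (by positivity),
      ENNReal.ofReal_mul hB0,
      ENNReal.ofReal_add (p := 16384 * C₂ ^ 2 * C₁ * (k / n)) (by positivity) (by positivity)]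
    gcongr ?_ + _ + ?_ * (_ + ?_)
    · calc _ ≤ ENNReal.ofReal (biasConst b C₂ / n) *
            (ENNReal.ofReal n * ENNReal.ofReal (M.tailSignal k)) := by
            rw [ENNReal.ofReal_natCast]
            gcongr
            exact M.lintegral_tailResponse_le k
        _ = _ := by
            rw [← ENNReal.ofReal_mul (by positivity), ← ENNReal.ofReal_mul (by positivity)]
            congr 1
            field_simp
    · exact ENNReal.ofReal_le_ofReal hB
    · rw [← ENNReal.ofReal_natCast, ← ENNReal.ofReal_mul (by positivity),
        ← ENNReal.ofReal_mul (by positivity)]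
      apply ENNReal.ofReal_le_ofReal
      rw [rankR, div_div_eq_mul_div]
      apply le_of_eq
      ring
  -- Outside the bad event the risk is dominated by the measurable function U, to which Markov's
  -- inequality applies; the risk itself need not be measurable.
  refine (measure_mono (t := M.badEvent k n C₁ C₂ ∪ {X | ε ≤ U X}) fun X hX => ?_).trans
    ((measure_union_le _ _).trans (add_le_add le_rfl
      ((meas_ge_le_lintegral_div hUm.aemeasurable hε hε').trans
        (ENNReal.div_le_div_right hUint ε))))
  by_contra hcon
  rw [Set.mem_union, not_or] at hcon
  obtain ⟨h1, h2⟩ := hcon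
  simp only [badEvent, Set.mem_union, Set.mem_ofPred_eq, not_or, not_not] at h1
  exact h2 (hX.trans (stdRisk_le_on_good hn hk hb hbk hC₁ hC₂ h1.1 h1.2.1 h1.2.2))

/-- On the good event the adversarial risk is large. -/
theorem le_advRisk_on_good (hn : 0 < n) (hk : 0 < M.eig k) (hC₁ : 0 ≤ C₁) (hC₂ : 1 ≤ C₂)
    (hsmall : 16384 * C₂ ^ 2 * C₁ ^ 2 * k ≤ n / 4) {α : ℝ} (hα : 0 < α)
    (hX : X ∉ M.badEvent k n C₁ C₂) :
    ENNReal.ofReal (M.noise ^ 2 / (M.tail k / n) / (4 * C₂)) ≤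
      M.advRisk α (ridge 0) X / ENNReal.ofReal (α ^ 2) := by
  have hn' : (0 : ℝ) < n := by exact_mod_cast hn
  have ht : 0 < M.tail k := hk.trans_le (M.eig_le_tail k)
  simp only [badEvent, Set.mem_union, Set.mem_ofPred_eq, not_or, not_not] at hX
  have h1 := (variance_facts hn hk hC₁ hC₂ hX.1 hX.2.1).2
  have h2 : M.noise ^ 2 / (M.tail k / n) / (4 * C₂) ≤
      M.noise ^ 2 * ∑ i : Fin n, ‖ridge 0 X (Pi.single i 1)‖ ^ 2 := by
    calc _ = M.noise ^ 2 * ((n / 4) / (C₂ * M.tail k)) := by field_simp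
      _ ≤ M.noise ^ 2 * ((n / 2 - 16384 * C₂ ^ 2 * C₁ ^ 2 * k) / (C₂ * M.tail k)) := by
          gcongr
          linarith
      _ ≤ _ := by gcongr
  rw [ENNReal.le_div_iff_mul_le (Or.inl (ENNReal.ofReal_pos.2 (pow_pos hα 2)).ne')
    (Or.inl ENNReal.ofReal_ne_top), ← ENNReal.ofReal_mul' (sq_nonneg _)]
  refine le_trans (ENNReal.ofReal_le_ofReal ?_) (M.le_advRisk_ridge hX.2.2 hα.le)
  rw [mul_comm]
  gcongr

end LinearModel

/-! ## Asymptotics -/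

/-- An exponential decay at rate `v` beats an exponential growth at a smaller rate `u`. -/
theorem tendsto_pow_mul_exp_neg {ι : Type*} {l : Filter ι} {u : ι → ℕ} {v : ι → ℝ} {K c : ℝ}
    (hK : 1 ≤ K) (hc : 0 < c) (huv : Tendsto (fun i => (u i : ℝ) / v i) l (𝓝 0))
    (hv : Tendsto v l atTop) :
    Tendsto (fun i => K ^ u i * Real.exp (-(c * v i))) l (𝓝 0) := by
  have hlog : 0 ≤ Real.log K := Real.log_nonneg hK
  have hη : 0 < c / (2 * (Real.log K + 1)) := by positivity
  have h1 : Tendsto (fun i => Real.exp (-(c / 2 * v i))) l (𝓝 0) :=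
    Real.tendsto_exp_neg_atTop_nhds_zero.comp (hv.const_mul_atTop (half_pos hc))
  refine squeeze_zero' (Eventually.of_forall fun i => by positivity) ?_ h1
  filter_upwards [huv.eventually_lt_const hη, hv.eventually_gt_atTop 0] with i hi hvi
  have h2 : (u i : ℝ) * Real.log K ≤ c / 2 * v i := by
    rw [div_lt_div_iff₀ hvi (by positivity)] at hi
    nlinarith [(u i).cast_nonneg (α := ℝ)]
  calc K ^ u i * Real.exp (-(c * v i)) =
        Real.exp (u i * Real.log K) * Real.exp (-(c * v i)) := by
        rw [← Real.log_pow, Real.exp_log (by positivity)]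
    _ = Real.exp (u i * Real.log K - c * v i) := by rw [← Real.exp_add, sub_eq_add_neg]
    _ ≤ _ := Real.exp_le_exp.2 (by linarith)

namespace LinearModel

variable {H : Type*} [NormedAddCommGroup H] [InnerProductSpace ℝ H] [MeasurableSpace H]
  [BorelSpace H] {σx : ℝ≥0} (M : LinearModel H σx)

theorem rankr_eq_zero {k : ℕ} (hk : M.eig k = 0) : M.rankr k = 0 := by
  rw [rankr, hk, div_zero]

theorem eig_pos_of_rankr_pos {k : ℕ} (hk : 0 < M.rankr k) : 0 < M.eig k :=
  (M.eig_nonneg k).lt_of_ne fun h => hk.ne' (M.rankr_eq_zero h.symm)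

theorem eig_mul_rankr {k : ℕ} (hk : 0 < M.eig k) : M.eig k * M.rankr k = M.tail k :=
  mul_div_cancel₀ _ hk.ne'

theorem rankR_pos {k : ℕ} (hk : 0 < M.eig k) : 0 < M.rankR k :=
  div_pos (pow_pos (hk.trans_le (M.eig_le_tail k)) 2)
    ((M.summable_eig_sq k).tsum_pos (fun _ => sq_nonneg _) 0 (by simpa using pow_pos hk 2))

/-- The upper constant of the design bounds with exponential rate `6 / b`. -/
noncomputable def designConst (σx : ℝ≥0) (b : ℝ) : ℝ := 4 * ((6 / b + 1) * (4 * (σx ^ 2 + 1)))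

theorem designConst_pos (σx : ℝ≥0) {b : ℝ} (hb : 0 < b) : 0 < designConst σx b := by
  unfold designConst
  positivity

/-- With L = 6/b and r_k ≥ bn the upper tail contributes 6^n exp(-3n) ≤ exp(-n), as 6 ≤ e². The
choice δ = 1/(8C + 1) meets the net condition 8Cδ² ≤ 1, and 1/(n + 1) pays for the truncation. The
label moments fail only on a null set. -/
theorem measure_badEvent_le {k n : ℕ} {b : ℝ} (hb : 0 < b) (hn : 0 < n) (hk : 0 < M.eig k)
    (hbk : b * n ≤ M.rankr k) :
    M.designLaw n (M.badEvent k n (designConst σx b) (designConst σx b + 1)) ≤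
      ENNReal.ofReal (Real.exp (-n) + (3 * (8 * designConst σx b + 1)) ^ n *
        Real.exp (-((1 / (4 * (σx ^ 2 + 1))) ^ 2 / 128 * M.rankR k))) +
      ENNReal.ofReal (1 / (n + 1)) +
      ENNReal.ofReal (6 ^ k * Real.exp (-(6 / b * n)) + (3 * (8 * designConst σx b + 1)) ^ k *
        Real.exp (-((1 / (4 * (σx ^ 2 + 1))) ^ 2 / 32 * n))) := by
  have hC := designConst_pos σx hb
  set C := designConst σx b with hCdef
  have hδ : 0 < 1 / (8 * C + 1) := by positivity
  have hδ1 : 1 / (8 * C + 1) ≤ 1 := by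
    rw [div_le_one (by positivity)]
    linarith
  have hδL : 32 * ((6 / b + 1) * (4 * (σx ^ 2 + 1))) * (1 / (8 * C + 1)) ^ 2 ≤ 1 := by
    have e : 32 * ((6 / b + 1) * (4 * ((σx : ℝ) ^ 2 + 1))) = 8 * C := by
      rw [hCdef, designConst]
      ring
    rw [e, div_pow, one_pow, mul_one_div, div_le_one (by positivity)]
    nlinarith
  have hT := M.measure_not_tailBounds_le (n := n) hk (by positivity) hδ hδ1 hδL
    (ε := 1 / ((n : ℝ) + 1)) (by positivity)
  have hHd := M.measure_not_headBounds_le (M.lt_p_of_eig_pos hk).le hn (by positivity) hδ hδ1 hδL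
  have hlab : M.designLaw n {X | ¬ ∀ᵐ θ ∂M.prior, M.LabelMoments X θ} = 0 :=
    M.ae_labelMoments n
  change M.designLaw n {X | ¬ M.TailBounds k (M.tail k / 16) ((C + 1) * M.tail k) X} ≤ _ at hT
  change M.designLaw n {X | ¬ M.HeadBounds k (n / 8) (C * n) X} ≤ _ at hHd
  have h3 : (3 : ℝ) / (1 / (8 * C + 1)) = 3 * (8 * C + 1) := by field_simp
  rw [h3] at hT hHd
  refine (measure_union_le _ _).trans (add_le_add (hT.trans ?_)
    ((measure_union_le _ _).trans (by rw [hlab, add_zero]; exact hHd)))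
  gcongr ENNReal.ofReal (?_ + _ * Real.exp (-?_)) + _
  · have h6 : (6 : ℝ) ≤ Real.exp 2 := by
      have h1 := Real.exp_one_gt_d9
      have h2 : Real.exp 2 = Real.exp 1 * Real.exp 1 := by
        rw [← Real.exp_add]
        norm_num
      nlinarith
    calc (6 : ℝ) ^ n * Real.exp (-(6 / b * (M.rankr k / 2))) ≤
          Real.exp 2 ^ n * Real.exp (-(3 * n)) := by
          gcongr ?_ ^ _ * Real.exp (-?_)
          calc (3 : ℝ) * n = 6 / b * (b * n / 2) := by field_simp; norm_num
            _ ≤ _ := by gcongr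
      _ = _ := by
          rw [← Real.exp_nat_mul, ← Real.exp_add]
          congr 1
          ring
  · apply le_of_eq
    ring

end LinearModel

/-! ### Limits along the sequence of models -/

section

variable {σx : ℝ≥0} {H : ℕ → Type*} [∀ n, NormedAddCommGroup (H n)]
    [∀ n, InnerProductSpace ℝ (H n)] [∀ n, MeasurableSpace (H n)] [∀ n, BorelSpace (H n)]
    {M : ∀ n, LinearModel (H n) σx} {b : ℝ}

/-- The infimum of a nonempty set of naturals is attained. Since `rankr` is 0 by division by zero
where the eigenvalue vanishes, a positive value places the critical index below the dimension. -/
theorem BenignOverfitting.eventually_critIndex (h : BenignOverfitting M b) (hb : 0 < b) :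
    ∀ᶠ n : ℕ in atTop, 0 < n ∧ 0 < (M n).eig ((M n).critIndex b n) ∧
      b * n ≤ (M n).rankr ((M n).critIndex b n) := by
  filter_upwards [h.finite_index, eventually_gt_atTop 0] with n hn hn0
  have h1 : b * n ≤ (M n).rankr ((M n).critIndex b n) := 
    Nat.sInf_mem (s := {k | b * n ≤ (M n).rankr k}) hn
  refine ⟨hn0, (M n).eig_pos_of_rankr_pos (lt_of_lt_of_le ?_ h1), h1⟩
  have : (0 : ℝ) < n := by exact_mod_cast hn0
  positivity

/-- Eventually n/R_k < 1, which means n < R_k because R_k is positive. -/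
theorem BenignOverfitting.tendsto_rankR (h : BenignOverfitting M b) (hb : 0 < b) :
    Tendsto (fun n => (M n).rankR ((M n).critIndex b n)) atTop atTop := by
  refine tendsto_atTop_mono' atTop ?_ tendsto_natCast_atTop_atTop
  filter_upwards [h.eventually_critIndex hb, h.rank_large.eventually_lt_const one_pos]
    with n hn h1
  exact ((div_lt_one ((M n).rankR_pos hn.2.1)).1 h1).le

theorem BenignOverfitting.tendsto_measure_badEvent (h : BenignOverfitting M b) (hb : 0 < b) :
    Tendsto (fun n => (M n).designLaw n ((M n).badEvent ((M n).critIndex b n) n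
      (LinearModel.designConst σx b) (LinearModel.designConst σx b + 1))) atTop (𝓝 0) := by
  have hC := LinearModel.designConst_pos σx hb
  have hnat : Tendsto (fun n : ℕ => (n : ℝ)) atTop atTop := tendsto_natCast_atTop_atTop
  have e1 : Tendsto (fun n : ℕ => Real.exp (-(n : ℝ))) atTop (𝓝 0) :=
    Real.tendsto_exp_neg_atTop_nhds_zero.comp hnat
  have hK : 1 ≤ 3 * (8 * LinearModel.designConst σx b + 1) := by linarith
  have e2 := tendsto_pow_mul_exp_neg hK
    (by positivity : 0 < (1 / (4 * ((σx : ℝ) ^ 2 + 1))) ^ 2 / 128)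
    h.rank_large (h.tendsto_rankR hb)
  have e3 := tendsto_pow_mul_exp_neg (by norm_num : (1 : ℝ) ≤ 6) (by positivity : 0 < 6 / b)
    h.index_small hnat
  have e4 := tendsto_pow_mul_exp_neg hK
    (by positivity : 0 < (1 / (4 * ((σx : ℝ) ^ 2 + 1))) ^ 2 / 32)
    h.index_small hnat
  have hlim := ((ENNReal.tendsto_ofReal (e1.add e2)).add (ENNReal.tendsto_ofReal
    (tendsto_one_div_add_atTop_nhds_zero_nat (𝕜 := ℝ)))).add (ENNReal.tendsto_ofReal (e3.add e4))
  simp only [add_zero, ENNReal.ofReal_zero] at hlim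
  refine tendsto_of_tendsto_of_tendsto_of_le_of_le' tendsto_const_nhds hlim
    (Eventually.of_forall fun _ => zero_le) ?_
  filter_upwards [h.eventually_critIndex hb] with n hn
  exact (M n).measure_badEvent_le hb hn.1 hn.2.1 hn.2.2

theorem BenignOverfitting.stdRisk_tendsto (h : BenignOverfitting M b) (hb : 0 < b) {B : ℝ}
    (hB : ∀ n, (M n).noise ^ 2 ≤ B) :
    TendstoZeroInProb (fun n => (M n).designLaw n) (fun n X => (M n).stdRisk (ridge 0) X) := by
  intro ε' hε'
  -- Markov's inequality needs a finite threshold, while ε' may be infinite.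
  obtain ⟨ε, hε, hε1, hεε⟩ : ∃ ε : ℝ≥0∞, ε ≠ 0 ∧ ε ≠ ∞ ∧ ε ≤ ε' :=
    ⟨min ε' 1, (lt_min hε' one_pos).ne', ((min_le_right _ _).trans_lt ENNReal.one_lt_top).ne,
      min_le_left _ _⟩
  have hC := LinearModel.designConst_pos σx hb
  set C := LinearModel.designConst σx b
  set K := LinearModel.biasConst b (C + 1)
  have hlim := (h.tendsto_measure_badEvent hb).add (ENNReal.Tendsto.div_const
    (ENNReal.tendsto_ofReal (((h.tail_signal.const_mul K).add
      ((h.head_signal.const_mul K).add (h.tail_signal.const_mul 2))).add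
      (((h.index_small.const_mul (16384 * (C + 1) ^ 2 * C)).add
        (h.rank_large.const_mul 256)).const_mul B))) (b := ε) (Or.inr hε))
  simp only [mul_zero, add_zero, ENNReal.ofReal_zero, ENNReal.zero_div] at hlim
  refine tendsto_of_tendsto_of_tendsto_of_le_of_le' tendsto_const_nhds hlim
    (Eventually.of_forall fun _ => zero_le) ?_
  filter_upwards [h.eventually_critIndex hb] with n hn
  have h1 := (LinearModel.measure_stdRisk_ge_le hn.1 hn.2.1 hb hn.2.2 hC.le
    (le_add_of_nonneg_left hC.le) (hB n) hε hε1)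
  refine ((measure_mono fun X hX => le_trans hεε hX).trans h1).trans (le_of_eq ?_)
  rw [(M n).eig_mul_rankr hn.2.1]
  rfl

theorem BenignOverfitting.advRisk_tendsto (h : BenignOverfitting M b) (hb : 0 < b)
    (hnoise : Tendsto (fun n : ℕ => (M n).noise ^ 2 /
      ((M n).eig ((M n).critIndex b n) * (M n).rankr ((M n).critIndex b n) / n)) atTop atTop)
    {α : ℕ → ℝ} (hα : ∀ n, 0 < α n) :
    TendstoInftyInProb (fun n => (M n).designLaw n)
      (fun n X => (M n).advRisk (α n) (ridge 0) X / ENNReal.ofReal (α n ^ 2)) := by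
  intro R
  have hC := LinearModel.designConst_pos σx hb
  set C := LinearModel.designConst σx b
  refine tendsto_of_tendsto_of_tendsto_of_le_of_le' tendsto_const_nhds
    (h.tendsto_measure_badEvent hb) (Eventually.of_forall fun _ => zero_le) ?_
  have hA : 0 < 16384 * (C + 1) ^ 2 * C ^ 2 := by positivity
  -- The bound on k/n leaves n/4 of the n/2 in the variance estimate, and the noise condition lifts
  -- the resulting lower bound strictly above R, so the adversarial ratio can be at most R only on
  -- the bad event.
  filter_upwards [h.eventually_critIndex hb,
    h.index_small.eventually_lt_const (by positivity : 0 < 1 / (4 * (16384 * (C + 1) ^ 2 * C ^ 2))),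
    hnoise.eventually_gt_atTop (R * (4 * (C + 1)))] with n hn hsmall hlarge
  have hn' : (0 : ℝ) < n := by exact_mod_cast hn.1
  refine measure_mono fun X hX => ?_
  by_contra hbad
  have h1 := LinearModel.le_advRisk_on_good hn.1 hn.2.1 hC.le (by linarith) (by
    rw [div_lt_div_iff₀ hn' (by positivity)] at hsmall
    linarith) (hα n) hbad
  rw [(M n).eig_mul_rankr hn.2.1, ← lt_div_iff₀ (by positivity)] at hlarge
  have h2 := h1.trans hX
  rw [← ENNReal.ofReal_coe_nnreal] at h2
  exact (not_le.2 hlarge) ((ENNReal.ofReal_le_ofReal_iff R.2).1 h2)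

end

theorem theorem1 {σx : ℝ≥0} {H : ℕ → Type*} [∀ n, NormedAddCommGroup (H n)]
    [∀ n, InnerProductSpace ℝ (H n)] [∀ n, MeasurableSpace (H n)] [∀ n, BorelSpace (H n)]
    (M : ∀ n, LinearModel (H n) σx) (b : ℝ) (hb : 0 < b) (hbenign : BenignOverfitting M b)
    (hnoise : Tendsto (fun n : ℕ => (M n).noise ^ 2 /
      ((M n).eig ((M n).critIndex b n) * (M n).rankr ((M n).critIndex b n) / n)) atTop atTop)
    (α : ℕ → ℝ) (hα : ∀ n, 0 < α n) :
    ((∃ B : ℝ, ∀ n, (M n).noise ^ 2 ≤ B) →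
      TendstoZeroInProb (fun n => (M n).designLaw n)
        (fun n X => (M n).stdRisk (ridge 0) X)) ∧
    TendstoInftyInProb (fun n => (M n).designLaw n)
      (fun n X => (M n).advRisk (α n) (ridge 0) X / ENNReal.ofReal (α n ^ 2)) :=
  ⟨fun ⟨_, hB⟩ => hbenign.stdRisk_tendsto hb hB, hbenign.advRisk_tendsto hb hnoise hα⟩
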